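/- For $x=[a_0,a_1,a_2,\dots]\ge 0$ (regular continued fraction) let $F(x)=1-2^{-a_0}+2^{-(a_0+a_1)}-2^{-(a_0+a_1+a_2)}+\cdots$ be the Minkowski question mark function (for rational $x$ the sum stops at the last partial quotient), and let $$G(z)=\int_0^\infty \frac{dF(x)}{x+1-z}.$$ For complex $p$ put $W_a(p)=p^{-1}+p^{-2}+\cdots+p^{-a}=\frac{p^a-1}{p^{a+1}-p^a}$, $$\mathfrak X(p,[a_0,a_1,a_2,\dots])=W_{a_0}(p)+\cfrac{p^{-a_0}}{W_{a_1}(p)+\cfrac{p^{-a_1}}{W_{a_2}(p)+\cdots}},\qquad G(p,z)=\int_0^\infty\frac{dF(x)}{\mathfrak X(p,x)+1-z}$$ (for rational $x$ the last partial quotient is followed by $\infty$, with $W_\infty(p)=\frac1{p-1}$ and $p^{-\infty}=0$). **Theorem.** There is a unique sequence of polynomials $B_0,B_1,B_2,\dots\in\mathbb Q[z]$ such that $B_0=-1$, $\deg B_n\le n-1$ for $n\ge1$, and the rational functions $H_n(z)=\dfrac{B_n(z)}{(z-2)^{n+1}}$ satisfy, for all $n\ge1$ and all complex $z\ne0,1$,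 $$S_n(2z,z)-\frac1{z^2}S_n\Big(\frac2z,\frac1z\Big)=2H_n(z+1)-2H_n(2z)+\frac2{z^2}H_n\Big(\frac2z\Big),$$ where $$S_n(w,u)=\sum_{j=1}^{n}\frac{2}{j!}H_{n-j}^{(j)}(w)u^j+\sum_{j=0}^{n-1}\frac1{j!}H_{n-1-j}^{(j)}(w)u^j .$$ For this sequence: 1. $B_1=0$, and $\deg B_n=n-1$ for every $n\ge2$. 2. For every $n\ge1$, $B_n(0)=0$ and $B_n(z+1)=(-1)^nz^{n-1}B_n\big(\tfrac1z+1\big)$ for all $z\neq0$. 3. The $H_n$ are the Taylor coefficients of $G(p,z)$ at $p=2$: for all $p$ near $2$ the continued fraction $\mathfrak X(p,x)$ converges for every $x\ge0$, and for every $z\ne2$ the integral defining $G(p,z)$ converges absolutely for $p$ near $2$, $p\mapsto G(p,z)$ is analytic at $p=2$, and $\frac1{n!}\frac{\partial^n}{\partial p^n}G(p,z)\big|_{p=2}=H_n(z)$ for all $n\ge0$. 4. For every $z$ with $|z|\le\frac34$ or $|z+\frac97|\le\frac{12}7$, the integral defining $G(z)$ converges absolutely, the series $\sum_{n\ge0}(-1)^nH_n(z)$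 converges absolutely, and $$G(z)=\int_0^\infty\frac{dF(x)}{x+1-z}=\sum_{n=0}^\infty(-1)^nH_n(z).$$ -/

import Mathlib

open Filter Topology MeasureTheory Polynomial

noncomputable section

/-! ### The Minkowski question mark function -/

/-- The `n`-th partial quotient `aₙ` of the regular continued fraction `x = [a₀, a₁, a₂, …]`;
it is `none` once the expansion of a rational `x` has terminated. -/
def partialQuotient (x : ℝ) (n : ℕ) : Option ℤ :=
  (GenContFract.IntFractPair.stream x n).map GenContFract.IntFractPair.b

/-- The `n`-th summand `(-1)ⁿ⁺¹ 2 ^ (-(a₀ + … + aₙ))`; it is `0` if the continued fraction of `x`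
has no `n`-th partial quotient. -/
def questionMarkTerm (x : ℝ) (n : ℕ) : ℝ :=
  if partialQuotient x n = none then 0
  else (-1) ^ (n + 1) *
    (2 : ℝ) ^ (-(∑ i ∈ Finset.range (n + 1), (partialQuotient x i).getD 0))

/-- The Minkowski question mark function
`F([a₀, a₁, a₂, …]) = 1 - 2 ^ (-a₀) + 2 ^ (-(a₀ + a₁)) - …` on `[0, ∞)`,
extended by `0` to the negative reals (it is a distribution function). -/
def questionMark (x : ℝ) : ℝ :=
  if x < 0 then 0 else 1 + ∑' n, questionMarkTerm x n

theorem partialQuotient_zero (x : ℝ) : partialQuotient x 0 = some ⌊x⌋ := by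
  simp [partialQuotient, GenContFract.IntFractPair.stream_zero, GenContFract.IntFractPair.of]

theorem partialQuotient_succ_of_fract_eq_zero {x : ℝ} (h : Int.fract x = 0) (n : ℕ) :
    partialQuotient x (n + 1) = none := by
  have hx : x = (⌊x⌋ : ℝ) := by
    have := Int.floor_add_fract x
    rw [h, add_zero] at this
    exact this.symm
  rw [partialQuotient, hx, GenContFract.IntFractPair.stream_succ_of_int]
  rfl

theorem partialQuotient_succ_of_fract_ne_zero {x : ℝ} (h : Int.fract x ≠ 0) (n : ℕ) :
    partialQuotient x (n + 1) = partialQuotient (Int.fract x)⁻¹ n := by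
  rw [partialQuotient, partialQuotient, GenContFract.IntFractPair.stream_succ h]

theorem questionMarkTerm_zero (x : ℝ) : questionMarkTerm x 0 = -(2 : ℝ) ^ (-⌊x⌋) := by
  simp [questionMarkTerm, partialQuotient_zero]

theorem questionMarkTerm_succ (x : ℝ) (n : ℕ) :
    questionMarkTerm x (n + 1) =
      if Int.fract x = 0 then 0
      else -(2 : ℝ) ^ (-⌊x⌋) * questionMarkTerm (Int.fract x)⁻¹ n := by
  split_ifs with h
  · simp [questionMarkTerm, partialQuotient_succ_of_fract_eq_zero h]
  · unfold questionMarkTerm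
    rw [partialQuotient_succ_of_fract_ne_zero h]
    split_ifs with h'
    · simp
    · rw [Finset.sum_range_succ' _ (n + 1)]
      simp only [partialQuotient_succ_of_fract_ne_zero h, partialQuotient_zero, Option.getD_some]
      rw [neg_add, zpow_add₀ (by norm_num : (2 : ℝ) ≠ 0)]
      ring

theorem two_zpow_neg_floor_le_one {x : ℝ} (hx : 0 ≤ x) : (2 : ℝ) ^ (-⌊x⌋) ≤ 1 := by
  apply zpow_le_one_of_nonpos₀ (by norm_num)
  have := Int.floor_nonneg.mpr hx
  omega

theorem two_zpow_neg_floor_le_half {x : ℝ} (hx : 1 ≤ x) : (2 : ℝ) ^ (-⌊x⌋) ≤ 1 / 2 := by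
  have h1 : (1 : ℤ) ≤ ⌊x⌋ := Int.le_floor.mpr (by simpa using hx)
  calc (2 : ℝ) ^ (-⌊x⌋) ≤ (2 : ℝ) ^ (-1 : ℤ) :=
        zpow_le_zpow_right₀ (by norm_num) (by omega)
    _ = 1 / 2 := by norm_num

theorem one_le_inv_fract {x : ℝ} (h : Int.fract x ≠ 0) : 1 ≤ (Int.fract x)⁻¹ :=
  (one_le_inv₀ (lt_of_le_of_ne (Int.fract_nonneg x) (Ne.symm h))).mpr (Int.fract_lt_one x).le

theorem abs_questionMarkTerm_le_of_one_le (n : ℕ) :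
    ∀ x : ℝ, 1 ≤ x → |questionMarkTerm x n| ≤ (1 / 2) ^ (n + 1) := by
  induction n with
  | zero =>
    intro x hx
    rw [questionMarkTerm_zero, abs_neg, abs_of_pos (by positivity)]
    simpa using two_zpow_neg_floor_le_half hx
  | succ n ih =>
    intro x hx
    rw [questionMarkTerm_succ]
    split_ifs with h
    · simp
    · rw [abs_mul, abs_neg, abs_of_pos (by positivity), pow_succ']
      exact mul_le_mul (two_zpow_neg_floor_le_half hx) (ih _ (one_le_inv_fract h))
        (abs_nonneg _) (by norm_num)

theorem abs_questionMarkTerm_le {x : ℝ} (hx : 0 ≤ x) (n : ℕ) :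
    |questionMarkTerm x n| ≤ (1 / 2) ^ n := by
  cases n with
  | zero =>
    rw [questionMarkTerm_zero, abs_neg, abs_of_pos (by positivity)]
    simpa using two_zpow_neg_floor_le_one hx
  | succ n =>
    rw [questionMarkTerm_succ]
    split_ifs with h
    · simp
    · rw [abs_mul, abs_neg, abs_of_pos (by positivity)]
      calc _ ≤ 1 * (1 / 2 : ℝ) ^ (n + 1) :=
            mul_le_mul (two_zpow_neg_floor_le_one hx)
              (abs_questionMarkTerm_le_of_one_le n _ (one_le_inv_fract h)) (abs_nonneg _)
              (by norm_num)
        _ = _ := one_mul _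

theorem summable_questionMarkTerm {x : ℝ} (hx : 0 ≤ x) : Summable (questionMarkTerm x) :=
  Summable.of_norm_bounded (g := fun n : ℕ => (1 / 2 : ℝ) ^ n)
    (summable_geometric_of_lt_one (by norm_num) (by norm_num))
    (fun n => by rw [Real.norm_eq_abs]; exact abs_questionMarkTerm_le hx n)

theorem questionMark_partial_succ (x : ℝ) (N : ℕ) :
    1 + ∑ n ∈ Finset.range (N + 1), questionMarkTerm x n =
      1 - (2 : ℝ) ^ (-⌊x⌋) * (if Int.fract x = 0 then 1 else
        1 + ∑ n ∈ Finset.range N, questionMarkTerm (Int.fract x)⁻¹ n) := by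
  rw [Finset.sum_range_succ', questionMarkTerm_zero]
  simp only [questionMarkTerm_succ]
  split_ifs with h
  · simp; ring
  · rw [← Finset.mul_sum]; ring

theorem questionMark_partial_bounds (N : ℕ) :
    ∀ x : ℝ, 0 ≤ x →
      (1 - (2 : ℝ) ^ (-⌊x⌋) ≤ 1 + ∑ n ∈ Finset.range N, questionMarkTerm x n ∧
        1 + ∑ n ∈ Finset.range N, questionMarkTerm x n ≤ 1) := by
  induction N with
  | zero =>
    intro x _
    have : (0 : ℝ) < (2 : ℝ) ^ (-⌊x⌋) := by positivity
    rw [Finset.sum_range_zero]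
    constructor <;> linarith
  | succ N ih =>
    intro x hx
    rw [questionMark_partial_succ]
    have hp : (0 : ℝ) < (2 : ℝ) ^ (-⌊x⌋) := by positivity
    split_ifs with h
    · constructor <;> linarith
    · have h1 := one_le_inv_fract h
      obtain ⟨hl, hu⟩ := ih (Int.fract x)⁻¹ (by linarith)
      have h2 := two_zpow_neg_floor_le_half h1
      constructor <;> nlinarith

theorem questionMark_partial_upper (N : ℕ) {x : ℝ} (hx : 0 ≤ x) :
    1 + ∑ n ∈ Finset.range (N + 1), questionMarkTerm x n ≤ 1 - (2 : ℝ) ^ (-(⌊x⌋ + 1)) := by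
  rw [questionMark_partial_succ]
  have hp : (0 : ℝ) < (2 : ℝ) ^ (-⌊x⌋) := by positivity
  have he : (2 : ℝ) ^ (-(⌊x⌋ + 1)) = (2 : ℝ) ^ (-⌊x⌋) * (1 / 2) := by
    rw [neg_add, zpow_add₀ (by norm_num : (2 : ℝ) ≠ 0)]
    norm_num
  rw [he]
  split_ifs with h
  · linarith
  · have h1 := one_le_inv_fract h
    obtain ⟨hl, hu⟩ := questionMark_partial_bounds N (Int.fract x)⁻¹ (by linarith)
    have h2 := two_zpow_neg_floor_le_half h1
    nlinarith

theorem questionMark_partial_mono (N : ℕ) :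
    ∀ x y : ℝ, 0 ≤ x → x ≤ y →
      1 + ∑ n ∈ Finset.range N, questionMarkTerm x n ≤
        1 + ∑ n ∈ Finset.range N, questionMarkTerm y n := by
  induction N with
  | zero => intro x y _ _; simp
  | succ N ih =>
    intro x y hx hxy
    rcases (Int.floor_mono hxy).lt_or_eq with hlt | heq
    · refine (questionMark_partial_upper N hx).trans
        (le_trans ?_ (questionMark_partial_bounds (N + 1) y (hx.trans hxy)).1)
      have : (2 : ℝ) ^ (-⌊y⌋) ≤ (2 : ℝ) ^ (-(⌊x⌋ + 1)) :=
        zpow_le_zpow_right₀ (by norm_num) (by omega)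
      linarith
    · rw [questionMark_partial_succ, questionMark_partial_succ, ← heq]
      have hp : (0 : ℝ) < (2 : ℝ) ^ (-⌊x⌋) := by positivity
      have hf : Int.fract x ≤ Int.fract y := by
        unfold Int.fract
        rw [← heq]
        linarith
      suffices hs : (if Int.fract y = 0 then (1 : ℝ) else
          1 + ∑ n ∈ Finset.range N, questionMarkTerm (Int.fract y)⁻¹ n) ≤
          (if Int.fract x = 0 then 1 else
          1 + ∑ n ∈ Finset.range N, questionMarkTerm (Int.fract x)⁻¹ n) by nlinarith
      by_cases h0 : Int.fract x = 0
      · rw [if_pos h0]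
        split_ifs with h
        · exact le_rfl
        · have h1 := one_le_inv_fract h
          exact (questionMark_partial_bounds N (Int.fract y)⁻¹ (by linarith)).2
      · have hx0 : 0 < Int.fract x := lt_of_le_of_ne (Int.fract_nonneg x) (Ne.symm h0)
        have hy0 : 0 < Int.fract y := hx0.trans_le hf
        rw [if_neg h0, if_neg hy0.ne']
        exact ih _ _ (inv_nonneg.mpr hy0.le) (inv_anti₀ hx0 hf)

theorem tendsto_questionMark_partial {x : ℝ} (hx : 0 ≤ x) :
    Tendsto (fun N => 1 + ∑ n ∈ Finset.range N, questionMarkTerm x n) atTop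
      (𝓝 (questionMark x)) := by
  rw [questionMark, if_neg (not_lt.mpr hx)]
  exact (summable_questionMarkTerm hx).hasSum.tendsto_sum_nat.const_add 1

theorem questionMark_monotone : Monotone questionMark := by
  intro x y hxy
  rcases lt_or_ge x 0 with hx | hx
  · rw [questionMark, if_pos hx]
    rcases lt_or_ge y 0 with hy | hy
    · rw [questionMark, if_pos hy]
    · refine ge_of_tendsto' (tendsto_questionMark_partial hy) fun N => ?_
      have h1 := (questionMark_partial_bounds N y hy).1
      have h2 := two_zpow_neg_floor_le_one hy
      linarith
  · exact le_of_tendsto_of_tendsto' (tendsto_questionMark_partial hx)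
      (tendsto_questionMark_partial (hx.trans hxy))
      fun N => questionMark_partial_mono N x y hx hxy

/-- The Lebesgue–Stieltjes measure `dF` of the Minkowski question mark function. -/
def questionMarkMeasure : Measure ℝ := questionMark_monotone.stieltjesFunction.measure

/-- The dyadic period function `G(z) = ∫₀^∞ dF(x) / (x + 1 - z)`. -/
def dyadicPeriod (z : ℂ) : ℂ :=
  ∫ x in Set.Ici (0 : ℝ), 1 / ((x : ℂ) + 1 - z) ∂questionMarkMeasure

/-! ### `p`-continued fractions and the functions `G(p, z)` -/

/-- `W_a(p) = (pᵃ - 1) / (pᵃ⁺¹ - pᵃ) = p⁻¹ + p⁻² + ⋯ + p⁻ᵃ`. -/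
def pWeight (p : ℂ) (a : ℕ) : ℂ := ∑ j ∈ Finset.range a, (p ^ (j + 1))⁻¹

/-- The `n`-th convergent
`W_{a₀}(p) + p ^ (-a₀) / (W_{a₁}(p) + p ^ (-a₁) / (W_{a₂}(p) + ⋯))` of the `p`-continued fraction
attached to `x = [a₀, a₁, a₂, …] ≥ 0`; the last partial quotient `a_k` of a rational number is
followed by the partial quotient `∞`, where `W_∞(p) = 1 / (p - 1)` and `p ^ (-∞) = 0`. -/
def pConvergent (p : ℂ) : ℕ → ℝ → ℂ
  | 0, x => pWeight p ⌊x⌋₊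
  | n + 1, x => pWeight p ⌊x⌋₊ + (p ^ ⌊x⌋₊)⁻¹ *
      (if Int.fract x = 0 then p - 1 else (pConvergent p n (Int.fract x)⁻¹)⁻¹)

/-- `𝔛(p, x) = [a₀, a₁, a₂, …]_p` for `x = [a₀, a₁, a₂, …] ≥ 0`. -/
def pContFract (p : ℂ) (x : ℝ) : ℂ := limUnder atTop fun n => pConvergent p n x

/-- `G(p, z) = ∫₀^∞ dF(x) / (𝔛(p, x) + 1 - z)`. -/
def pPeriod (p z : ℂ) : ℂ :=
  ∫ x in Set.Ici (0 : ℝ), 1 / (pContFract p x + 1 - z) ∂questionMarkMeasure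

/-! ### The rational functions `Hₙ` -/

/-- `Hₙ(z) = Bₙ(z) / (z - 2)ⁿ⁺¹`. -/
def ratH (B : ℕ → ℚ[X]) (n : ℕ) (z : ℂ) : ℂ := aeval z (B n) / (z - 2) ^ (n + 1)

/-- `∑_{j=1}^{n} (2/j!) H_{n-j}^{(j)}(w) uʲ + ∑_{j=0}^{n-1} (1/j!) H_{n-1-j}^{(j)}(w) uʲ`. -/
def ratHSum (B : ℕ → ℚ[X]) (n : ℕ) (w u : ℂ) : ℂ :=
  ∑ j ∈ Finset.Icc 1 n, 2 / (j.factorial : ℂ) * iteratedDeriv j (ratH B (n - j)) w * u ^ j +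
    ∑ j ∈ Finset.range n,
      1 / (j.factorial : ℂ) * iteratedDeriv j (ratH B (n - 1 - j)) w * u ^ j

/-- The recurrence defining the polynomials `Bₙ`: `B₀ = -1`, and for `n ≥ 1` the polynomial `Bₙ`
has degree at most `n - 1` and `Hₙ` solves the three term functional equation whose left hand
side is built from `H₀, …, Hₙ₋₁`. -/
structure IsRatHRecurrence (B : ℕ → ℚ[X]) : Prop where
  zero : B 0 = -1
  degree_lt : ∀ n : ℕ, 1 ≤ n → (B n).degree < n
  funEq : ∀ n : ℕ, 1 ≤ n → ∀ z : ℂ, z ≠ 0 → z ≠ 1 →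
    ratHSum B n (2 * z) z - 1 / z ^ 2 * ratHSum B n (2 / z) (1 / z) =
      2 * ratH B n (z + 1) - 2 * ratH B n (2 * z) + 2 / z ^ 2 * ratH B n (2 / z)

end

/-! The measure `dF` is invariant under averaging over `x ↦ x + 1` and `x ↦ x / (x + 1)`, and `𝔛(p,
·)` conjugates these two maps to `stepF p` and `stepG p`. Hence `G(p, z)` is the limit of
`wordPeriod N p z`, the average of `1 / (X + 1 - z)` over the images `X` of `1` under the `2 ^ N`
words in the two maps. At `p = 1` the maps are the original ones, so the averages tend to `G(z)`.
The series `∑ (-1)ⁿ Hₙ(z)` is the Taylor series at `p = 2` evaluated at `p = 1`, and the task is to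
interchange it with the limit in `N`.

Near `p = 2` everything is explicit. In the coordinate `v = (X - 1) / (X + 1)` both maps contract by
`21 / 25`, the values of `𝔛(p, ·)` satisfy `‖v‖ ≤ ‖p - 2‖`, and `X ↦ X⁻¹` is `v ↦ -v`. Expanding the
kernel in powers of `v` expresses the Taylor coefficients through the moments of `v`; odd moments
vanish and the `k`-th moment vanishes to order `k` at `2`. This yields the polynomials `periodPoly`,
their degree bound, their zero at `0` and their reciprocity. The mean of `𝔛(p, ·)` is a rational
function of `p`, which gives the leading coefficients. Self-similarity yields a functional equation
for `G(p, z)` whose Taylor coefficients are the recurrence (`periodCoeff_funEq`). The homogeneous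
equation has no nonzero solution, by comparing leading terms of the poles at `z = 1`
(`homogeneous_funEq_unique`); this gives uniqueness and, through a `ℚ`-linear projection `ℂ → ℚ`,
rational coefficients.

The interchange rests on a region preserved for all `‖p - 2‖ ≤ 1`. The disc `‖Z - 2‖ ≤ √5` is the
inverse of the exterior of `‖Y + 2‖ < √5`, and every iterate of `stepF p` maps the former into the
latter, with a margin (`stepF_iterate_norm_lower`). So all word images avoid `z - 1`. Thanks to the
margin, a word whose runs have length at most `A` is harmless on the larger disc of radius `1 + 1 /
(5000 A²)`, while words with longer runs have proportion at most `N 2 ^ (-A)`. Cauchy estimates with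
`A` of order `log n` bound the `n`-th coefficient by `O(n⁻²)` if `N = O(n)`; for larger `N` the
geometric convergence near `p = 2` takes over. The resulting bound is summable and independent of
`N`, and dominated convergence concludes (`exists_dominating_sequence`, `hasSum_periodCoeff`). -/

/-! ### Nonnegativity of the spiral form while the angle of `p ^ a` is at most `π` -/

/-- The quadratic form whose nonnegativity expresses that the image of the disc `‖Z - 2‖² ≤ 5`
under the `a`-th iterate of `X ↦ (1 + X) / p` stays away from the disc `‖Y + 2‖² ≤ 5`; here
`p = 1 + R + i I`, `T = ‖p‖ ^ a` and `c`, `s` are the cosine and sine of the argument of `p ^ a`. -/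
noncomputable def spiralForm (R I T c s : ℝ) : ℝ :=
  (T + T⁻¹) * (1 - 51 / 50 * (R ^ 2 + I ^ 2)) + 4 * R * (T - T⁻¹)
    - 2 * c * (1 - 4 * (R ^ 2 + I ^ 2)) + 8 * I * s - 10 * (R ^ 2 + I ^ 2)

/-- The forcing term in the three term recurrence of `spiralForm` along the powers of `p`. -/
noncomputable def spiralForce (q R I T : ℝ) : ℝ :=
  ((T + T⁻¹) * (1 - 51 / 50 * (R ^ 2 + I ^ 2)) + 4 * R * (T - T⁻¹)) / q

/-- The terms in `c` and `s` satisfy the recurrence of `cos (jφ)` exactly. The hyperbolic and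
constant terms leave a defect divisible by `‖p - 1‖²`, because `q + q⁻¹ - 2 cos φ = ‖p - 1‖² / q`.
-/
theorem spiralForm_recurrence {q φ : ℝ} (hq : 0 < q) (j : ℕ) :
    spiralForm (q * Real.cos φ - 1) (q * Real.sin φ) (q ^ (j + 2))
        (Real.cos ((j + 2 : ℕ) * φ)) (Real.sin ((j + 2 : ℕ) * φ)) =
      2 * Real.cos φ * spiralForm (q * Real.cos φ - 1) (q * Real.sin φ) (q ^ (j + 1))
        (Real.cos ((j + 1 : ℕ) * φ)) (Real.sin ((j + 1 : ℕ) * φ))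
      - spiralForm (q * Real.cos φ - 1) (q * Real.sin φ) (q ^ j)
        (Real.cos (j * φ)) (Real.sin (j * φ))
      + ((q * Real.cos φ - 1) ^ 2 + (q * Real.sin φ) ^ 2) *
        (spiralForce q (q * Real.cos φ - 1) (q * Real.sin φ) (q ^ (j + 1))
          - 20 * (1 - Real.cos φ)) := by
  have h1 : ((j + 2 : ℕ) : ℝ) * φ = (j + 1 : ℕ) * φ + φ := by push_cast; ring
  have h2 : (j : ℝ) * φ = (j + 1 : ℕ) * φ - φ := by push_cast; ring
  have h3 : q ^ (j + 2) = q ^ (j + 1) * q := by ring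
  have h4 : q ^ j = q ^ (j + 1) * q⁻¹ := by field_simp; ring
  rw [h1, h2, h3, h4, Real.cos_add, Real.sin_add, Real.cos_sub, Real.sin_sub]
  have hT : q ^ (j + 1) ≠ 0 := by positivity
  generalize q ^ (j + 1) = T at *
  generalize Real.cos ((j + 1 : ℕ) * φ) = c
  generalize Real.sin ((j + 1 : ℕ) * φ) = s
  have hs : Real.sin φ ^ 2 = 1 - Real.cos φ ^ 2 := Real.sin_sq φ
  generalize Real.cos φ = k at *
  generalize Real.sin φ = l at *
  have hr : (q * k - 1) ^ 2 + (q * l) ^ 2 = q ^ 2 - 2 * q * k + 1 := by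
    rw [mul_pow q l, hs]; ring
  unfold spiralForm spiralForce
  rw [hr]
  field_simp
  ring

/-- For given `q` and `T` the force decreases in `R² + I²`, after `4R` is eliminated by `hP`; the
worst case allowed by `hr` is `R² + I² = (q² - 1) / 2`. -/
theorem spiralForce_lower {q R I T : ℝ} (hq : 1 ≤ q)
    (hP : q ^ 2 = 1 + 2 * R + (R ^ 2 + I ^ 2)) (hr : R ^ 2 + I ^ 2 ≤ 2 * R) (hT : 1 ≤ T) :
    T * (1 + 49 / 100 * (q ^ 2 - 1)) + T⁻¹ * (1 - 151 / 100 * (q ^ 2 - 1)) ≤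
      q * spiralForce q R I T := by
  have hT' : 0 < T⁻¹ := by positivity
  have hT1 : T⁻¹ ≤ 1 := inv_le_one_of_one_le₀ hT
  have : q * spiralForce q R I T =
    (T + T⁻¹) * (1 - 51 / 50 * (R ^ 2 + I ^ 2)) + 4 * R * (T - T⁻¹) := by
    unfold spiralForce; field_simp
  rw [this]
  have h1 : R ^ 2 + I ^ 2 ≤ (q ^ 2 - 1) / 2 := by linarith
  have h2 : 4 * R = 2 * (q ^ 2 - 1) - 2 * (R ^ 2 + I ^ 2) := by linarith
  rw [h2]
  nlinarith [mul_nonneg (sub_nonneg.2 h1) (by linarith : 0 ≤ T + T⁻¹),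
    mul_nonneg (sub_nonneg.2 h1) (by linarith : 0 ≤ T - T⁻¹)]

theorem spiralForce_lower_mono {q T T' : ℝ} (hq : 1 ≤ q) (hT : 1 ≤ T) (hTT : T ≤ T') :
    T * (1 + 49 / 100 * (q ^ 2 - 1)) + T⁻¹ * (1 - 151 / 100 * (q ^ 2 - 1)) ≤
    T' * (1 + 49 / 100 * (q ^ 2 - 1)) + T'⁻¹ * (1 - 151 / 100 * (q ^ 2 - 1)) := by
  have hq2 : 0 ≤ q ^ 2 - 1 := by nlinarith
  have h1 : T⁻¹ - T'⁻¹ ≤ T' - T := by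
    have hT0 : 0 < T' := by linarith
    have hT1 : 0 < T := by linarith
    have : T⁻¹ - T'⁻¹ = (T' - T) * (T⁻¹ * T'⁻¹) := by field_simp
    rw [this]
    have a1 : T⁻¹ ≤ 1 := inv_le_one_of_one_le₀ hT
    have a2 : T'⁻¹ ≤ 1 := inv_le_one_of_one_le₀ (hT.trans hTT)
    have a3 : 0 < T'⁻¹ := by positivity
    have : T⁻¹ * T'⁻¹ ≤ 1 := mul_le_one₀ a1 a3.le a2
    nlinarith
  have h2 : 0 ≤ T⁻¹ - T'⁻¹ := sub_nonneg.2 (inv_anti₀ (by linarith) hTT)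
  nlinarith

/-- The hypothesis `hk`, used throughout this part, is `‖p - 2‖ ≤ 1` in polar coordinates `p = q
exp(iφ)`. -/
theorem sector_cos_lower {q φ : ℝ} (hk : q ^ 2 + 3 ≤ 4 * (q * Real.cos φ)) : 20 * (q * (1 - Real.cos φ)) ≤ 5 * ((q - 1) * (3 - q)) := by
  nlinarith

theorem sector_cos_lower' {q φ : ℝ} (hq : 1 ≤ q) (hk : q ^ 2 + 3 ≤ 4 * (q * Real.cos φ)) : 20 * (1 - Real.cos φ) ≤ 27 / 10 := by
  have := sector_cos_lower hk
  have h2 : q * (20 * (1 - Real.cos φ)) ≤ q * (27 / 10) := by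
    -- The maximum of `5 (q - 1) (3 - q) / q` is `5 (4 - 2√3) < 2.7`, at `q = √3`.
    nlinarith [sq_nonneg (q - 1.73)]
  exact le_of_mul_le_mul_left h2 (by linarith)

theorem sector_sq (q φ : ℝ) : q ^ 2 = 1 + 2 * (q * Real.cos φ - 1) +
    ((q * Real.cos φ - 1) ^ 2 + (q * Real.sin φ) ^ 2) := by
  rw [mul_pow q (Real.sin φ), Real.sin_sq]; ring

theorem sector_radius {q φ : ℝ} (hk : q ^ 2 + 3 ≤ 4 * (q * Real.cos φ)) :
    (q * Real.cos φ - 1) ^ 2 + (q * Real.sin φ) ^ 2 ≤ 2 * (q * Real.cos φ - 1) := by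
  rw [mul_pow q (Real.sin φ), Real.sin_sq]; nlinarith

/-- For `a = 1` the form is `‖p - 1‖² / q` times a factor which the disc condition bounds below by a
quadratic in `q` without real zeros, minimal near `q = 5 / 2`. -/
theorem spiralForm_one_nonneg {q φ : ℝ} (hq : 1 ≤ q) (hk : q ^ 2 + 3 ≤ 4 * (q * Real.cos φ)) :
    0 ≤ spiralForm (q * Real.cos φ - 1) (q * Real.sin φ) (q ^ 1)
        (Real.cos ((1 : ℕ) * φ)) (Real.sin ((1 : ℕ) * φ)) := by
  have hr := sector_sq q φ
  have hr0 : 0 ≤ (q * Real.cos φ - 1) ^ 2 + (q * Real.sin φ) ^ 2 := by positivity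
  have key : q * spiralForm (q * Real.cos φ - 1) (q * Real.sin φ) (q ^ 1)
        (Real.cos ((1 : ℕ) * φ)) (Real.sin ((1 : ℕ) * φ)) =
      ((q * Real.cos φ - 1) ^ 2 + (q * Real.sin φ) ^ 2) *
        (16 + 12 * (q * Real.cos φ - 1) - q ^ 2 - 10 * q - 1 / 50 * (q ^ 2 + 1)) := by
    unfold spiralForm
    have hs : Real.sin φ ^ 2 = 1 - Real.cos φ ^ 2 := Real.sin_sq φ
    simp only [Nat.cast_one, one_mul, pow_one]
    generalize Real.cos φ = k at *
    generalize Real.sin φ = l at *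
    have hr : (q * k - 1) ^ 2 + (q * l) ^ 2 = q ^ 2 - 2 * q * k + 1 := by
      rw [mul_pow q l, hs]; ring
    have hl : 8 * (q * l) * l = 8 * q * (1 - k ^ 2) := by rw [← hs]; ring
    rw [hr, hl]
    field_simp
    ring
  have : 0 ≤ 16 + 12 * (q * Real.cos φ - 1) - q ^ 2 - 10 * q - 1 / 50 * (q ^ 2 + 1) := by
    nlinarith [sq_nonneg (q - 5 / 2)]
  have h0 := mul_nonneg hr0 this
  rw [← key] at h0
  exact nonneg_of_mul_nonneg_right h0 (by linarith)

theorem spiralForce_nonneg {q φ : ℝ} (hq : 1 ≤ q) (hk : q ^ 2 + 3 ≤ 4 * (q * Real.cos φ)) (k : ℕ) :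
    0 ≤ spiralForce q (q * Real.cos φ - 1) (q * Real.sin φ) (q ^ (k + 1)) := by
  have h := spiralForce_lower (T := q ^ (k + 1)) hq (sector_sq q φ)
    (sector_radius hk) (one_le_pow₀ hq)
  have h2 := spiralForce_lower_mono (T := q) (T' := q ^ (k + 1)) hq hq
    (le_self_pow₀ hq (by omega))
  have h3 : 0 ≤ q * (1 + 49 / 100 * (q ^ 2 - 1)) + q⁻¹ * (1 - 151 / 100 * (q ^ 2 - 1)) := by
    have : q * (1 + 49 / 100 * (q ^ 2 - 1)) + q⁻¹ * (1 - 151 / 100 * (q ^ 2 - 1)) =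
      q⁻¹ * (q ^ 2 * (1 + 49 / 100 * (q ^ 2 - 1)) + (1 - 151 / 100 * (q ^ 2 - 1))) := by
      field_simp
    rw [this]
    apply mul_nonneg (by positivity)
    nlinarith [sq_nonneg (q ^ 2 - 1)]
  exact nonneg_of_mul_nonneg_right (h3.trans (h2.trans h)) (by linarith)

theorem spiralForce_two {q φ : ℝ} (hq : 1 ≤ q) (hk : q ^ 2 + 3 ≤ 4 * (q * Real.cos φ)) :
    20 * (1 - Real.cos φ) - 6 / 10 ≤
      spiralForce q (q * Real.cos φ - 1) (q * Real.sin φ) (q ^ 2) := by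
  have h := spiralForce_lower (T := q ^ 2) hq (sector_sq q φ)
    (sector_radius hk) (one_le_pow₀ hq)
  have h2 := sector_cos_lower hk
  have h3 : 5 * ((q - 1) * (3 - q)) - 6 / 10 * q ≤
      q ^ 2 * (1 + 49 / 100 * (q ^ 2 - 1)) + (q ^ 2)⁻¹ * (1 - 151 / 100 * (q ^ 2 - 1)) := by
    have : q ^ 2 * (1 + 49 / 100 * (q ^ 2 - 1)) + (q ^ 2)⁻¹ * (1 - 151 / 100 * (q ^ 2 - 1)) =
      (q ^ 2)⁻¹ * (q ^ 4 * (1 + 49 / 100 * (q ^ 2 - 1)) + (1 - 151 / 100 * (q ^ 2 - 1))) := by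
      field_simp
    rw [this, inv_mul_eq_div, le_div_iff₀ (by positivity)]
    obtain ⟨x, rfl⟩ : ∃ x, q = 1 + x := ⟨q - 1, by ring⟩
    have hx : 0 ≤ x := by linarith
    nlinarith [mul_nonneg hx (sq_nonneg (x - 0.4)), mul_nonneg hx (sq_nonneg (x ^ 2 - 0.2)),
      sq_nonneg (x - 0.4), sq_nonneg (x^2 - 0.16), pow_nonneg hx 3, pow_nonneg hx 5,
      mul_nonneg (sq_nonneg x) (sq_nonneg (x - 0.4))]
  have h4 : q * (20 * (1 - Real.cos φ) - 6 / 10) ≤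
      q * spiralForce q (q * Real.cos φ - 1) (q * Real.sin φ) (q ^ 2) := by linarith
  exact le_of_mul_le_mul_left h4 (by linarith)

theorem spiralForce_three {q φ : ℝ} (hq : 1 ≤ q) (hk : q ^ 2 + 3 ≤ 4 * (q * Real.cos φ)) (k : ℕ) :
    20 * (1 - Real.cos φ) ≤
      spiralForce q (q * Real.cos φ - 1) (q * Real.sin φ) (q ^ (k + 3)) := by
  have h := spiralForce_lower (T := q ^ (k + 3)) hq (sector_sq q φ)
    (sector_radius hk) (one_le_pow₀ hq)
  have h1 := spiralForce_lower_mono (T := q ^ 3) (T' := q ^ (k + 3)) hq (one_le_pow₀ hq)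
    (pow_le_pow_right₀ hq (by omega))
  have h2 := sector_cos_lower hk
  have h3 : 5 * ((q - 1) * (3 - q)) ≤
      q ^ 3 * (1 + 49 / 100 * (q ^ 2 - 1)) + (q ^ 3)⁻¹ * (1 - 151 / 100 * (q ^ 2 - 1)) := by
    have : q ^ 3 * (1 + 49 / 100 * (q ^ 2 - 1)) + (q ^ 3)⁻¹ * (1 - 151 / 100 * (q ^ 2 - 1)) =
      (q ^ 3)⁻¹ * (q ^ 6 * (1 + 49 / 100 * (q ^ 2 - 1)) + (1 - 151 / 100 * (q ^ 2 - 1))) := by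
      field_simp
    rw [this, inv_mul_eq_div, le_div_iff₀ (by positivity)]
    obtain ⟨x, rfl⟩ : ∃ x, q = 1 + x := ⟨q - 1, by ring⟩
    have hx : 0 ≤ x := by linarith
    nlinarith [mul_nonneg hx (sq_nonneg (x - 0.4)), mul_nonneg hx (sq_nonneg (x ^ 2 - 0.2)),
      sq_nonneg (x - 0.4), sq_nonneg (x^2 - 0.16), pow_nonneg hx 3, pow_nonneg hx 5,
      mul_nonneg (sq_nonneg x) (sq_nonneg (x - 0.4)), pow_nonneg hx 4, pow_nonneg hx 6,
      pow_nonneg hx 7, pow_nonneg hx 8]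
  have h4 : q * (20 * (1 - Real.cos φ)) ≤
      q * spiralForce q (q * Real.cos φ - 1) (q * Real.sin φ) (q ^ (k + 3)) := by linarith
  exact le_of_mul_le_mul_left h4 (by linarith)

theorem spiralForm_zero (q φ : ℝ) :
    spiralForm (q * Real.cos φ - 1) (q * Real.sin φ) (q ^ 0)
        (Real.cos ((0 : ℕ) * φ)) (Real.sin ((0 : ℕ) * φ)) =
      -(101 / 25) * ((q * Real.cos φ - 1) ^ 2 + (q * Real.sin φ) ^ 2) := by
  simp [spiralForm]; ring

/-- The Wronskian of `k ↦ spiralForm` and `k ↦ sin (k φ)` is nonnegative up to angle `π`. -/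
theorem spiral_wronskian_nonneg {q φ : ℝ} (hq : 1 ≤ q) (hk : q ^ 2 + 3 ≤ 4 * (q * Real.cos φ))
    (hφ : 0 ≤ φ) (hφπ : φ ≤ Real.pi) {G : ℕ → ℝ}
    (hG : ∀ a : ℕ, G a = spiralForm (q * Real.cos φ - 1) (q * Real.sin φ) (q ^ a)
        (Real.cos (a * φ)) (Real.sin (a * φ))) (k : ℕ) (hkφ : (k : ℝ) * φ ≤ Real.pi) :
    0 ≤ G (k + 1) * Real.sin (k * φ) - G k * Real.sin ((k + 1 : ℕ) * φ) := by
  set r := (q * Real.cos φ - 1) ^ 2 + (q * Real.sin φ) ^ 2 with hr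
  have hr0 : 0 ≤ r := by rw [hr]; positivity
  have hs : 0 ≤ Real.sin φ := Real.sin_nonneg_of_nonneg_of_le_pi hφ hφπ
  have hrs := mul_nonneg hr0 hs
  set W : ℕ → ℝ := fun k => G (k + 1) * Real.sin (k * φ) - G k * Real.sin ((k + 1 : ℕ) * φ)
    with hW
  set fc : ℕ → ℝ := fun k => spiralForce q (q * Real.cos φ - 1) (q * Real.sin φ) (q ^ k)
    - 20 * (1 - Real.cos φ) with hfc
  -- `sin (kφ)` solves the homogeneous recurrence, so only the forcing term changes the Wronskian.
  have hstep : ∀ k, W (k + 1) = W k + r * fc (k + 1) * Real.sin ((k + 1 : ℕ) * φ) := by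
    intro k
    have h := spiralForm_recurrence (q := q) (φ := φ) (by linarith) k
    rw [← hG, ← hG, ← hG, ← hr] at h
    have h1 : Real.sin ((k + 2 : ℕ) * φ) =
        2 * Real.cos φ * Real.sin ((k + 1 : ℕ) * φ) - Real.sin (k * φ) := by
      have a1 : ((k + 2 : ℕ) : ℝ) * φ = (k + 1 : ℕ) * φ + φ := by push_cast; ring
      have a2 : (k : ℝ) * φ = (k + 1 : ℕ) * φ - φ := by push_cast; ring
      rw [a1, a2, Real.sin_add, Real.sin_sub]; ring
    simp only [hW, hfc]
    rw [show k + 1 + 1 = k + 2 from rfl, h, h1]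
    ring
  -- The forcing can be negative only at the first two steps, by at most `2.7` and `0.6`. In units
  -- of `r sin φ` the Wronskian starts at `4.04`, is at least `1.34` after one step and at least
  -- `1.34 - 2 · 0.6 > 0` after two.
  have h0 : W 0 = 101 / 25 * (r * Real.sin φ) := by
    have : G 0 = -(101 / 25) * r := by rw [hG, hr, spiralForm_zero]
    simp [hW, this]; ring
  have h1 : 134 / 100 * (r * Real.sin φ) ≤ W 1 := by
    rw [hstep 0, h0]
    have a1 := spiralForce_nonneg hq hk 0
    have a2 := sector_cos_lower' hq hk
    have : -(27 / 10) ≤ fc 1 := by simp only [hfc, zero_add] at *; linarith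
    have a3 := mul_le_mul_of_nonneg_left this hrs
    simp only [zero_add, Nat.cast_one, one_mul]
    linarith
  have h2 : 2 * φ ≤ Real.pi → 0 ≤ W 2 := by
    intro h2φ
    have e : W 2 = W 1 + r * fc 2 * Real.sin ((2 : ℕ) * φ) := hstep 1
    rw [e]
    have a1 := spiralForce_two hq hk
    have : -(6 / 10) ≤ fc 2 := by simp only [hfc] at *; linarith
    have a2 : Real.sin ((2 : ℕ) * φ) ≤ 2 * Real.sin φ := by
      push_cast
      rw [Real.sin_two_mul]
      nlinarith [Real.cos_le_one φ]
    have a4 : 0 ≤ Real.sin ((2 : ℕ) * φ) := by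
      apply Real.sin_nonneg_of_nonneg_of_le_pi (by positivity)
      push_cast; linarith
    have a3 := mul_le_mul_of_nonneg_right this (mul_nonneg hr0 a4)
    have a5 := mul_le_mul_of_nonneg_left a2 hr0
    generalize Real.sin ((2 : ℕ) * φ) = S at *
    linarith
  have h3 : ∀ k : ℕ, ((k + 2 : ℕ) : ℝ) * φ ≤ Real.pi → 0 ≤ W (k + 2) := by
    intro k
    induction k with
    | zero => intro h; exact h2 (by simpa using h)
    | succ k ih =>
      intro h
      have hle : ((k + 2 : ℕ) : ℝ) * φ ≤ Real.pi := by
        refine le_trans ?_ h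
        gcongr; omega
      rw [hstep (k + 2)]
      have a1 := spiralForce_three hq hk k
      have a2 : 0 ≤ fc (k + 2 + 1) := by simp only [hfc]; linarith
      have a3 : 0 ≤ Real.sin ((k + 2 + 1 : ℕ) * φ) :=
        Real.sin_nonneg_of_nonneg_of_le_pi (by positivity) h
      have := mul_nonneg (mul_nonneg hr0 a2) a3
      linarith [ih hle]
  rcases k with _ | _ | k
  · change 0 ≤ W 0
    rw [h0]; positivity
  · change 0 ≤ W 1
    linarith
  · exact h3 k hkφ

/-- Discrete Sturm comparison: a nonnegative Wronskian says that the quotient of the form by `sin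
(aφ)` does not decrease as long as the sines are positive, so nonnegativity propagates from `a = 1`.
-/
theorem spiralForm_nonneg_of_le_pi {q φ : ℝ} (hq : 1 ≤ q)
    (hk : q ^ 2 + 3 ≤ 4 * (q * Real.cos φ)) (hφ : 0 < φ) (a : ℕ) (ha : 1 ≤ a)
    (haφ : (a : ℝ) * φ ≤ Real.pi) :
    0 ≤ spiralForm (q * Real.cos φ - 1) (q * Real.sin φ) (q ^ a)
        (Real.cos (a * φ)) (Real.sin (a * φ)) := by
  induction a, ha using Nat.le_induction with
  | base => exact spiralForm_one_nonneg hq hk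
  | succ a ha ih =>
    have ha0 : (1 : ℝ) ≤ a := by exact_mod_cast ha
    have hlt : (a : ℝ) * φ < Real.pi := by
      push_cast at haφ; linarith
    have hφπ : φ ≤ Real.pi := by nlinarith
    have h := spiral_wronskian_nonneg hq hk hφ.le hφπ (fun _ => rfl) a hlt.le
    have h1 := ih hlt.le
    have h2 : 0 < Real.sin (a * φ) :=
      Real.sin_pos_of_pos_of_lt_pi (by positivity) hlt
    have h3 : 0 ≤ Real.sin ((a + 1 : ℕ) * φ) :=
      Real.sin_nonneg_of_nonneg_of_le_pi (by positivity) haφ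
    have h4 := mul_nonneg h1 h3
    exact nonneg_of_mul_nonneg_left (by linarith) h2

/-- On the real axis the form does not decrease as `T` grows from `q` to `q ^ a`, which reduces the
claim to `a = 1`. -/
theorem spiralForm_nonneg_real {q : ℝ} (hq : 1 ≤ q) (hq3 : q ≤ 3) (a : ℕ) (ha : 1 ≤ a) :
    0 ≤ spiralForm (q - 1) 0 (q ^ a) 1 0 := by
  have h1 := spiralForm_one_nonneg (φ := 0) hq (by simp; nlinarith)
  simp only [Real.cos_zero, Real.sin_zero, mul_one, mul_zero, pow_one] at h1
  refine h1.trans ?_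
  have hT : q ≤ q ^ a := le_self_pow₀ hq (by omega)
  generalize q ^ a = T at *
  have hT0 : 0 < T := by linarith
  have hq0 : 0 < q := by linarith
  have hi : q⁻¹ - T⁻¹ = (T - q) * (q⁻¹ * T⁻¹) := by field_simp
  have hi1 : q⁻¹ * T⁻¹ ≤ 1 :=
    mul_le_one₀ (inv_le_one_of_one_le₀ hq) (by positivity) (inv_le_one_of_one_le₀ (hq.trans hT))
  have hi2 : q⁻¹ - T⁻¹ ≤ T - q := by
    rw [hi]; nlinarith
  have hi3 : 0 ≤ q⁻¹ - T⁻¹ := sub_nonneg.2 (inv_anti₀ hq0 hT)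
  unfold spiralForm
  obtain ⟨x, rfl⟩ : ∃ x, q = 1 + x := ⟨q - 1, by ring⟩
  have hx : 0 ≤ x := by linarith
  have hx2 : x ≤ 2 := by linarith
  nlinarith [mul_nonneg hx (sub_nonneg.2 hi2), mul_nonneg hx hi3, mul_nonneg hx (sub_nonneg.2 hT),
    mul_nonneg (sq_nonneg x) hi3, mul_nonneg (mul_nonneg hx (sub_nonneg.2 hx2)) (sub_nonneg.2 hT),
    mul_nonneg (mul_nonneg hx (sub_nonneg.2 hx2)) hi3]

/-! ### Nonnegativity of the spiral form beyond angle `π` -/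

theorem two_cosh_lower (s : ℝ) : 2 + s ^ 2 + s ^ 4 / 12 ≤ Real.exp s + (Real.exp s)⁻¹ := by
  have h := Real.hasSum_cosh s
  have h1 := sum_le_hasSum (Finset.range 3) (fun i _ => by
    have : 0 ≤ s ^ (2 * i) := by rw [pow_mul]; positivity
    positivity) h
  rw [Real.cosh_eq] at h1
  simp [Finset.sum_range_succ, Nat.factorial] at h1
  rw [← Real.exp_neg]
  linarith

theorem two_sinh_lower {s : ℝ} (hs : 0 ≤ s) :
    2 * s + s ^ 3 / 3 ≤ Real.exp s - (Real.exp s)⁻¹ := by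
  have h := Real.hasSum_sinh s
  have h1 := sum_le_hasSum (Finset.range 2) (fun i _ => by positivity) h
  rw [Real.sinh_eq] at h1
  simp [Finset.sum_range_succ, Nat.factorial] at h1
  rw [← Real.exp_neg]
  linarith

theorem exp_lower_quartic {s : ℝ} (hs : 0 ≤ s) :
    1 + s + s ^ 2 / 2 + s ^ 3 / 6 + s ^ 4 / 24 ≤ Real.exp s := by
  have h := Real.sum_le_exp_of_nonneg hs 5
  simp [Finset.sum_range_succ, Nat.factorial] at h
  linarith

/-- The tangents from the origin to the disc `‖p - 2‖ ≤ 1` make an angle `π / 6` with the real axis.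
-/
theorem sector_angle_le {q φ : ℝ} (hq : 1 ≤ q) (hk : q ^ 2 + 3 ≤ 4 * (q * Real.cos φ))
    (hφπ : φ ≤ Real.pi) : φ ≤ Real.pi / 6 := by
  by_contra! h
  have h1 := Real.cos_lt_cos_of_nonneg_of_le_pi (by positivity) hφπ h
  rw [Real.cos_pi_div_six] at h1
  have h3 : Real.sqrt 3 ^ 2 = 3 := Real.sq_sqrt (by norm_num)
  nlinarith [sq_nonneg (q - Real.sqrt 3)]

/-- Growth is tied to rotation: `φ²` is at most about `2 (1 - cos φ)`, which the disc condition
bounds by `(q - 1) (3 - q) / (2q)`, and `log q ≥ 2 (q - 1) / (q + 1)`. Once the angle `aφ` exceeds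
`π`, the modulus `q ^ a` is therefore large enough to dominate the oscillating terms. -/
theorem sector_log_lower {q φ : ℝ} (hq : 1 ≤ q) (hq3 : q ≤ 3)
    (hk : q ^ 2 + 3 ≤ 4 * (q * Real.cos φ))
    (hφ : 0 ≤ φ) (hφπ : φ ≤ Real.pi) {y : ℝ} (hyq : y ^ 2 = (q ^ 2 - 1) / 2) :
    98 / 100 * (y * φ) ≤ Real.log q := by
  have h6 := sector_angle_le hq hk hφπ
  have hpi := Real.pi_lt_d2
  have hφ1 : φ ≤ 0.525 := by linarith
  have hcos : Real.cos φ ≤ 1 - φ ^ 2 / 2 + φ ^ 4 * (5 / 96) := by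
    have h := Real.cos_bound (x := φ) (by rw [abs_of_nonneg hφ]; linarith)
    rw [abs_of_nonneg hφ] at h
    linarith [(abs_le.1 h).2]
  have hlog : 2 * (q - 1) / (q + 1) ≤ Real.log q := by
    have := Real.le_log_one_add_of_nonneg (x := q - 1) (by linarith)
    rw [show q - 1 + 2 = q + 1 by ring, show 1 + (q - 1) = q by ring] at this
    exact this
  refine le_trans ?_ hlog
  apply le_of_sq_le_sq _ (by apply div_nonneg <;> linarith)
  have hφ2 : φ ^ 2 ≤ 0.28 := by nlinarith
  have h1 : 0.97 * φ ^ 2 ≤ 2 * (1 - Real.cos φ) := by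
    nlinarith [sq_nonneg φ]
  have h2 : 4 * q * (1 - Real.cos φ) ≤ (q - 1) * (3 - q) := by nlinarith
  have h3 : (98 / 100 * (y * φ)) ^ 2 ≤ 0.97 * φ ^ 2 * y ^ 2 := by
    have := mul_nonneg (sq_nonneg φ) (sq_nonneg y)
    nlinarith
  have h4 : 0.97 * φ ^ 2 * y ^ 2 ≤ (q ^ 2 - 1) * ((q - 1) * (3 - q)) / (4 * q) := by
    rw [hyq, le_div_iff₀ (by linarith)]
    have h5 : 0 ≤ (q ^ 2 - 1) := by nlinarith
    have h6 := mul_le_mul_of_nonneg_right h1 h5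
    nlinarith
  refine h3.trans (h4.trans ?_)
  rw [div_pow, div_le_div_iff₀ (by linarith) (by positivity)]
  obtain ⟨x, rfl⟩ : ∃ x, q = 1 + x := ⟨q - 1, by ring⟩
  have hx : 0 ≤ x := by linarith
  nlinarith [pow_nonneg hx 5, pow_nonneg hx 6, pow_nonneg hx 7, pow_nonneg hx 2]

/-- Eliminates `R` and `I`: by `hr`, both `R² + I²` and `I²` are at most `y²`, and the worst case is
taken in each term. -/
theorem spiralForm_lower {q R I T c s y : ℝ} (hq : q ^ 2 = 1 + 2 * R + (R ^ 2 + I ^ 2))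
    (hr : R ^ 2 + I ^ 2 ≤ 2 * R) (hT : 1 ≤ T) (hc : c ≤ 1) (hy : 0 ≤ y)
    (hyq : y ^ 2 = (q ^ 2 - 1) / 2) :
    T * (1 + 49 / 100 * (q ^ 2 - 1)) + T⁻¹ * (1 - 151 / 100 * (q ^ 2 - 1))
      - 2 * c * (1 - 4 * y ^ 2) - 8 * y * |s| - 10 * y ^ 2 ≤ spiralForm R I T c s := by
  have hT' : 0 < T⁻¹ := by positivity
  have hT1 : T⁻¹ ≤ 1 := inv_le_one_of_one_le₀ hT
  have h1 : R ^ 2 + I ^ 2 ≤ y ^ 2 := by linarith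
  have hI : |I| ≤ y := by
    apply abs_le_of_sq_le_sq _ hy
    nlinarith [sq_nonneg R]
  have hIs : -(y * |s|) ≤ I * s := by
    have : |I * s| ≤ y * |s| := by rw [abs_mul]; gcongr
    linarith [neg_abs_le (I * s)]
  unfold spiralForm
  have e1 : q ^ 2 - 1 = 2 * y ^ 2 := by linarith
  have e2 : R = y ^ 2 - (R ^ 2 + I ^ 2) / 2 := by linarith
  rw [e1]
  generalize R ^ 2 + I ^ 2 = r at *
  rw [e2]
  nlinarith [mul_nonneg (sub_nonneg.2 h1) (by linarith : 0 ≤ T - T⁻¹),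
    mul_nonneg (sub_nonneg.2 h1) hT'.le, mul_nonneg (sub_nonneg.2 h1) (sub_nonneg.2 hc)]

/-- The constants `3.078`, `3.848`, `4.617` in this and the next four estimates lie just below
`0.98` times `π`, `5π/4`, `3π/2`: they are the guaranteed values of `a log q / y` on the respective
ranges of the angle. -/
theorem spiral_poly_one {y : ℝ} (hy : 0 ≤ y) (hy2 : y ≤ 1 / 2) :
    0 ≤ (2 + (3.078 * y) ^ 2 + (3.078 * y) ^ 4 / 12) * (1 - 51 / 50 * y ^ 2) +
      2 * y ^ 2 * (2 * (3.078 * y) + (3.078 * y) ^ 3 / 3) + 1.414 * (1 - 4 * y ^ 2)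
      - 8 * y * 0.7072 - 10 * y ^ 2 := by
  nlinarith [mul_nonneg hy (sub_nonneg.2 hy2), sq_nonneg (y - 1/2), pow_nonneg hy 3, pow_nonneg hy 5,
    mul_nonneg (pow_nonneg hy 2) (sub_nonneg.2 hy2), mul_nonneg (pow_nonneg hy 3) (sub_nonneg.2 hy2),
    mul_nonneg (pow_nonneg hy 4) (sub_nonneg.2 hy2), mul_nonneg (pow_nonneg hy 5) (sub_nonneg.2 hy2)]

theorem spiral_poly_two {y : ℝ} (hy : 0 ≤ y) (hy2 : y ≤ 1 / 2) :
    0 ≤ (2 + (3.848 * y) ^ 2 + (3.848 * y) ^ 4 / 12) * (1 - 51 / 50 * y ^ 2) +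
      2 * y ^ 2 * (2 * (3.848 * y) + (3.848 * y) ^ 3 / 3)
      - 8 * y - 10 * y ^ 2 := by
  nlinarith [mul_nonneg hy (sub_nonneg.2 hy2), sq_nonneg (y - 0.28), pow_nonneg hy 3, pow_nonneg hy 5,
    mul_nonneg hy (sq_nonneg (y - 0.28)),
    mul_nonneg (pow_nonneg hy 2) (sub_nonneg.2 hy2), mul_nonneg (pow_nonneg hy 3) (sub_nonneg.2 hy2),
    mul_nonneg (pow_nonneg hy 4) (sub_nonneg.2 hy2), mul_nonneg (pow_nonneg hy 5) (sub_nonneg.2 hy2)]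

theorem spiral_poly_three {y : ℝ} (hy : 0 ≤ y) (hy2 : y ≤ 1 / 2) :
    2 + 18 * y ^ 2 ≤ (2 + (4.617 * y) ^ 2 + (4.617 * y) ^ 4 / 12) * (1 - 51 / 50 * y ^ 2) +
      2 * y ^ 2 * (2 * (4.617 * y) + (4.617 * y) ^ 3 / 3) := by
  nlinarith [pow_nonneg hy 3, pow_nonneg hy 5, pow_nonneg hy 2,
    mul_nonneg (pow_nonneg hy 2) (sub_nonneg.2 hy2), mul_nonneg (pow_nonneg hy 3) (sub_nonneg.2 hy2),
    mul_nonneg (pow_nonneg hy 4) (sub_nonneg.2 hy2), mul_nonneg (pow_nonneg hy 5) (sub_nonneg.2 hy2)]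

/-- The subtracted term is `3.02 (y² - 1/4) / 4`; it absorbs the negative contribution of `exp
(-κy)`, which is at most `1 / 4` here. -/
theorem spiral_poly_four {y : ℝ} (hy : 1 / 2 ≤ y) :
    18 * y ^ 2 - 2 + 8 * y * 0.7072 ≤ (1 + 3.078 * y + (3.078 * y) ^ 2 / 2 + (3.078 * y) ^ 3 / 6
      + (3.078 * y) ^ 4 / 24) * (1 + 49 / 50 * y ^ 2) - (3.02 * y ^ 2 - 0.755) / 4 := by
  obtain ⟨x, rfl⟩ : ∃ x, y = 1 / 2 + x := ⟨y - 1 / 2, by ring⟩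
  have hx : 0 ≤ x := by linarith
  nlinarith [pow_nonneg hx 3, pow_nonneg hx 5, pow_nonneg hx 2, pow_nonneg hx 4, pow_nonneg hx 6,
    sq_nonneg (x - 0.05), sq_nonneg (x - 0.1)]

theorem spiral_poly_five {y : ℝ} (hy : 1 / 2 ≤ y) :
    18 * y ^ 2 + 2 ≤ (1 + 3.848 * y + (3.848 * y) ^ 2 / 2 + (3.848 * y) ^ 3 / 6
      + (3.848 * y) ^ 4 / 24) * (1 + 49 / 50 * y ^ 2) - (3.02 * y ^ 2 - 0.755) / 4 := by
  obtain ⟨x, rfl⟩ : ∃ x, y = 1 / 2 + x := ⟨y - 1 / 2, by ring⟩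
  have hx : 0 ≤ x := by linarith
  nlinarith [pow_nonneg hx 3, pow_nonneg hx 5, pow_nonneg hx 2, pow_nonneg hx 4, pow_nonneg hx 6]

theorem cos_sin_first_eighth {θ : ℝ} (h1 : Real.pi ≤ θ) (h2 : θ ≤ 5 / 4 * Real.pi) :
    Real.cos θ ≤ -0.707 ∧ |Real.sin θ| ≤ 0.7072 := by
  have hpi := Real.pi_pos
  have e : θ = (θ - Real.pi) + Real.pi := by ring
  have hc : Real.cos θ = -Real.cos (θ - Real.pi) := by rw [Real.cos_sub_pi]; ring
  have hs : Real.sin θ = -Real.sin (θ - Real.pi) := by rw [Real.sin_sub_pi]; ring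
  have h3 : Real.cos (Real.pi / 4) ≤ Real.cos (θ - Real.pi) :=
    Real.cos_le_cos_of_nonneg_of_le_pi (by linarith) (by linarith) (by linarith)
  have h4 : Real.sin (θ - Real.pi) ≤ Real.sin (Real.pi / 4) :=
    Real.sin_le_sin_of_le_of_le_pi_div_two (by linarith) (by linarith) (by linarith)
  have h5 : 0 ≤ Real.sin (θ - Real.pi) :=
    Real.sin_nonneg_of_nonneg_of_le_pi (by linarith) (by linarith)
  rw [Real.cos_pi_div_four] at h3
  rw [Real.sin_pi_div_four] at h4
  have h6 : Real.sqrt 2 ≤ 1.4143 := Real.sqrt_le_iff.2 (by norm_num)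
  have h7 : 1.4142 ≤ Real.sqrt 2 := Real.le_sqrt_of_sq_le (by norm_num)
  rw [hc, hs, abs_neg, abs_of_nonneg h5]
  constructor <;> linarith

theorem cos_nonpos_of_third_quadrant {θ : ℝ} (h1 : Real.pi ≤ θ) (h2 : θ ≤ 3 / 2 * Real.pi) :
    Real.cos θ ≤ 0 := by
  have hpi := Real.pi_pos
  exact Real.cos_nonpos_of_pi_div_two_le_of_le (by linarith) (by linarith)

/-- Cauchy–Schwarz, with `(1 - 4y²)² + (4y)² = (1 + 4y²)²`. -/
theorem amplitude_bound (y θ : ℝ) :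
    2 * Real.cos θ * (1 - 4 * y ^ 2) + 8 * y * |Real.sin θ| ≤ 2 * (1 + 4 * y ^ 2) := by
  have h := Real.sin_sq_add_cos_sq θ
  rw [← sq_abs (Real.sin θ)] at h
  generalize |Real.sin θ| = s at *
  generalize Real.cos θ = c at *
  have : (c * (1 - 4 * y ^ 2) + 4 * y * s) ^ 2 ≤ (1 + 4 * y ^ 2) ^ 2 := by
    nlinarith [sq_nonneg (s * (1 - 4 * y ^ 2) - 4 * y * c)]
  have := abs_le_of_sq_le_sq' this (by positivity)
  linarith [this.2]

theorem spiralForm_nonneg_of_pi_le {q φ : ℝ} (hq : 1 ≤ q) (hq3 : q ≤ 3)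
    (hk : q ^ 2 + 3 ≤ 4 * (q * Real.cos φ)) (hφ : 0 ≤ φ) (hφπ : φ ≤ Real.pi) (a : ℕ)
    (haφ : Real.pi ≤ a * φ) :
    0 ≤ spiralForm (q * Real.cos φ - 1) (q * Real.sin φ) (q ^ a)
        (Real.cos (a * φ)) (Real.sin (a * φ)) := by
  obtain ⟨y, hy, hyq⟩ : ∃ y : ℝ, 0 ≤ y ∧ y ^ 2 = (q ^ 2 - 1) / 2 :=
    ⟨Real.sqrt ((q ^ 2 - 1) / 2), Real.sqrt_nonneg _, Real.sq_sqrt (by nlinarith)⟩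
  have hlog := sector_log_lower hq hq3 hk hφ hφπ hyq
  have hT : q ^ a = Real.exp (a * Real.log q) := by
    rw [mul_comm, Real.exp_mul, Real.exp_log (by linarith), Real.rpow_natCast]
  have hτ : 98 / 100 * (y * (a * φ)) ≤ a * Real.log q := by
    have := mul_le_mul_of_nonneg_left hlog (Nat.cast_nonneg (α := ℝ) a)
    linarith
  refine le_trans ?_ (spiralForm_lower (sector_sq q φ) (sector_radius hk) (one_le_pow₀ hq)
    (Real.cos_le_one _) hy hyq)
  generalize hθ : (a : ℝ) * φ = θ at *
  have hq2 : q ^ 2 - 1 = 2 * y ^ 2 := by linarith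
  have hy2 : y ≤ 2 := by nlinarith
  have hpi := Real.pi_gt_d4
  -- lower bound for the hyperbolic part
  have hA : ∀ κ : ℝ, 0 ≤ κ → κ ≤ 98 / 100 * θ →
      Real.exp (κ * y) * (1 + 49 / 50 * y ^ 2) + (Real.exp (κ * y))⁻¹ * (1 - 151 / 50 * y ^ 2) ≤
      q ^ a * (1 + 49 / 100 * (q ^ 2 - 1)) + (q ^ a)⁻¹ * (1 - 151 / 100 * (q ^ 2 - 1)) := by
    intro κ hκ0 hκ
    have := spiralForce_lower_mono (q := q) (T := Real.exp (κ * y)) (T' := q ^ a) hq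
      (Real.one_le_exp (by positivity))
      (by
        rw [hT]
        apply Real.exp_le_exp.2
        nlinarith)
    rw [hq2] at this ⊢
    linarith
  have hsmall : ∀ κ : ℝ, 0 ≤ κ → κ ≤ 98 / 100 * θ → y ≤ 1 / 2 →
      (2 + (κ * y) ^ 2 + (κ * y) ^ 4 / 12) * (1 - 51 / 50 * y ^ 2) +
      2 * y ^ 2 * (2 * (κ * y) + (κ * y) ^ 3 / 3) ≤
      q ^ a * (1 + 49 / 100 * (q ^ 2 - 1)) + (q ^ a)⁻¹ * (1 - 151 / 100 * (q ^ 2 - 1)) := by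
    intro κ hκ0 hκ hy1
    refine le_trans ?_ (hA κ hκ0 hκ)
    have h1 := two_cosh_lower (κ * y)
    have h2 := two_sinh_lower (s := κ * y) (by positivity)
    have h3 : 0 ≤ 1 - 51 / 50 * y ^ 2 := by nlinarith
    have h4 := mul_le_mul_of_nonneg_right h1 h3
    have h5 := mul_le_mul_of_nonneg_left h2 (by positivity : 0 ≤ 2 * y ^ 2)
    linarith
  have hlarge : ∀ κ : ℝ, 3.078 ≤ κ → κ ≤ 98 / 100 * θ → 1 / 2 ≤ y →
      (1 + κ * y + (κ * y) ^ 2 / 2 + (κ * y) ^ 3 / 6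
      + (κ * y) ^ 4 / 24) * (1 + 49 / 50 * y ^ 2) - (3.02 * y ^ 2 - 0.755) / 4 ≤
      q ^ a * (1 + 49 / 100 * (q ^ 2 - 1)) + (q ^ a)⁻¹ * (1 - 151 / 100 * (q ^ 2 - 1)) := by
    intro κ hκ0 hκ hy1
    refine le_trans ?_ (hA κ (by linarith) hκ)
    have hs : 1.539 ≤ κ * y := by nlinarith
    have h1 := exp_lower_quartic (s := κ * y) (by linarith)
    have h2 : 4 ≤ Real.exp (κ * y) := by
      refine le_trans ?_ h1
      nlinarith [pow_nonneg (by linarith : 0 ≤ κ * y) 3, pow_nonneg (by linarith : 0 ≤ κ * y) 4,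
        pow_le_pow_left₀ (by norm_num) hs 3, pow_le_pow_left₀ (by norm_num) hs 2]
    have h3 : (Real.exp (κ * y))⁻¹ ≤ 1 / 4 := by
      rw [one_div]; exact inv_anti₀ (by norm_num) h2
    have h4 : 0 < (Real.exp (κ * y))⁻¹ := by positivity
    have h5 := mul_le_mul_of_nonneg_right h1 (by positivity : 0 ≤ 1 + 49 / 50 * y ^ 2)
    have h6 : 0 ≤ (y ^ 2 - 1 / 4) * (1 / 4 - (Real.exp (κ * y))⁻¹) :=
      mul_nonneg (by nlinarith) (by linarith)
    linarith
  have hamp := amplitude_bound y θ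
  clear hA hT hτ hlog
  generalize q ^ a * (1 + 49 / 100 * (q ^ 2 - 1)) + (q ^ a)⁻¹ * (1 - 151 / 100 * (q ^ 2 - 1)) = A
    at *
  -- The sign of `1 - 4y²` decides whether a negative cosine helps. For small `y` the bounds on
  -- cosine and sine improve the estimate up to `3π/2`; for large `y` a separate treatment is needed
  -- only up to `5π/4`. Past these angles the amplitude bound suffices.
  rcases le_total y (1 / 2) with hy1 | hy1
  · rcases le_total θ (5 / 4 * Real.pi) with h | h
    · obtain ⟨hc, hs⟩ := cos_sin_first_eighth haφ h
      have h1 := hsmall 3.078 (by norm_num) (by linarith) hy1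
      have h2 := spiral_poly_one hy hy1
      have h3 : 0 ≤ 1 - 4 * y ^ 2 := by nlinarith
      have h4 := mul_nonneg h3 (sub_nonneg.2 hc)
      have h5 := mul_nonneg hy (sub_nonneg.2 hs)
      linarith
    · rcases le_total θ (3 / 2 * Real.pi) with h' | h'
      · have hc := cos_nonpos_of_third_quadrant haφ h'
        have hs := Real.abs_sin_le_one θ
        have h1 := hsmall 3.848 (by norm_num) (by linarith) hy1
        have h2 := spiral_poly_two hy hy1
        have h3 : 0 ≤ 1 - 4 * y ^ 2 := by nlinarith
        have h4 := mul_nonneg h3 (sub_nonneg.2 hc)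
        have h5 := mul_nonneg hy (sub_nonneg.2 hs)
        linarith
      · have h1 := hsmall 4.617 (by norm_num) (by linarith) hy1
        have h2 := spiral_poly_three hy hy1
        linarith
  · rcases le_total θ (5 / 4 * Real.pi) with h | h
    · obtain ⟨hc, hs⟩ := cos_sin_first_eighth haφ h
      have hc1 := Real.neg_one_le_cos θ
      have h1 := hlarge 3.078 le_rfl (by linarith) hy1
      have h2 := spiral_poly_four hy1
      have h3 : 0 ≤ 4 * y ^ 2 - 1 := by nlinarith
      have h4 := mul_nonneg h3 (sub_nonneg.2 hc1)
      have h5 := mul_nonneg hy (sub_nonneg.2 hs)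
      linarith
    · have h1 := hlarge 3.848 (by norm_num) (by linarith) hy1
      have h2 := spiral_poly_five hy1
      linarith

theorem spiralForm_nonneg {q φ : ℝ} (hq : 1 ≤ q) (hq3 : q ≤ 3)
    (hk : q ^ 2 + 3 ≤ 4 * (q * Real.cos φ)) (hφ : 0 ≤ φ) (hφπ : φ ≤ Real.pi) (a : ℕ) (ha : 1 ≤ a) :
    0 ≤ spiralForm (q * Real.cos φ - 1) (q * Real.sin φ) (q ^ a)
        (Real.cos (a * φ)) (Real.sin (a * φ)) := by
  rcases hφ.eq_or_lt with rfl | hφ0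
  · simpa using spiralForm_nonneg_real hq hq3 a ha
  · rcases le_total (a * φ) Real.pi with h | h
    · exact spiralForm_nonneg_of_le_pi hq hk hφ0 a ha h
    · exact spiralForm_nonneg_of_pi_le hq hq3 hk hφ hφπ a h

/-! ### Iterates of `stepF p` on the disc of radius `√5` around `2` -/

/-- The map `X ↦ (1 + X) / p`, which is `x ↦ x + 1` in terms of `p`-continued fractions. -/
noncomputable def stepF (p X : ℂ) : ℂ := (1 + X) / p

/-- Multiplication by `p - 1` turns the fixed point into `1` and clears the denominator, so the
formula also makes sense at `p = 1`. -/
theorem stepF_iterate (p : ℂ) (hp : p ≠ 0) (a : ℕ) (Z : ℂ) :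
    (p - 1) * (stepF p)^[a] Z = (1 - (p ^ a)⁻¹) + (p ^ a)⁻¹ * ((p - 1) * Z) := by
  induction a with
  | zero => simp
  | succ a ih =>
    rw [Function.iterate_succ_apply', stepF, mul_div_assoc', mul_add, ih, pow_succ]
    field_simp
    ring

/-- The difference of the two sides is `spiralForm / ‖p‖ ^ a`. The summand with factor `1 / 50` is
the reserve that produces the positive margin in `stepF_iterate_norm_lower`; it is the excess of `51
/ 50` over `1` in `spiralForm`. -/
theorem spiral_norm_bound_of_im_nonneg {p : ℂ} (hp : ‖p - 2‖ ≤ 1) (hIm : 0 ≤ p.im) (a : ℕ)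
    (ha : 1 ≤ a) :
    ‖p - 1‖ ^ 2 * (5 * (1 + (‖p‖ ^ a)⁻¹) ^ 2 + 1 / 50 * (1 + ((‖p‖ ^ a)⁻¹) ^ 2)) ≤
    ‖1 - (p ^ a)⁻¹ + 2 * (p - 1) * (1 + (p ^ a)⁻¹)‖ ^ 2 := by
  have hre := Complex.norm_mul_cos_arg p
  have him := Complex.norm_mul_sin_arg p
  have hq : 1 ≤ ‖p‖ := by
    have := norm_sub_norm_le (2 : ℂ) p
    rw [norm_sub_rev] at this
    simp at this; linarith
  have hq3 : ‖p‖ ≤ 3 := by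
    have := norm_sub_norm_le p 2
    simp at this; linarith
  have hnorm : ‖p‖ ^ 2 = p.re ^ 2 + p.im ^ 2 := by
    rw [Complex.sq_norm, Complex.normSq_apply]; ring
  have hk : ‖p‖ ^ 2 + 3 ≤ 4 * (‖p‖ * Real.cos p.arg) := by
    have h2 : ‖p - 2‖ ^ 2 ≤ 1 := by nlinarith [norm_nonneg (p - 2)]
    rw [Complex.sq_norm, Complex.normSq_apply] at h2
    simp at h2
    rw [hre]; nlinarith
  have h := spiralForm_nonneg hq hq3 hk (Complex.arg_nonneg_iff.2 hIm) (Complex.arg_le_pi p) a ha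
  rw [hre, him] at h
  have hpow : p ^ a = (‖p‖ ^ a : ℝ) * (Real.cos (a * p.arg) + Real.sin (a * p.arg) * Complex.I) := by
    conv_lhs => rw [← Complex.norm_mul_exp_arg_mul_I p]
    rw [mul_pow, ← Complex.exp_nat_mul, ← mul_assoc]
    push_cast
    rw [← Complex.exp_mul_I]
  have hT : 0 < ‖p‖ ^ a := by positivity
  generalize ‖p‖ ^ a = T at *
  have hcs := Real.sin_sq_add_cos_sq (a * p.arg)
  generalize Real.cos (a * p.arg) = c at *
  generalize Real.sin (a * p.arg) = s at *
  have hQ : (p ^ a)⁻¹ = (T⁻¹ : ℝ) * ((c : ℝ) - (s : ℝ) * Complex.I) := by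
    rw [hpow]
    refine inv_eq_of_mul_eq_one_left ?_
    have : ((c : ℂ) - s * Complex.I) * (c + s * Complex.I) = 1 := by
      have h1 : ((s ^ 2 + c ^ 2 : ℝ) : ℂ) = 1 := by rw [hcs]; simp
      push_cast at h1
      linear_combination h1 - (s : ℂ) ^ 2 * Complex.I_sq
    calc _ = ((T⁻¹ : ℝ) * (T : ℝ) : ℂ) * (((c : ℂ) - s * Complex.I) * (c + s * Complex.I)) := by ring
      _ = 1 := by rw [this, ← Complex.ofReal_mul, inv_mul_cancel₀ hT.ne']; simp
  rw [hQ, Complex.sq_norm, Complex.sq_norm, Complex.normSq_apply, Complex.normSq_apply]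
  simp only [Complex.add_re, Complex.sub_re, Complex.mul_re, Complex.one_re, Complex.ofReal_re,
    Complex.ofReal_im, Complex.I_re, Complex.I_im, Complex.add_im, Complex.sub_im, Complex.mul_im,
    Complex.one_im, Complex.re_ofNat, Complex.im_ofNat, mul_zero, zero_mul, sub_zero, add_zero,
    zero_add, mul_one, zero_sub]
  unfold spiralForm at h
  obtain ⟨u, hu⟩ : ∃ u, u = p.re - 1 := ⟨_, rfl⟩
  rw [← hu] at h ⊢
  generalize p.im = v at *
  have h2 : 0 ≤ T⁻¹ * ((T + T⁻¹) * (1 - 51 / 50 * (u ^ 2 + v ^ 2)) + 4 * u * (T - T⁻¹)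
    - 2 * c * (1 - 4 * (u ^ 2 + v ^ 2)) + 8 * v * s - 10 * (u ^ 2 + v ^ 2)) := by positivity
  have h3 : T⁻¹ * T = 1 := inv_mul_cancel₀ hT.ne'
  generalize T⁻¹ = t at *
  have h4 : s ^ 2 = 1 - c ^ 2 := by linarith
  have e1 : t * ((T + t) * (1 - 51 / 50 * (u ^ 2 + v ^ 2)) + 4 * u * (T - t)
    - 2 * c * (1 - 4 * (u ^ 2 + v ^ 2)) + 8 * v * s - 10 * (u ^ 2 + v ^ 2)) =
    (1 + t ^ 2) * (1 - 51 / 50 * (u ^ 2 + v ^ 2)) + 4 * u * (1 - t ^ 2)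
    - 2 * t * c * (1 - 4 * (u ^ 2 + v ^ 2)) + 8 * v * t * s - 10 * t * (u ^ 2 + v ^ 2) := by
    linear_combination (1 - 51 / 50 * (u ^ 2 + v ^ 2) + 4 * u) * h3
  rw [e1] at h2
  refine le_of_sub_nonneg (h2.trans_eq ?_)
  linear_combination (-t ^ 2 * (1 - 4 * u + 4 * (u ^ 2 + v ^ 2))) * h4

theorem spiral_norm_bound {p : ℂ} (hp : ‖p - 2‖ ≤ 1) (a : ℕ) (ha : 1 ≤ a) :
    ‖p - 1‖ ^ 2 * (5 * (1 + (‖p‖ ^ a)⁻¹) ^ 2 + 1 / 50 * (1 + ((‖p‖ ^ a)⁻¹) ^ 2)) ≤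
    ‖1 - (p ^ a)⁻¹ + 2 * (p - 1) * (1 + (p ^ a)⁻¹)‖ ^ 2 := by
  rcases le_total 0 p.im with h | h
  · exact spiral_norm_bound_of_im_nonneg hp h a ha
  · have h2c : (starRingEnd ℂ) 2 = 2 := Complex.conj_ofNat 2
    have hp' : ‖(starRingEnd ℂ) p - 2‖ ≤ 1 := by
      rw [← Complex.norm_conj]; simpa [h2c] using hp
    have := spiral_norm_bound_of_im_nonneg hp' (by simpa using h) a ha
    have e1 : ‖(starRingEnd ℂ) p - 1‖ = ‖p - 1‖ := by rw [← Complex.norm_conj]; simp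
    have e2 : ‖1 - ((starRingEnd ℂ) p ^ a)⁻¹ +
        2 * ((starRingEnd ℂ) p - 1) * (1 + ((starRingEnd ℂ) p ^ a)⁻¹)‖ =
        ‖1 - (p ^ a)⁻¹ + 2 * (p - 1) * (1 + (p ^ a)⁻¹)‖ := by
      rw [← Complex.norm_conj]; simp [h2c]
    rwa [e1, e2, Complex.norm_conj] at this

/-- The disc `‖Z - 2‖ ≤ √5`, which contains `𝔛(p, x)` for all `x ≤ 1`. -/
def spiralDisc : Set ℂ := {Z | ‖Z - 2‖ ≤ √5}

/-- Iterates of `X ↦ (1 + X) / p` map `spiralDisc` away from the disc `‖Y + 2‖ ≤ √5`. -/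
theorem stepF_iterate_norm_lower {p Z : ℂ} (hp : ‖p - 2‖ ≤ 1) (hZ : Z ∈ spiralDisc) (a : ℕ)
    (ha : 1 ≤ a) : √5 + 1 / 500 ≤ ‖(stepF p)^[a] Z + 2‖ := by
  have h5 : √5 ^ 2 = 5 := Real.sq_sqrt (by norm_num)
  have h5' : √5 ≤ 2.2361 := Real.sqrt_le_iff.2 (by norm_num)
  have h50 : 0 ≤ √5 := Real.sqrt_nonneg 5
  have hZ' : ‖Z - 2‖ ≤ √5 := hZ
  have hq : 1 ≤ ‖p‖ := by
    have := norm_sub_norm_le (2 : ℂ) p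
    rw [norm_sub_rev] at this
    simp at this; linarith
  have hp0 : p ≠ 0 := by
    rintro rfl; simp at hq; linarith
  -- At `p = 1` the factor `p - 1` cannot be cancelled, but there the map is translation by `1`.
  rcases eq_or_ne p 1 with rfl | h1
  · have : ∀ b : ℕ, (stepF 1)^[b] Z = b + Z := by
      intro b
      induction b with
      | zero => simp
      | succ b ih => rw [Function.iterate_succ_apply', ih, stepF]; push_cast; ring
    rw [this]
    have e : (a : ℂ) + Z + 2 = ((a : ℂ) + 4) - (2 - Z) := by ring
    rw [e]
    have h2 := norm_sub_norm_le ((a : ℂ) + 4) (2 - Z)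
    have h3 : ‖(a : ℂ) + 4‖ = a + 4 := by
      rw [show (a : ℂ) + 4 = ((a + 4 : ℕ) : ℂ) by push_cast; ring, Complex.norm_natCast]
      push_cast; ring
    have h4 : (1 : ℝ) ≤ a := by exact_mod_cast ha
    rw [norm_sub_rev] at hZ'
    linarith
  · have hr : 0 < ‖p - 1‖ := norm_pos_iff.2 (sub_ne_zero.2 h1)
    have hb := spiral_norm_bound hp a ha
    have hit := stepF_iterate p hp0 a Z
    set Y := (stepF p)^[a] Z with hY
    set Q := (p ^ a)⁻¹ with hQ
    have hQn : ‖Q‖ = (‖p‖ ^ a)⁻¹ := by simp [hQ]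
    rw [← hQn] at hb
    have ht0 : 0 ≤ ‖Q‖ := norm_nonneg _
    have ht1 : ‖Q‖ ≤ 1 := by rw [hQn]; exact inv_le_one_of_one_le₀ (one_le_pow₀ hq)
    -- The image of the disc is a disc of radius `√5 ‖Q‖`; up to the factor `p - 1`, the first
    -- bracket is its centre plus `2`.
    have e1 : (p - 1) * (Y + 2) = (1 - Q + 2 * (p - 1) * (1 + Q)) + (p - 1) * (Q * (Z - 2)) := by
      linear_combination hit
    have h2 : ‖p - 1‖ * (√5 * (1 + ‖Q‖) + 1 / 500) ≤ ‖1 - Q + 2 * (p - 1) * (1 + Q)‖ := by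
      apply le_of_sq_le_sq _ (norm_nonneg _)
      refine le_trans ?_ hb
      rw [mul_pow]
      gcongr
      have : (√5 * (1 + ‖Q‖) + 1 / 500) ^ 2 = 5 * (1 + ‖Q‖) ^ 2 +
        1 / 250 * (√5 * (1 + ‖Q‖)) + 1 / 250000 := by
        linear_combination (1 + ‖Q‖) ^ 2 * h5
      rw [this]
      have : √5 * (1 + ‖Q‖) ≤ 2.2361 * 2 := by
        apply mul_le_mul h5' (by linarith) (by linarith) (by norm_num)
      nlinarith
    have h3 : ‖1 - Q + 2 * (p - 1) * (1 + Q)‖ - ‖p - 1‖ * (‖Q‖ * √5) ≤ ‖p - 1‖ * ‖Y + 2‖ := by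
      rw [← norm_mul, e1]
      have := norm_sub_le_norm_add (1 - Q + 2 * (p - 1) * (1 + Q)) ((p - 1) * (Q * (Z - 2)))
      refine le_trans ?_ this
      gcongr
      rw [norm_mul, norm_mul]
      gcongr
    have h4 : ‖p - 1‖ * (√5 + 1 / 500) ≤ ‖p - 1‖ * ‖Y + 2‖ := by linarith
    exact le_of_mul_le_mul_left h4 hr

/-! ### Words in the two generating maps -/

/-- The map `X ↦ p X / (1 + X)`, which is `x ↦ x / (x + 1)` in terms of `p`-continued fractions. -/
noncomputable def stepG (p X : ℂ) : ℂ := p * X / (1 + X)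

/-- The composition of the maps `stepF p` (for `true`) and `stepG p` (for `false`) along a word. -/
noncomputable def wordMap (p : ℂ) : List Bool → ℂ → ℂ
  | [], X => X
  | true :: l, X => stepF p (wordMap p l X)
  | false :: l, X => stepG p (wordMap p l X)

/-- The length of the initial run of equal letters of a word. -/
def leadRun : List Bool → ℕ
  | [] => 0
  | b :: l => if l.head? = some b then leadRun l + 1 else 1

/-- All runs of equal letters in the word have length at most `A`. -/
def RunsLE (A : ℕ) : List Bool → Prop
  | [] => True
  | b :: l => RunsLE A l ∧ leadRun (b :: l) ≤ A

theorem leadRun_le_length (l : List Bool) : leadRun l ≤ l.length := by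
  induction l with
  | nil => simp [leadRun]
  | cons b l ih => simp only [leadRun, List.length_cons]; split_ifs <;> omega

theorem runsLE_of_length_le {A : ℕ} (l : List Bool) (h : l.length ≤ A) : RunsLE A l := by
  induction l with
  | nil => trivial
  | cons b l ih =>
    simp only [List.length_cons] at h
    exact ⟨ih (by omega), (leadRun_le_length _).trans (by simpa using h)⟩

/-- The iterates up to `A` of `stepF p` map `spiralDisc` away from the disc `‖Y + 2‖ < √5`. -/
def SpiralInvariant (A : ℕ) (p : ℂ) : Prop :=
  ∀ a, 1 ≤ a → a ≤ A → ∀ Z ∈ spiralDisc, √5 ≤ ‖(stepF p)^[a] Z + 2‖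

theorem sqrt_five_bounds : 2.236 ≤ √5 ∧ √5 ≤ 2.2361 :=
  ⟨Real.le_sqrt_of_sq_le (by norm_num), Real.sqrt_le_iff.2 (by norm_num)⟩

theorem one_mem_spiralDisc : (1 : ℂ) ∈ spiralDisc := by
  have := sqrt_five_bounds.1
  change ‖(1 : ℂ) - 2‖ ≤ √5
  rw [show (1 : ℂ) - 2 = -1 by norm_num, norm_neg, norm_one]; linarith

theorem neg_one_notMem_spiralDisc : (-1 : ℂ) ∉ spiralDisc := by
  have := sqrt_five_bounds.2
  change ¬ ‖(-1 : ℂ) - 2‖ ≤ √5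
  norm_num; linarith

/-- Since `2² - 5 = -1`, inversion exchanges the disc `‖Z - 2‖ ≤ √5` with the exterior of the disc
around `-2` of the same radius. This is what singles out the radius `√5`. -/
theorem inv_mem_spiralDisc_iff {Y : ℂ} (hY : Y ≠ 0) : Y⁻¹ ∈ spiralDisc ↔ √5 ≤ ‖Y + 2‖ := by
  have h5 : √5 ^ 2 = 5 := Real.sq_sqrt (by norm_num)
  have hn : 0 < ‖Y‖ := norm_pos_iff.2 hY
  have e : ‖Y⁻¹ - 2‖ * ‖Y‖ = ‖1 - 2 * Y‖ := by
    rw [← norm_mul]; congr 1; field_simp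
  change ‖Y⁻¹ - 2‖ ≤ √5 ↔ _
  rw [← mul_le_mul_iff_left₀ hn, e, ← abs_of_nonneg (norm_nonneg (1 - 2 * Y)),
    ← abs_of_nonneg (mul_nonneg (Real.sqrt_nonneg 5) hn.le), ← sq_le_sq, mul_pow, h5]
  rw [← abs_of_nonneg (norm_nonneg (Y + 2)), ← abs_of_nonneg (Real.sqrt_nonneg 5), ← sq_le_sq, h5]
  simp only [Complex.sq_norm, Complex.normSq_apply]
  simp
  constructor <;> intro h <;> nlinarith

theorem one_add_ne_zero_of_mem {X : ℂ} (h : X ∈ spiralDisc ∨ X⁻¹ ∈ spiralDisc) : 1 + X ≠ 0 := by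
  intro h0
  have hX : X = -1 := by linear_combination h0
  subst hX
  rcases h with h | h
  · exact neg_one_notMem_spiralDisc h
  · rw [inv_neg, inv_one] at h
    exact neg_one_notMem_spiralDisc h

theorem inv_stepG {p X : ℂ} (hX : X ≠ 0) : (stepG p X)⁻¹ = stepF p X⁻¹ := by
  unfold stepG stepF
  rw [inv_div]
  by_cases hp : p = 0
  · simp [hp]
  · field_simp; ring

/-- A block of equal letters is an iterate of `stepF p`, or the same iterate conjugated by
inversion. By `SpiralInvariant` a block sends `spiralDisc` to points whose inverses lie in
`spiralDisc`, which is the admissible input of a block of the other letter. The last two clauses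
remember the start of the current block, since invariance is known only for whole blocks and not for
single letters. -/
theorem wordMap_state {p : ℂ} {A : ℕ} (hp : p ≠ 0) (hinv : SpiralInvariant A p) (l : List Bool)
    (hl : RunsLE A l) : wordMap p l 1 ≠ 0 ∧
      (l.head? ≠ some true → wordMap p l 1 ∈ spiralDisc) ∧
      (l.head? ≠ some false → (wordMap p l 1)⁻¹ ∈ spiralDisc) ∧
      (l.head? = some true → ∃ Z ∈ spiralDisc, wordMap p l 1 = (stepF p)^[leadRun l] Z) ∧
      (l.head? = some false → ∃ Z ∈ spiralDisc, (wordMap p l 1)⁻¹ = (stepF p)^[leadRun l] Z) := by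
  induction l with
  | nil => simp [wordMap, one_mem_spiralDisc]
  | cons b l ih =>
    obtain ⟨hl1, hl2⟩ := hl
    obtain ⟨h0, ht, hf, ht', hf'⟩ := ih hl1
    set X := wordMap p l 1 with hX
    have h1 : 1 + X ≠ 0 := by
      apply one_add_ne_zero_of_mem
      by_cases h : l.head? = some true
      · exact Or.inr (hf (by simp [h]))
      · exact Or.inl (ht h)
    have hpos : 1 ≤ leadRun (b :: l) := by
      simp only [leadRun]; split_ifs <;> omega
    cases b with
    | true =>
      have hne : wordMap p (true :: l) 1 ≠ 0 := div_ne_zero h1 hp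
      have hex : ∃ Z ∈ spiralDisc, wordMap p (true :: l) 1 = (stepF p)^[leadRun (true :: l)] Z := by
        by_cases h : l.head? = some true
        · obtain ⟨Z, hZ, e⟩ := ht' h
          refine ⟨Z, hZ, ?_⟩
          simp only [leadRun, if_pos h]
          rw [Function.iterate_succ_apply', ← e]; rfl
        · refine ⟨X, ht h, ?_⟩
          simp only [leadRun, if_neg h]
          rfl
      refine ⟨hne, by simp, fun _ => ?_, fun _ => hex, by simp⟩
      obtain ⟨Z, hZ, e⟩ := hex
      rw [inv_mem_spiralDisc_iff hne, e]
      exact hinv _ hpos hl2 Z hZ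
    | false =>
      have hne : wordMap p (false :: l) 1 ≠ 0 := div_ne_zero (mul_ne_zero hp h0) h1
      have hex : ∃ Z ∈ spiralDisc,
          (wordMap p (false :: l) 1)⁻¹ = (stepF p)^[leadRun (false :: l)] Z := by
        have e0 : (wordMap p (false :: l) 1)⁻¹ = stepF p X⁻¹ := inv_stepG h0
        by_cases h : l.head? = some false
        · obtain ⟨Z, hZ, e⟩ := hf' h
          refine ⟨Z, hZ, ?_⟩
          simp only [leadRun, if_pos h]
          rw [Function.iterate_succ_apply', ← e, e0]
        · refine ⟨X⁻¹, hf h, ?_⟩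
          simp only [leadRun, if_neg h]
          exact e0
      refine ⟨hne, fun _ => ?_, by simp, by simp, fun _ => hex⟩
      obtain ⟨Z, hZ, e⟩ := hex
      rw [← inv_inv (wordMap p (false :: l) 1), inv_mem_spiralDisc_iff (inv_ne_zero hne), e]
      exact hinv _ hpos hl2 Z hZ

theorem wordMap_mem {p : ℂ} {A : ℕ} (hp : p ≠ 0) (hinv : SpiralInvariant A p) (l : List Bool)
    (hl : RunsLE A l) : wordMap p l 1 ≠ 0 ∧
      (wordMap p l 1 ∈ spiralDisc ∨ (wordMap p l 1)⁻¹ ∈ spiralDisc) := by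
  obtain ⟨h0, ht, hf, -, -⟩ := wordMap_state hp hinv l hl
  refine ⟨h0, ?_⟩
  by_cases h : l.head? = some true
  · exact Or.inr (hf (by simp [h]))
  · exact Or.inl (ht h)

theorem differentiableAt_wordMap {p : ℂ} {A : ℕ} (hp : p ≠ 0) (hinv : SpiralInvariant A p)
    (l : List Bool) (hl : RunsLE A l) : DifferentiableAt ℂ (fun p => wordMap p l 1) p := by
  induction l with
  | nil => simp [wordMap]
  | cons b l ih =>
    have hd := ih hl.1
    have h1 := one_add_ne_zero_of_mem (wordMap_mem hp hinv l hl.1).2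
    cases b with
    | true => exact (hd.const_add 1).div differentiableAt_id hp
    | false => exact (differentiableAt_id.mul hd).div (hd.const_add 1) h1

theorem norm_ge_one_of_closedBall {p : ℂ} (hp : ‖p - 2‖ ≤ 1) : 1 ≤ ‖p‖ := by
  have := norm_sub_norm_le (2 : ℂ) p
  rw [norm_sub_rev] at this
  simp at this; linarith

theorem spiralInvariant_of_closedBall {p : ℂ} (hp : ‖p - 2‖ ≤ 1) (A : ℕ) :
    SpiralInvariant A p := fun a ha _ Z hZ => by
  linarith [stepF_iterate_norm_lower hp hZ a ha]

theorem norm_stepF_iterate_le {p Z : ℂ} (hp : 1 ≤ ‖p‖) (a : ℕ) :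
    ‖(stepF p)^[a] Z‖ ≤ a + ‖Z‖ := by
  induction a with
  | zero => simp
  | succ a ih =>
    rw [Function.iterate_succ_apply', stepF, norm_div]
    have h1 : ‖1 + (stepF p)^[a] Z‖ ≤ 1 + (a + ‖Z‖) := (norm_add_le _ _).trans (by simpa using ih)
    have h2 : 0 ≤ ‖1 + (stepF p)^[a] Z‖ := norm_nonneg _
    rw [div_le_iff₀ (by linarith)]
    push_cast
    nlinarith

/-- One step adds an error of about `(a + 6) η`, because the iterate has norm at most `a + 5`;
summing gives quadratic growth in `a`. The smallness `hηA` controls the division by `p'`, whose norm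
may be slightly below `1`. -/
theorem norm_stepF_iterate_sub_le {p p' Z : ℂ} {η : ℝ} {A : ℕ} (hp : 1 ≤ ‖p‖)
    (hη : ‖p - p'‖ ≤ η) (hη0 : 0 ≤ η) (hηA : 5000 * (η * A ^ 2) ≤ 1) (hZ : ‖Z‖ ≤ 5) (a : ℕ)
    (ha : a ≤ A) : ‖(stepF p')^[a] Z - (stepF p)^[a] Z‖ ≤ 10 * a ^ 2 * η := by
  induction a with
  | zero => simp
  | succ a ih =>
    have hA1 : (1 : ℝ) ≤ A := by exact_mod_cast (by omega : 1 ≤ A)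
    have haA : (a : ℝ) ≤ A := by exact_mod_cast (by omega : a ≤ A)
    have hη1 : η ≤ 1 / 5000 := by nlinarith [mul_le_mul_of_nonneg_left (one_le_pow₀ hA1 : 1 ≤ (A : ℝ) ^ 2) hη0]
    have hp' : 1 - η ≤ ‖p'‖ := by
      have := norm_sub_norm_le p p'
      linarith
    have hp0 : p ≠ 0 := norm_pos_iff.1 (by linarith)
    have hp0' : p' ≠ 0 := norm_pos_iff.1 (by linarith)
    rw [Function.iterate_succ_apply', Function.iterate_succ_apply']
    have hY := norm_stepF_iterate_le (Z := Z) hp a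
    have ih := ih (by omega)
    generalize (stepF p')^[a] Z = Y' at *
    generalize (stepF p)^[a] Z = Y at *
    have e : stepF p' Y' - stepF p Y = ((Y' - Y) + (1 + Y) / p * (p - p')) / p' := by
      unfold stepF; field_simp; ring
    rw [e, norm_div, div_le_iff₀ (by linarith)]
    have h1 : ‖(1 + Y) / p * (p - p')‖ ≤ (a + 6) * η := by
      rw [norm_mul, norm_div]
      have : ‖1 + Y‖ / ‖p‖ ≤ a + 6 := by
        rw [div_le_iff₀ (by linarith)]
        have h2 : ‖1 + Y‖ ≤ 1 + ‖Y‖ := (norm_add_le _ _).trans (by simp)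
        have : (0 : ℝ) ≤ a := Nat.cast_nonneg a
        nlinarith
      exact mul_le_mul this hη (norm_nonneg _) (by positivity)
    refine (norm_add_le _ _).trans ((add_le_add ih h1).trans ?_)
    have ha0 : (0 : ℝ) ≤ a := Nat.cast_nonneg a
    have h3 : 10 * ((a + 1 : ℕ) : ℝ) ^ 2 * η * (1 - η) ≤ 10 * ((a + 1 : ℕ) : ℝ) ^ 2 * η * ‖p'‖ := by
      gcongr
    refine le_trans ?_ h3
    push_cast
    have h4 : ((a : ℝ) + 1) ^ 2 * η ≤ 1 / 5000 := by
      have : ((a : ℝ) + 1) ≤ A := by exact_mod_cast ha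
      have : ((a : ℝ) + 1) ^ 2 ≤ (A : ℝ) ^ 2 := by gcongr
      nlinarith
    have h5 : 10 * (a : ℝ) ^ 2 + (a + 6) ≤ 10 * ((a : ℝ) + 1) ^ 2 - 10 * (((a : ℝ) + 1) ^ 2 * η) := by
      nlinarith
    nlinarith

theorem norm_le_five_of_mem {Z : ℂ} (hZ : Z ∈ spiralDisc) : ‖Z‖ ≤ 5 := by
  have h1 : ‖Z - 2‖ ≤ √5 := hZ
  have h2 := norm_sub_norm_le Z 2
  have := sqrt_five_bounds.2
  simp at h2
  linarith

/-- The margin `1 / 500` on the closed unit disc around `2` absorbs the error `10 A² η = 1 / 500`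
made by moving `p` by at most `η`. -/
theorem spiralInvariant_of_norm_le {p : ℂ} {A : ℕ} (hA : 1 ≤ A)
    (hp : ‖p - 2‖ ≤ 1 + 1 / (5000 * (A : ℝ) ^ 2)) : p ≠ 0 ∧ SpiralInvariant A p := by
  have hA1 : (1 : ℝ) ≤ A := by exact_mod_cast hA
  set η := 1 / (5000 * (A : ℝ) ^ 2) with hη
  have hη0 : 0 < η := by positivity
  have hηA : 5000 * (η * A ^ 2) = 1 := by rw [hη]; field_simp
  have hη1 : η ≤ 1 / 5000 := by nlinarith [mul_le_mul_of_nonneg_left (one_le_pow₀ hA1 : 1 ≤ (A : ℝ) ^ 2) hη0.le]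
  -- Radial contraction of `p` into the closed unit disc around `2`.
  set p₀ : ℂ := 2 + (p - 2) / ((1 + η : ℝ) : ℂ) with hp₀
  have hc : ((1 + η : ℝ) : ℂ) ≠ 0 := by
    exact_mod_cast (by linarith : (1 + η : ℝ) ≠ 0)
  have h1 : ‖p₀ - 2‖ ≤ 1 := by
    rw [hp₀, add_sub_cancel_left, norm_div, Complex.norm_real, Real.norm_of_nonneg (by linarith),
      div_le_one (by linarith)]
    exact hp
  have h2 : ‖p₀ - p‖ ≤ η := by
    have e : p₀ - p = -((p - 2) / ((1 + η : ℝ) : ℂ)) * (η : ℝ) := by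
      rw [hp₀]; field_simp; push_cast; ring
    rw [e, norm_mul, norm_neg, Complex.norm_real, Real.norm_of_nonneg hη0.le]
    have : ‖(p - 2) / ((1 + η : ℝ) : ℂ)‖ ≤ 1 := by simpa [hp₀] using h1
    nlinarith
  have h3 := norm_ge_one_of_closedBall h1
  constructor
  · rintro rfl
    rw [sub_zero] at h2; linarith
  · intro a ha haA Z hZ
    have h4 := stepF_iterate_norm_lower h1 hZ a ha
    have h5 := norm_stepF_iterate_sub_le h3 h2 hη0.le hηA.le (norm_le_five_of_mem hZ) a haA
    have h6 : 10 * (a : ℝ) ^ 2 * η ≤ 1 / 500 := by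
      have : (a : ℝ) ≤ A := by exact_mod_cast haA
      have : (a : ℝ) ^ 2 ≤ (A : ℝ) ^ 2 := by gcongr
      nlinarith
    have h7 : ‖(stepF p₀)^[a] Z + 2‖ - ‖(stepF p)^[a] Z + 2‖ ≤
        ‖(stepF p)^[a] Z - (stepF p₀)^[a] Z‖ := by
      rw [norm_sub_rev]
      refine (norm_sub_norm_le _ _).trans_eq ?_
      congr 1; ring
    linarith

/-! ### Averages over words and the rarity of long runs -/

/-- The average of `F` over all words of length `N`. -/
noncomputable def wordAvg {E : Type*} [AddCommGroup E] [Module ℝ E] : ℕ → (List Bool → E) → E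
  | 0, F => F []
  | N + 1, F => (1 / 2 : ℝ) •
      (wordAvg N (fun l => F (true :: l)) + wordAvg N (fun l => F (false :: l)))

section wordAvg
variable {E E' : Type*} [AddCommGroup E] [Module ℝ E] [AddCommGroup E'] [Module ℝ E']

theorem wordAvg_add (N : ℕ) (F G : List Bool → E) :
    wordAvg N (fun l => F l + G l) = wordAvg N F + wordAvg N G := by
  induction N generalizing F G with
  | zero => rfl
  | succ N ih => simp only [wordAvg, ih, ← smul_add]; congr 1; abel

theorem wordAvg_map (T : E →ₗ[ℝ] E') (N : ℕ) (F : List Bool → E) :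
    wordAvg N (fun l => T (F l)) = T (wordAvg N F) := by
  induction N generalizing F with
  | zero => rfl
  | succ N ih => simp only [wordAvg, ih, map_smul, map_add]

theorem wordAvg_const (N : ℕ) (c : E) : wordAvg N (fun _ => c) = c := by
  induction N with
  | zero => rfl
  | succ N ih => rw [wordAvg, ih, ← two_smul ℝ c, smul_smul]; norm_num

theorem wordAvg_congr {N : ℕ} {F G : List Bool → E} (h : ∀ l, l.length = N → F l = G l) :
    wordAvg N F = wordAvg N G := by
  induction N generalizing F G with
  | zero => exact h [] rfl
  | succ N ih =>
    simp only [wordAvg]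
    rw [ih fun l hl => h (true :: l) (by simp [hl]), ih fun l hl => h (false :: l) (by simp [hl])]

/-- Splits off the innermost letter instead of the outermost one; self-similarity of the measure
acts at that end. -/
theorem wordAvg_succ_snoc (N : ℕ) (F : List Bool → E) :
    wordAvg (N + 1) F = (1 / 2 : ℝ) •
      (wordAvg N (fun l => F (l ++ [true])) + wordAvg N (fun l => F (l ++ [false]))) := by
  induction N generalizing F with
  | zero => rfl
  | succ N ih =>
    rw [wordAvg, ih, ih]
    simp only [wordAvg, List.cons_append, ← smul_add]
    congr 2; abel

theorem wordAvg_map_not (N : ℕ) (F : List Bool → E) :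
    wordAvg N (fun l => F (l.map not)) = wordAvg N F := by
  induction N generalizing F with
  | zero => rfl
  | succ N ih =>
    simp only [wordAvg, List.map_cons, Bool.not_true, Bool.not_false]
    rw [ih fun l => F (false :: l), ih fun l => F (true :: l), add_comm]

end wordAvg

theorem wordAvg_mono {N : ℕ} {F G : List Bool → ℝ} (h : ∀ l, l.length = N → F l ≤ G l) :
    wordAvg N F ≤ wordAvg N G := by
  induction N generalizing F G with
  | zero => exact h [] rfl
  | succ N ih =>
    simp only [wordAvg, smul_eq_mul]
    have h1 := ih fun l hl => h (true :: l) (by simp [hl])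
    have h2 := ih fun l hl => h (false :: l) (by simp [hl])
    linarith

theorem norm_wordAvg_le {E : Type*} [NormedAddCommGroup E] [NormedSpace ℝ E] (N : ℕ)
    (F : List Bool → E) : ‖wordAvg N F‖ ≤ wordAvg N (fun l => ‖F l‖) := by
  induction N generalizing F with
  | zero => exact le_rfl
  | succ N ih =>
    simp only [wordAvg, smul_eq_mul, norm_smul]
    have h3 := norm_add_le (wordAvg N fun l => F (true :: l)) (wordAvg N fun l => F (false :: l))
    have h1 := ih fun l => F (true :: l)
    have h2 := ih fun l => F (false :: l)
    have : ‖(1 / 2 : ℝ)‖ = 1 / 2 := by norm_num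
    rw [this]
    linarith

theorem norm_wordAvg_le_of_le {E : Type*} [NormedAddCommGroup E] [NormedSpace ℝ E] {N : ℕ}
    {F : List Bool → E} {C : ℝ} (h : ∀ l, l.length = N → ‖F l‖ ≤ C) : ‖wordAvg N F‖ ≤ C :=
  (norm_wordAvg_le N F).trans ((wordAvg_mono h).trans_eq (wordAvg_const N C))

-- Given the tail, at most one choice of the first letter prolongs its leading run, so each further
-- unit of length costs a factor `1 / 2`.
open Classical in
theorem wordAvg_leadRun_le (N k : ℕ) :
    wordAvg N (fun l => if k + 1 ≤ leadRun l then (1 : ℝ) else 0) ≤ (1 / 2) ^ k := by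
  induction k generalizing N with
  | zero =>
    refine (wordAvg_mono (G := fun _ => 1) fun l _ => ?_).trans_eq (by simp [wordAvg_const])
    split_ifs <;> norm_num
  | succ k ih =>
    cases N with
    | zero => simp [wordAvg, leadRun]
    | succ N =>
      rw [wordAvg, ← wordAvg_add, smul_eq_mul, pow_succ, mul_comm]
      refine mul_le_mul_of_nonneg_right ((wordAvg_mono fun l _ => ?_).trans (ih N)) (by norm_num)
      rcases h : l.head? with _ | b
      · simp only [leadRun, h]
        split_ifs <;> simp_all
      · cases b <;> simp only [leadRun, h] <;> split_ifs <;> simp_all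

-- Union bound over the starting positions of a run longer than `A`.
open Classical in
theorem wordAvg_not_runsLE_le (N A : ℕ) :
    wordAvg N (fun l => if RunsLE A l then (0 : ℝ) else 1) ≤ N * (1 / 2) ^ A := by
  induction N with
  | zero => simp [wordAvg, RunsLE]
  | succ N ih =>
    have h1 : wordAvg (N + 1) (fun l => if RunsLE A l then (0 : ℝ) else 1) ≤
        wordAvg (N + 1) (fun l => (if RunsLE A l.tail then (0 : ℝ) else 1) +
          (if A + 1 ≤ leadRun l then (1 : ℝ) else 0)) := by
      refine wordAvg_mono fun l hl => ?_
      cases l with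
      | nil => simp [RunsLE, leadRun]
      | cons b l =>
        simp only [RunsLE, List.tail_cons]
        by_cases h1 : RunsLE A l <;> by_cases h2 : leadRun (b :: l) ≤ A <;>
          simp [h1, h2, Nat.lt_of_not_le, Nat.not_lt_of_le]
    rw [wordAvg_add] at h1
    have h2 : wordAvg (N + 1) (fun l => if RunsLE A l.tail then (0 : ℝ) else 1) =
        wordAvg N (fun l => if RunsLE A l then (0 : ℝ) else 1) := by
      change (1 / 2 : ℝ) • (wordAvg N (fun l => if RunsLE A l then (0 : ℝ) else 1) +
        wordAvg N (fun l => if RunsLE A l then (0 : ℝ) else 1)) = _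
      rw [smul_eq_mul]; ring
    rw [h2] at h1
    have h3 := wordAvg_leadRun_le (N + 1) A
    push_cast
    linarith

/-- The `n`-th Taylor coefficient at `2`. -/
noncomputable def taylorCoeff (n : ℕ) (φ : ℂ → ℂ) : ℂ := iteratedDeriv n φ 2 / n.factorial

/-! ### Taylor coefficients at `2` -/

theorem hasSum_taylorCoeff {φ : ℂ → ℂ} {r : ℝ} (hφ : DifferentiableOn ℂ φ (Metric.ball 2 r))
    {p : ℂ} (hp : p ∈ Metric.ball 2 r) :
    HasSum (fun n => taylorCoeff n φ * (p - 2) ^ n) (φ p) := by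
  have h := Complex.hasSum_taylorSeries_on_ball hφ hp
  refine Eq.mp (congrArg (fun u => HasSum u (φ p)) (funext fun n => ?_)) h
  simp only [taylorCoeff, smul_eq_mul]
  ring

theorem analyticAt_of_hasSum {φ : ℂ → ℂ} {c : ℕ → ℂ}
    (h : ∀ᶠ p in 𝓝 (2 : ℂ), HasSum (fun n => c n * (p - 2) ^ n) (φ p)) :
    AnalyticAt ℂ φ 2 ∧ ∀ n, taylorCoeff n φ = c n := by
  have h1 : HasFPowerSeriesAt φ (FormalMultilinearSeries.ofScalars ℂ c) 2 := by
    rw [hasFPowerSeriesAt_iff]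
    have h2 : Tendsto (fun z : ℂ => 2 + z) (𝓝 0) (𝓝 2) := by
      have : ContinuousAt (fun z : ℂ => 2 + z) 0 := by fun_prop
      simpa [ContinuousAt] using this
    filter_upwards [h2.eventually h] with z hz
    simpa [FormalMultilinearSeries.coeff_ofScalars, mul_comm] using hz
  have h3 : AnalyticAt ℂ φ 2 := h1.analyticAt
  refine ⟨h3, fun n => ?_⟩
  have h4 := h3.hasFPowerSeriesAt.eq_formalMultilinearSeries h1
  have h5 := congrArg (fun q => FormalMultilinearSeries.coeff q n) h4
  simpa only [FormalMultilinearSeries.coeff_ofScalars, taylorCoeff] using h5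

theorem taylorCoeff_add {φ ψ : ℂ → ℂ} (hφ : AnalyticAt ℂ φ 2) (hψ : AnalyticAt ℂ ψ 2) (n : ℕ) :
    taylorCoeff n (fun p => φ p + ψ p) = taylorCoeff n φ + taylorCoeff n ψ := by
  unfold taylorCoeff
  have := iteratedDeriv_add (n := n) hφ.contDiffAt hψ.contDiffAt
  rw [← add_div, ← this]; rfl

theorem taylorCoeff_const_mul {φ : ℂ → ℂ} (hφ : AnalyticAt ℂ φ 2) (c : ℂ) (n : ℕ) :
    taylorCoeff n (fun p => c * φ p) = c * taylorCoeff n φ := by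
  unfold taylorCoeff
  rw [iteratedDeriv_const_mul c hφ.contDiffAt, mul_div_assoc]

theorem taylorCoeff_sub {φ ψ : ℂ → ℂ} (hφ : AnalyticAt ℂ φ 2) (hψ : AnalyticAt ℂ ψ 2) (n : ℕ) :
    taylorCoeff n (fun p => φ p - ψ p) = taylorCoeff n φ - taylorCoeff n ψ := by
  unfold taylorCoeff
  have := iteratedDeriv_sub (n := n) hφ.contDiffAt hψ.contDiffAt
  rw [← sub_div, ← this]; rfl

theorem taylorCoeff_congr {φ ψ : ℂ → ℂ} (h : φ =ᶠ[𝓝 2] ψ) (n : ℕ) :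
    taylorCoeff n φ = taylorCoeff n ψ := by
  unfold taylorCoeff
  rw [h.iteratedDeriv_eq]

theorem taylorCoeff_sum {ι : Type*} (s : Finset ι) {φ : ι → ℂ → ℂ}
    (hφ : ∀ i ∈ s, AnalyticAt ℂ (φ i) 2) (n : ℕ) :
    taylorCoeff n (fun p => ∑ i ∈ s, φ i p) = ∑ i ∈ s, taylorCoeff n (φ i) := by
  classical
  induction s using Finset.induction_on with
  | empty => simp [taylorCoeff]
  | insert i s hi ih =>
    simp only [Finset.sum_insert hi]
    rw [taylorCoeff_add (hφ i (by simp)), ih fun j hj => hφ j (by simp [hj])]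
    exact Finset.analyticAt_fun_sum _ fun j hj => hφ j (by simp [hj])

theorem norm_taylorCoeff_le {φ : ℂ → ℂ} {r C : ℝ} (hr : 0 < r)
    (hφ : DiffContOnCl ℂ φ (Metric.ball 2 r)) (hC : ∀ p ∈ Metric.sphere (2 : ℂ) r, ‖φ p‖ ≤ C)
    (n : ℕ) : ‖taylorCoeff n φ‖ ≤ C / r ^ n := by
  have h := Complex.norm_iteratedDeriv_le_of_forall_mem_sphere_norm_le n hr hφ hC
  unfold taylorCoeff
  rw [norm_div, Complex.norm_natCast, div_le_iff₀ (by positivity)]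
  refine h.trans_eq ?_
  ring

/-- Cauchy estimates on circles of radius tending to `0`. This transfers asymptotic identities in
`p` to identities between Taylor coefficients. -/
theorem taylorCoeff_eq_zero_of_isBigO {φ : ℂ → ℂ} (hφ : AnalyticAt ℂ φ 2) {n : ℕ} {C : ℝ}
    (hC : ∀ᶠ p in 𝓝 (2 : ℂ), ‖φ p‖ ≤ C * ‖p - 2‖ ^ (n + 1)) : taylorCoeff n φ = 0 := by
  obtain ⟨r₀, hr₀, h⟩ := Metric.eventually_nhds_iff_ball.1 (hC.and hφ.eventually_analyticAt)
  have key : ∀ r ∈ Set.Ioo 0 r₀, ‖taylorCoeff n φ‖ ≤ C * r := by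
    intro r hr
    have hsub : Metric.closedBall (2 : ℂ) r ⊆ Metric.ball 2 r₀ :=
      Metric.closedBall_subset_ball hr.2
    have h1 : DifferentiableOn ℂ φ (Metric.closedBall 2 r) := fun p hp =>
      (h p (hsub hp)).2.differentiableAt.differentiableWithinAt
    have h2 := norm_taylorCoeff_le (C := C * r ^ (n + 1)) hr.1 (h1.diffContOnCl_ball subset_rfl) (fun p hp => by
      have := (h p (hsub (Metric.sphere_subset_closedBall hp))).1
      rwa [mem_sphere_iff_norm.1 hp] at this) n
    refine h2.trans_eq ?_
    have := hr.1.ne'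
    rw [pow_succ, ← mul_assoc, mul_div_right_comm, mul_div_cancel_right₀ _ (pow_ne_zero n this)]
  have h3 : Tendsto (fun r : ℝ => C * r) (𝓝[>] 0) (𝓝 (C * 0)) :=
    (tendsto_id.const_mul C).mono_left nhdsWithin_le_nhds
  have h4 := ge_of_tendsto h3 (by
    filter_upwards [Ioo_mem_nhdsGT hr₀] with r hr using key r hr)
  rw [mul_zero] at h4
  exact norm_le_zero_iff.1 h4

theorem taylorCoeff_pow_mul {φ : ℂ → ℂ} (hφ : AnalyticAt ℂ φ 2) (m n : ℕ) :
    taylorCoeff n (fun p => (p - 2) ^ m * φ p) = if m ≤ n then taylorCoeff (n - m) φ else 0 := by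
  obtain ⟨r, hr, hd⟩ := Metric.eventually_nhds_iff_ball.1 hφ.eventually_analyticAt
  have hd' : DifferentiableOn ℂ φ (Metric.ball 2 r) := fun p hp =>
    (hd p hp).differentiableAt.differentiableWithinAt
  have h : ∀ᶠ p in 𝓝 (2 : ℂ), HasSum
      (fun n => (if m ≤ n then taylorCoeff (n - m) φ else 0) * (p - 2) ^ n)
      ((p - 2) ^ m * φ p) := by
    filter_upwards [Metric.ball_mem_nhds (2 : ℂ) hr] with p hp
    have h1 := (hasSum_taylorCoeff hd' hp).mul_left ((p - 2) ^ m)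
    have h2 : Function.Injective (fun n : ℕ => n + m) := add_left_injective m
    rw [← h2.hasSum_iff]
    · refine Eq.mp (congrArg (fun u => HasSum u _) (funext fun k => ?_)) h1
      simp only [Function.comp_apply, Nat.le_add_left, if_true, Nat.add_sub_cancel]
      ring
    · intro n hn
      have : ¬ m ≤ n := fun hle => hn ⟨n - m, by simp; omega⟩
      simp [this]
  exact (analyticAt_of_hasSum h).2 n

theorem analyticAt_wordAvg {φ : List Bool → ℂ → ℂ} {p : ℂ} {N : ℕ}
    (hφ : ∀ l, l.length = N → AnalyticAt ℂ (φ l) p) :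
    AnalyticAt ℂ (fun p => wordAvg N (fun l => φ l p)) p := by
  induction N generalizing φ with
  | zero => exact hφ [] rfl
  | succ N ih =>
    simp only [wordAvg, Complex.real_smul]
    exact analyticAt_const.mul ((ih fun l hl => hφ (true :: l) (by simp [hl])).add
      (ih fun l hl => hφ (false :: l) (by simp [hl])))

theorem taylorCoeff_wordAvg {φ : List Bool → ℂ → ℂ} {N : ℕ}
    (hφ : ∀ l, l.length = N → AnalyticAt ℂ (φ l) 2) (n : ℕ) :
    taylorCoeff n (fun p => wordAvg N (fun l => φ l p)) =
      wordAvg N (fun l => taylorCoeff n (φ l)) := by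
  induction N generalizing φ with
  | zero => rfl
  | succ N ih =>
    have h1 : ∀ l : List Bool, l.length = N → AnalyticAt ℂ (φ (true :: l)) 2 :=
      fun l hl => hφ (true :: l) (by simp [hl])
    have h2 : ∀ l : List Bool, l.length = N → AnalyticAt ℂ (φ (false :: l)) 2 :=
      fun l hl => hφ (false :: l) (by simp [hl])
    have a1 := analyticAt_wordAvg h1
    have a2 := analyticAt_wordAvg h2
    simp only [wordAvg, Complex.real_smul]
    rw [taylorCoeff_const_mul (a1.fun_add a2), taylorCoeff_add a1 a2, ih h1, ih h2]

/-! ### The finite approximations of `G(p, z)` -/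

/-- The average of `1 / (X + 1 - z)` over the images `X` of `1` under all words of length `N`. -/
noncomputable def wordPeriod (N : ℕ) (p z : ℂ) : ℂ :=
  wordAvg N (fun l => 1 / (wordMap p l 1 + 1 - z))

/-- The set of `z` on which the expansion of the dyadic period function is considered. -/
def periodRegion : Set ℂ := {z | ‖z‖ ≤ 3 / 4 ∨ ‖z + 9 / 7‖ ≤ 12 / 7}

/-- This is where the region for `z` enters. The point `z - 1` must avoid `‖X - 2‖ ≤ √5`, which
holds as `3 / 4 < 3 - √5` and `12 / 7 < 30 / 7 - √5`; and it must lie strictly inside `‖X + 2‖ <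
√5`, which follows from `‖z + 1‖ ≤ 2 < √5`. -/
theorem norm_lower_of_mem_spiralDisc {z X : ℂ} (hz : z ∈ periodRegion)
    (hX : X ≠ 0 ∧ (X ∈ spiralDisc ∨ X⁻¹ ∈ spiralDisc)) : 1 / 100 ≤ ‖X + 1 - z‖ := by
  obtain ⟨h5, h5'⟩ := sqrt_five_bounds
  obtain ⟨h0, hX | hX⟩ := hX
  · have hX : ‖X - 2‖ ≤ √5 := hX
    rw [norm_sub_rev] at hX
    rcases hz with hz | hz
    · have h1 : ‖(3 : ℂ)‖ ≤ ‖X + 1 - z‖ + ‖2 - X‖ + ‖z‖ := by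
        refine le_trans (le_of_eq ?_) (norm_add₃_le (a := X + 1 - z) (b := 2 - X) (c := z))
        congr 1; ring
      norm_num at h1
      linarith
    · have h1 : ‖(30 / 7 : ℂ)‖ ≤ ‖X + 1 - z‖ + ‖2 - X‖ + ‖z + 9 / 7‖ := by
        refine le_trans (le_of_eq ?_) (norm_add₃_le (a := X + 1 - z) (b := 2 - X) (c := z + 9 / 7))
        congr 1; ring
      norm_num at h1
      linarith
  · have hX := (inv_mem_spiralDisc_iff h0).1 hX
    have hz1 : ‖z + 1‖ ≤ 2 := by
      rcases hz with hz | hz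
      · have := norm_add_le z 1
        rw [norm_one] at this
        linarith
      · have := norm_add_le (z + 9 / 7) (-(2 / 7))
        rw [show z + 9 / 7 + -(2 / 7) = z + 1 by ring] at this
        norm_num at this
        linarith
    have h1 : ‖X + 2‖ ≤ ‖X + 1 - z‖ + ‖z + 1‖ := by
      refine le_trans (le_of_eq ?_) (norm_add_le (X + 1 - z) (z + 1))
      congr 1; ring
    linarith

theorem norm_taylorCoeff_word_le {z : ℂ} (hz : z ∈ periodRegion) {A : ℕ} {r : ℝ} (hr : 0 < r)
    (hA : ∀ p : ℂ, ‖p - 2‖ ≤ r → p ≠ 0 ∧ SpiralInvariant A p) {l : List Bool} (hl : RunsLE A l)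
    (n : ℕ) : ‖taylorCoeff n (fun p => 1 / (wordMap p l 1 + 1 - z))‖ ≤ 100 / r ^ n := by
  have hlow : ∀ p : ℂ, ‖p - 2‖ ≤ r → 1 / 100 ≤ ‖wordMap p l 1 + 1 - z‖ := fun p hp =>
    norm_lower_of_mem_spiralDisc hz (wordMap_mem (hA p hp).1 (hA p hp).2 l hl)
  have hd : DifferentiableOn ℂ (fun p => 1 / (wordMap p l 1 + 1 - z)) (Metric.closedBall 2 r) := by
    intro p hp
    have hp' := mem_closedBall_iff_norm.1 hp
    have h1 := differentiableAt_wordMap (hA p hp').1 (hA p hp').2 l hl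
    have h2 := hlow p hp'
    refine ((differentiableAt_const 1).div ((h1.add_const 1).sub_const z) ?_).differentiableWithinAt
    intro h0
    rw [h0, norm_zero] at h2
    norm_num at h2
  refine norm_taylorCoeff_le hr (hd.diffContOnCl_ball subset_rfl) (fun p hp => ?_) n
  have h2 := hlow p (mem_sphere_iff_norm.1 hp).le
  rw [norm_div, norm_one, div_le_iff₀ (by linarith)]
  linarith

theorem analyticAt_wordMap_two (l : List Bool) {p : ℂ} (hp : ‖p - 2‖ < 1) :
    AnalyticAt ℂ (fun p => wordMap p l 1) p := by
  have hd : DifferentiableOn ℂ (fun p => wordMap p l 1) (Metric.ball 2 1) := by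
    intro q hq
    have hq := (mem_ball_iff_norm.1 hq).le
    exact (differentiableAt_wordMap (norm_pos_iff.1 (by linarith [norm_ge_one_of_closedBall hq]))
      (spiralInvariant_of_closedBall hq l.length) l
      (runsLE_of_length_le l le_rfl)).differentiableWithinAt
  exact hd.analyticAt (Metric.isOpen_ball.mem_nhds (mem_ball_iff_norm.2 hp))

theorem wordPeriod_den_ne_zero {z : ℂ} (hz : z ∈ periodRegion) (l : List Bool) {A : ℕ} {p : ℂ}
    (hp : p ≠ 0 ∧ SpiralInvariant A p) (hl : RunsLE A l) : wordMap p l 1 + 1 - z ≠ 0 := by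
  have := norm_lower_of_mem_spiralDisc hz (wordMap_mem hp.1 hp.2 l hl)
  intro h0
  rw [h0, norm_zero] at this
  norm_num at this

theorem closedBall_spiralInvariant {p : ℂ} (hp : ‖p - 2‖ ≤ 1) (A : ℕ) :
    p ≠ 0 ∧ SpiralInvariant A p :=
  ⟨norm_pos_iff.1 (by linarith [norm_ge_one_of_closedBall hp]), spiralInvariant_of_closedBall hp A⟩

theorem analyticAt_word {z : ℂ} (hz : z ∈ periodRegion) (l : List Bool) :
    AnalyticAt ℂ (fun p => 1 / (wordMap p l 1 + 1 - z)) 2 := by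
  refine analyticAt_const.div
    (((analyticAt_wordMap_two l (by simp)).add analyticAt_const).sub analyticAt_const) ?_
  exact wordPeriod_den_ne_zero hz l (closedBall_spiralInvariant (by simp) l.length)
    (runsLE_of_length_le l le_rfl)

/-- The main estimate: words with short runs extend to a larger disc, the others are rare. -/
theorem norm_taylorCoeff_wordPeriod_le {z : ℂ} (hz : z ∈ periodRegion) {A : ℕ} (hA : 1 ≤ A)
    (N n : ℕ) : ‖taylorCoeff n (fun p => wordPeriod N p z)‖ ≤
      100 / (1 + 1 / (5000 * (A : ℝ) ^ 2)) ^ n + 100 * (N * (1 / 2) ^ A) := by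
  classical
  have hA0 : (0 : ℝ) < A := by exact_mod_cast hA
  unfold wordPeriod
  rw [taylorCoeff_wordAvg fun l _ => analyticAt_word hz l]
  refine (norm_wordAvg_le _ _).trans ?_
  have h1 : wordAvg N (fun l => ‖taylorCoeff n (fun p => 1 / (wordMap p l 1 + 1 - z))‖) ≤
      wordAvg N (fun l => 100 / (1 + 1 / (5000 * (A : ℝ) ^ 2)) ^ n +
        LinearMap.mulLeft ℝ 100 (if RunsLE A l then (0 : ℝ) else 1)) := by
    refine wordAvg_mono fun l _ => ?_
    by_cases hl : RunsLE A l
    · rw [if_pos hl, map_zero, add_zero]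
      exact norm_taylorCoeff_word_le hz (by positivity)
        (fun p hp => spiralInvariant_of_norm_le hA hp) hl n
    -- Words with long runs are still holomorphic on the unit disc around `2`, so their coefficients
    -- are bounded by `100`.
    · rw [if_neg hl]
      have := norm_taylorCoeff_word_le hz one_pos
        (fun p hp => closedBall_spiralInvariant hp l.length) (runsLE_of_length_le l le_rfl) n
      simp only [one_pow, div_one] at this
      have h0 : 0 ≤ 100 / (1 + 1 / (5000 * (A : ℝ) ^ 2)) ^ n := by positivity
      simp only [LinearMap.mulLeft_apply, mul_one]
      linarith
  rw [wordAvg_add, wordAvg_const, wordAvg_map] at h1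
  refine h1.trans ?_
  simp only [LinearMap.mulLeft_apply]
  gcongr
  exact wordAvg_not_runsLE_le N A

/-- The Taylor series of the finite approximations converge at `p = 1`. -/
theorem hasSum_wordPeriod_one {z : ℂ} (hz : z ∈ periodRegion) (N : ℕ) :
    HasSum (fun n => (-1) ^ n * taylorCoeff n (fun p => wordPeriod N p z)) (wordPeriod N 1 z) := by
  -- All runs of a word of length `N` are at most `A`, so for fixed `N` the average is holomorphic
  -- on a disc of radius larger than `1`, containing `p = 1`. The added `1` ensures `A ≥ 1` when `N
  -- = 0`.
  set A := N + 1 with hA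
  set r : ℝ := 1 + 1 / (5000 * (A : ℝ) ^ 2) with hr
  have hA0 : (0 : ℝ) < A := by rw [hA]; positivity
  have hd : DifferentiableOn ℂ (fun p => wordPeriod N p z) (Metric.ball 2 r) := by
    have h : ∀ l : List Bool, l.length ≤ N → DifferentiableOn ℂ
        (fun p => 1 / (wordMap p l 1 + 1 - z)) (Metric.ball 2 r) := by
      intro l hl p hp
      have h1 := spiralInvariant_of_norm_le (A := A) (by omega) (mem_ball_iff_norm.1 hp).le
      have hl' := runsLE_of_length_le (A := A) l (by omega)
      have h2 := differentiableAt_wordMap h1.1 h1.2 l hl'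
      exact ((differentiableAt_const 1).div ((h2.add_const 1).sub_const z)
        (wordPeriod_den_ne_zero hz l h1 hl')).differentiableWithinAt
    have h' : ∀ l : List Bool, l.length = N → ∀ p ∈ Metric.ball (2 : ℂ) r,
        AnalyticAt ℂ (fun p => 1 / (wordMap p l 1 + 1 - z)) p := fun l hl p hp =>
      (h l hl.le).analyticAt (Metric.isOpen_ball.mem_nhds hp)
    intro p hp
    exact (analyticAt_wordAvg fun l hl => h' l hl p hp).differentiableAt.differentiableWithinAt
  have h1 := hasSum_taylorCoeff hd (p := 1) (by
    rw [mem_ball_iff_norm, show (1 : ℂ) - 2 = -1 by norm_num, norm_neg, norm_one, hr,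
      lt_add_iff_pos_right]
    positivity)
  refine Eq.mp (congrArg (fun u => HasSum u _) (funext fun n => ?_)) h1
  norm_num
  ring

/-! ### The Cayley coordinate near `p = 2` -/

/-- The coordinate `(X - 1) / (X + 1)`. -/
noncomputable def cayley (X : ℂ) : ℂ := (X - 1) / (X + 1)

/-- The points `X` whose Cayley coordinate is bounded by `2 / 5`. -/
def cayleyDisc : Set ℂ := {X | X + 1 ≠ 0 ∧ ‖cayley X‖ ≤ 2 / 5}

theorem ne_zero_of_mem_cayleyDisc {X : ℂ} (h : X ∈ cayleyDisc) : X ≠ 0 := by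
  rintro rfl
  have := h.2
  norm_num [cayley] at this

theorem one_sub_cayley {X : ℂ} (h : X + 1 ≠ 0) : 1 - cayley X = 2 / (X + 1) := by
  rw [cayley]; field_simp; ring

theorem one_mem_cayleyDisc : (1 : ℂ) ∈ cayleyDisc := by
  constructor <;> norm_num [cayley]

theorem cayley_one : cayley 1 = 0 := by norm_num [cayley]

theorem cayley_inv {X : ℂ} (h0 : X ≠ 0) : cayley X⁻¹ = -cayley X := by
  rw [cayley, cayley, ← neg_div]
  by_cases h : X + 1 = 0
  · have : X = -1 := by linear_combination h
    subst this; norm_num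
  · have : 1 + X ≠ 0 := by rwa [add_comm]
    rw [show X⁻¹ - 1 = (1 - X) / X by field_simp, show X⁻¹ + 1 = (1 + X) / X by field_simp,
      div_div_div_cancel_right₀ h0, add_comm 1 X]
    ring

theorem inv_mem_cayleyDisc {X : ℂ} (h : X ∈ cayleyDisc) : X⁻¹ ∈ cayleyDisc := by
  have h0 := ne_zero_of_mem_cayleyDisc h
  refine ⟨fun h' => h.1 ?_, by rw [cayley_inv h0, norm_neg]; exact h.2⟩
  field_simp at h'
  linear_combination h'

theorem eq_of_cayley {X : ℂ} (h : X ∈ cayleyDisc) : X = (1 + cayley X) / (1 - cayley X) := by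
  have := h.1
  rw [one_sub_cayley h.1, cayley]
  field_simp
  ring

theorem cayley_stepF_den {p v : ℂ} (hp : ‖p - 2‖ ≤ 1 / 20) (hv : ‖v‖ ≤ 2 / 5) :
    3.13 ≤ ‖2 + p - p * v‖ := by
  have h1 : ‖p‖ ≤ 2.05 := by
    have := norm_add_le (p - 2) 2
    rw [sub_add_cancel] at this
    norm_num at this ⊢; linarith
  have h2 : ‖p * v‖ ≤ 0.82 := by
    rw [norm_mul]; nlinarith [norm_nonneg p, norm_nonneg v]
  have h3 : (4 : ℝ) ≤ ‖2 + p - p * v‖ + ‖p - 2‖ + ‖p * v‖ := by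
    have h4 := norm_sub_le (2 + p - p * v + p * v) (p - 2)
    have h5 := norm_add_le (2 + p - p * v) (p * v)
    have : (2 + p - p * v + p * v) - (p - 2) = 4 := by ring
    rw [this, Complex.norm_ofNat] at h4
    linarith
  linarith

/-- In this coordinate `stepF 2` fixes `0` with derivative `1 / 2`, so for `p` near `2` both maps
are contractions near `0`. -/
theorem cayley_stepF {p X : ℂ} (hp : ‖p - 2‖ ≤ 1 / 20) (hX : X ∈ cayleyDisc) :
    stepF p X + 1 ≠ 0 ∧
      cayley (stepF p X) = (2 - p + p * cayley X) / (2 + p - p * cayley X) := by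
  have hp0 : p ≠ 0 := by
    rintro rfl; norm_num at hp
  have hd := cayley_stepF_den hp hX.2
  have hd0 : 2 + p - p * cayley X ≠ 0 := by
    intro h; rw [h] at hd; norm_num at hd
  have e1 : stepF p X + 1 = (X + 1) / (2 * p) * (2 + p - p * cayley X) := by
    have := hX.1
    rw [stepF, cayley]; field_simp; ring
  have e2 : stepF p X - 1 = (X + 1) / (2 * p) * (2 - p + p * cayley X) := by
    have := hX.1
    rw [stepF, cayley]; field_simp; ring
  have h0 : (X + 1) / (2 * p) ≠ 0 := div_ne_zero hX.1 (mul_ne_zero two_ne_zero hp0)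
  refine ⟨by rw [e1]; exact mul_ne_zero h0 hd0, ?_⟩
  rw [cayley, e1, e2, mul_div_mul_left _ _ h0]

theorem norm_le_of_near_two {p : ℂ} (hp : ‖p - 2‖ ≤ 1 / 20) : ‖p‖ ≤ 2.05 := by
  have := norm_add_le (p - 2) 2
  rw [sub_add_cancel] at this
  norm_num at this ⊢; linarith

/-- With `δ = 0` the disc of radius `‖p - 2‖` is invariant; with `δ > 0` orbits starting outside
approach it geometrically. -/
theorem norm_cayley_stepF_le {p X : ℂ} (hp : ‖p - 2‖ ≤ 1 / 20) (hX : X ∈ cayleyDisc) {δ : ℝ}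
    (hδ : 0 ≤ δ) (h : ‖cayley X‖ ≤ ‖p - 2‖ + δ) :
    ‖cayley (stepF p X)‖ ≤ ‖p - 2‖ + 21 / 25 * δ := by
  have hd := cayley_stepF_den hp hX.2
  have hpn := norm_le_of_near_two hp
  rw [(cayley_stepF hp hX).2, norm_div, div_le_iff₀ (by linarith)]
  have h1 : ‖2 - p + p * cayley X‖ ≤ ‖p - 2‖ + 2.05 * ‖cayley X‖ := by
    refine (norm_add_le _ _).trans ?_
    rw [norm_mul, norm_sub_rev]
    gcongr
  have := norm_nonneg (p - 2)
  nlinarith [norm_nonneg (p - 2)]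

theorem stepF_mem_cayleyDisc {p X : ℂ} (hp : ‖p - 2‖ ≤ 1 / 20) (hX : X ∈ cayleyDisc) :
    stepF p X ∈ cayleyDisc := by
  refine ⟨(cayley_stepF hp hX).1, ?_⟩
  have hd := cayley_stepF_den hp hX.2
  have hpn := norm_le_of_near_two hp
  rw [(cayley_stepF hp hX).2, norm_div, div_le_iff₀ (by linarith)]
  have h1 : ‖2 - p + p * cayley X‖ ≤ ‖p - 2‖ + 2.05 * ‖cayley X‖ := by
    refine (norm_add_le _ _).trans ?_
    rw [norm_mul, norm_sub_rev]
    gcongr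
  have := hX.2
  nlinarith

/-- The difference is `4p (v - w)` over the product of the two denominators, each at least `3.13`,
and `4 · 2.05 ≤ (21 / 25) · 3.13²`. -/
theorem norm_cayley_stepF_sub_le {p X Y : ℂ} (hp : ‖p - 2‖ ≤ 1 / 20) (hX : X ∈ cayleyDisc)
    (hY : Y ∈ cayleyDisc) :
    ‖cayley (stepF p X) - cayley (stepF p Y)‖ ≤ 21 / 25 * ‖cayley X - cayley Y‖ := by
  have hdX := cayley_stepF_den hp hX.2
  have hdY := cayley_stepF_den hp hY.2
  have hX0 : 2 + p - p * cayley X ≠ 0 := by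
    intro h; rw [h] at hdX; norm_num at hdX
  have hY0 : 2 + p - p * cayley Y ≠ 0 := by
    intro h; rw [h] at hdY; norm_num at hdY
  have hpn := norm_le_of_near_two hp
  rw [(cayley_stepF hp hX).2, (cayley_stepF hp hY).2]
  have e : (2 - p + p * cayley X) / (2 + p - p * cayley X) -
      (2 - p + p * cayley Y) / (2 + p - p * cayley Y) =
      4 * p * (cayley X - cayley Y) / ((2 + p - p * cayley X) * (2 + p - p * cayley Y)) := by
    field_simp; ring
  rw [e, norm_div, norm_mul, norm_mul, norm_mul, div_le_iff₀ (by positivity)]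
  have h1 : 9.79 ≤ ‖2 + p - p * cayley X‖ * ‖2 + p - p * cayley Y‖ := by nlinarith
  have h2 := norm_nonneg (cayley X - cayley Y)
  have h4 : ‖(4 : ℂ)‖ = 4 := by norm_num
  rw [h4]
  have h5 : 4 * ‖p‖ ≤ 21 / 25 * (‖2 + p - p * cayley X‖ * ‖2 + p - p * cayley Y‖) := by linarith
  nlinarith

theorem stepG_eq_inv {p X : ℂ} (hX : X ≠ 0) : stepG p X = (stepF p X⁻¹)⁻¹ := by
  rw [← inv_stepG hX, inv_inv]

theorem stepG_mem_cayleyDisc {p X : ℂ} (hp : ‖p - 2‖ ≤ 1 / 20) (hX : X ∈ cayleyDisc) :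
    stepG p X ∈ cayleyDisc := by
  rw [stepG_eq_inv (ne_zero_of_mem_cayleyDisc hX)]
  exact inv_mem_cayleyDisc (stepF_mem_cayleyDisc hp (inv_mem_cayleyDisc hX))

theorem cayley_stepG {p X : ℂ} (hp : ‖p - 2‖ ≤ 1 / 20) (hX : X ∈ cayleyDisc) :
    cayley (stepG p X) = -cayley (stepF p X⁻¹) := by
  rw [stepG_eq_inv (ne_zero_of_mem_cayleyDisc hX), cayley_inv (ne_zero_of_mem_cayleyDisc
    (stepF_mem_cayleyDisc hp (inv_mem_cayleyDisc hX)))]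

theorem norm_cayley_stepG_le {p X : ℂ} (hp : ‖p - 2‖ ≤ 1 / 20) (hX : X ∈ cayleyDisc)
    (h : ‖cayley X‖ ≤ ‖p - 2‖) : ‖cayley (stepG p X)‖ ≤ ‖p - 2‖ := by
  rw [cayley_stepG hp hX, norm_neg]
  have := norm_cayley_stepF_le hp (inv_mem_cayleyDisc hX) le_rfl (by
    rwa [cayley_inv (ne_zero_of_mem_cayleyDisc hX), norm_neg, add_zero])
  simpa using this

theorem norm_cayley_stepG_sub_le {p X Y : ℂ} (hp : ‖p - 2‖ ≤ 1 / 20) (hX : X ∈ cayleyDisc)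
    (hY : Y ∈ cayleyDisc) :
    ‖cayley (stepG p X) - cayley (stepG p Y)‖ ≤ 21 / 25 * ‖cayley X - cayley Y‖ := by
  have h := norm_cayley_stepF_sub_le hp (inv_mem_cayleyDisc hX) (inv_mem_cayleyDisc hY)
  rw [cayley_inv (ne_zero_of_mem_cayleyDisc hX), cayley_inv (ne_zero_of_mem_cayleyDisc hY)] at h
  rw [cayley_stepG hp hX, cayley_stepG hp hY, neg_sub_neg, norm_sub_rev]
  rwa [neg_sub_neg, norm_sub_rev (cayley Y)] at h

/-- The small disc `‖cayley X‖ ≤ ‖p - 2‖`, which contains all values of `pContFract p`. -/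
def cayleyNear (p : ℂ) : Set ℂ := {X | X ∈ cayleyDisc ∧ ‖cayley X‖ ≤ ‖p - 2‖}

theorem one_mem_cayleyNear (p : ℂ) : 1 ∈ cayleyNear p :=
  ⟨one_mem_cayleyDisc, by rw [cayley_one, norm_zero]; positivity⟩

theorem inv_mem_cayleyNear {p X : ℂ} (hX : X ∈ cayleyNear p) : X⁻¹ ∈ cayleyNear p :=
  ⟨inv_mem_cayleyDisc hX.1, by
    rw [cayley_inv (ne_zero_of_mem_cayleyDisc hX.1), norm_neg]; exact hX.2⟩

theorem stepF_mem_cayleyNear {p X : ℂ} (hp : ‖p - 2‖ ≤ 1 / 20) (hX : X ∈ cayleyNear p) :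
    stepF p X ∈ cayleyNear p :=
  ⟨stepF_mem_cayleyDisc hp hX.1, by
    simpa using norm_cayley_stepF_le hp hX.1 le_rfl (by simpa using hX.2)⟩

theorem stepG_mem_cayleyNear {p X : ℂ} (hp : ‖p - 2‖ ≤ 1 / 20) (hX : X ∈ cayleyNear p) :
    stepG p X ∈ cayleyNear p :=
  ⟨stepG_mem_cayleyDisc hp hX.1, norm_cayley_stepG_le hp hX.1 hX.2⟩

theorem wordMap_mem_cayleyNear {p X : ℂ} (hp : ‖p - 2‖ ≤ 1 / 20) (hX : X ∈ cayleyNear p)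
    (l : List Bool) : wordMap p l X ∈ cayleyNear p := by
  induction l with
  | nil => exact hX
  | cons b l ih =>
    cases b
    · exact stepG_mem_cayleyNear hp ih
    · exact stepF_mem_cayleyNear hp ih

theorem norm_cayley_wordMap_sub_le {p X Y : ℂ} (hp : ‖p - 2‖ ≤ 1 / 20) (hX : X ∈ cayleyNear p)
    (hY : Y ∈ cayleyNear p) (l : List Bool) :
    ‖cayley (wordMap p l X) - cayley (wordMap p l Y)‖ ≤
      (21 / 25) ^ l.length * ‖cayley X - cayley Y‖ := by
  induction l with
  | nil => simp [wordMap]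
  | cons b l ih =>
    have hX' := (wordMap_mem_cayleyNear hp hX l).1
    have hY' := (wordMap_mem_cayleyNear hp hY l).1
    rw [List.length_cons, pow_succ']
    cases b
    · refine (norm_cayley_stepG_sub_le hp hX' hY').trans ?_
      rw [mul_assoc]; gcongr
    · refine (norm_cayley_stepF_sub_le hp hX' hY').trans ?_
      rw [mul_assoc]; gcongr

/-- Inversion conjugates `stepF p` and `stepG p` into each other. Since the start `1` is its own
inverse, the set of word images is symmetric under inversion. -/
theorem wordMap_map_not {p X : ℂ} (hp : ‖p - 2‖ ≤ 1 / 20) (hX : X ∈ cayleyNear p)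
    (l : List Bool) : wordMap p (l.map not) X⁻¹ = (wordMap p l X)⁻¹ := by
  induction l with
  | nil => rfl
  | cons b l ih =>
    have h0 := ne_zero_of_mem_cayleyDisc (wordMap_mem_cayleyNear hp hX l).1
    cases b
    · simp only [List.map_cons, Bool.not_false, wordMap, ih]
      rw [inv_stepG h0]
    · simp only [List.map_cons, Bool.not_true, wordMap, ih]
      rw [stepG_eq_inv (inv_ne_zero h0), inv_inv]

/-! ### Convergence of the `p`-continued fractions -/

/-- A partial quotient `a` of the `p`-continued fraction is `a` applications of `stepF p` to the
inverse of the next tail. -/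
theorem pWeight_add_eq_iterate {p : ℂ} (hp : p ≠ 0) (a : ℕ) (Y : ℂ) :
    pWeight p a + (p ^ a)⁻¹ * Y = (stepF p)^[a] Y := by
  induction a generalizing Y with
  | zero => simp [pWeight]
  | succ a ih =>
    rw [Function.iterate_succ_apply, ← ih, pWeight, Finset.sum_range_succ, ← pWeight, stepF]
    field_simp
    ring

/-- The argument of the outermost iterate of `stepF p` in `pConvergent p (n + 1) x`. -/
noncomputable def pTail (p : ℂ) (n : ℕ) (x : ℝ) : ℂ :=
  if Int.fract x = 0 then p - 1 else (pConvergent p n (Int.fract x)⁻¹)⁻¹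

theorem pConvergent_succ {p : ℂ} (hp : p ≠ 0) (n : ℕ) (x : ℝ) :
    pConvergent p (n + 1) x = (stepF p)^[⌊x⌋₊] (pTail p n x) := by
  rw [← pWeight_add_eq_iterate hp, pConvergent, pTail]

theorem iterate_stepF_mem_cayleyDisc {p Y : ℂ} (hp : ‖p - 2‖ ≤ 1 / 20) (hY : Y ∈ cayleyDisc)
    (a : ℕ) : (stepF p)^[a] Y ∈ cayleyDisc := by
  induction a with
  | zero => exact hY
  | succ a ih => rw [Function.iterate_succ_apply']; exact stepF_mem_cayleyDisc hp ih

theorem norm_cayley_iterate_sub_le {p X Y : ℂ} (hp : ‖p - 2‖ ≤ 1 / 20) (hX : X ∈ cayleyDisc)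
    (hY : Y ∈ cayleyDisc) (a : ℕ) :
    ‖cayley ((stepF p)^[a] X) - cayley ((stepF p)^[a] Y)‖ ≤
      (21 / 25) ^ a * ‖cayley X - cayley Y‖ := by
  induction a with
  | zero => simp
  | succ a ih =>
    rw [Function.iterate_succ_apply', Function.iterate_succ_apply', pow_succ', mul_assoc]
    refine (norm_cayley_stepF_sub_le hp (iterate_stepF_mem_cayleyDisc hp hX a)
      (iterate_stepF_mem_cayleyDisc hp hY a)).trans ?_
    gcongr

theorem norm_cayley_iterate_le {p X : ℂ} (hp : ‖p - 2‖ ≤ 1 / 20) (hX : X ∈ cayleyDisc) {δ : ℝ}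
    (hδ : 0 ≤ δ) (h : ‖cayley X‖ ≤ ‖p - 2‖ + δ) (a : ℕ) :
    ‖cayley ((stepF p)^[a] X)‖ ≤ ‖p - 2‖ + (21 / 25) ^ a * δ := by
  induction a with
  | zero => simpa using h
  | succ a ih =>
    rw [Function.iterate_succ_apply', pow_succ', mul_assoc]
    exact norm_cayley_stepF_le hp (iterate_stepF_mem_cayleyDisc hp hX a) (by positivity) ih

theorem pow_mul_le_of_le {a : ℕ} {δ δ' : ℝ} (h : δ ≤ δ') (hδ : 0 ≤ δ') :
    (21 / 25 : ℝ) ^ a * δ ≤ δ' ∧ (1 ≤ a → (21 / 25 : ℝ) ^ a * δ ≤ 21 / 25 * δ') := by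
  have h0 : (0 : ℝ) ≤ (21 / 25 : ℝ) ^ a := by positivity
  refine ⟨?_, fun ha => ?_⟩
  · have h1 : (21 / 25 : ℝ) ^ a ≤ 1 := pow_le_one₀ (by norm_num) (by norm_num)
    nlinarith
  · have h1 : (21 / 25 : ℝ) ^ a ≤ (21 / 25 : ℝ) ^ 1 :=
      pow_le_pow_of_le_one (by norm_num) (by norm_num) ha
    rw [pow_one] at h1
    nlinarith

theorem p_sub_one_mem_cayleyDisc {p : ℂ} (hp : ‖p - 2‖ ≤ 1 / 20) :
    p - 1 ∈ cayleyDisc ∧ ‖cayley (p - 1)‖ ≤ ‖p - 2‖ := by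
  have h1 : 1.95 ≤ ‖p‖ := by
    have := norm_sub_norm_le 2 p
    rw [norm_sub_rev] at this
    norm_num at this ⊢; linarith
  have h0 : p ≠ 0 := by rintro rfl; norm_num at h1
  have h2 : ‖cayley (p - 1)‖ ≤ ‖p - 2‖ := by
    rw [cayley, show p - 1 - 1 = p - 2 by ring, sub_add_cancel, norm_div]
    exact div_le_self (norm_nonneg _) (by linarith)
  exact ⟨⟨by simpa using h0, h2.trans (by linarith)⟩, h2⟩

/-- The zeroth convergent is an iterate of `stepF p` at `0`, which lies outside `cayleyDisc`. One
step brings it inside; the radius `2 / 5` leaves room for this, the coordinate being `-1 / 3` at `p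
= 2`. -/
theorem stepF_zero_mem_cayleyDisc {p : ℂ} (hp : ‖p - 2‖ ≤ 1 / 20) :
    stepF p 0 ∈ cayleyDisc := by
  have h1 : 2.95 ≤ ‖1 + p‖ := by
    have := norm_sub_norm_le 3 (1 + p)
    rw [norm_sub_rev, show 1 + p - 3 = p - 2 by ring] at this
    norm_num at this ⊢; linarith
  have h2 : ‖1 - p‖ ≤ 1.05 := by
    have := norm_add_le (p - 2) 1
    rw [norm_sub_rev, show p - 1 = p - 2 + 1 by ring]
    norm_num at this ⊢; linarith
  have h0 : p ≠ 0 := by rintro rfl; norm_num at hp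
  have h3 : 1 + p ≠ 0 := by intro h; rw [h] at h1; norm_num at h1
  have e1 : stepF p 0 + 1 = (1 + p) / p := by rw [stepF]; field_simp; ring
  have e2 : stepF p 0 - 1 = (1 - p) / p := by rw [stepF]; field_simp; ring
  refine ⟨by rw [e1]; exact div_ne_zero h3 h0, ?_⟩
  rw [cayley, e1, e2, div_div_div_cancel_right₀ h0, norm_div, div_le_iff₀ (by linarith)]
  linarith

theorem one_le_floor_inv_fract {x : ℝ} (h : Int.fract x ≠ 0) : 1 ≤ ⌊(Int.fract x)⁻¹⌋₊ :=
  Nat.le_floor (by simpa using one_le_inv_fract h)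

theorem pConvergent_zero_mem {p : ℂ} (hp : ‖p - 2‖ ≤ 1 / 20) {x : ℝ} (hx : 1 ≤ ⌊x⌋₊) :
    pConvergent p 0 x ∈ cayleyDisc := by
  have h0 : p ≠ 0 := by rintro rfl; norm_num at hp
  have h := pWeight_add_eq_iterate h0 ⌊x⌋₊ 0
  rw [mul_zero, add_zero] at h
  rw [pConvergent, h]
  obtain ⟨a, ha⟩ : ∃ a, ⌊x⌋₊ = a + 1 := ⟨⌊x⌋₊ - 1, by omega⟩
  rw [ha, Function.iterate_succ_apply]
  exact iterate_stepF_mem_cayleyDisc hp (stepF_zero_mem_cayleyDisc hp) a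

theorem pTail_mem {p : ℂ} (hp : ‖p - 2‖ ≤ 1 / 20) (n : ℕ) (x : ℝ) : pTail p n x ∈ cayleyDisc := by
  have h0 : p ≠ 0 := by rintro rfl; norm_num at hp
  induction n generalizing x with
  | zero =>
    rw [pTail]
    split_ifs with h
    · exact (p_sub_one_mem_cayleyDisc hp).1
    · exact inv_mem_cayleyDisc (pConvergent_zero_mem hp (one_le_floor_inv_fract h))
  | succ n ih =>
    rw [pTail]
    split_ifs with h
    · exact (p_sub_one_mem_cayleyDisc hp).1
    · rw [pConvergent_succ h0]
      exact inv_mem_cayleyDisc (iterate_stepF_mem_cayleyDisc hp (ih _) _)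

/-- Every partial quotient after the first is at least `1`, so each level of the fraction contains
at least one contraction. The first one may vanish, which is why the induction concerns tails and
not convergents. -/
theorem pTail_bounds {p : ℂ} (hp : ‖p - 2‖ ≤ 1 / 20) (n : ℕ) (x : ℝ) :
    ‖cayley (pTail p n x)‖ ≤ ‖p - 2‖ + (21 / 25) ^ n ∧
      ‖cayley (pTail p (n + 1) x) - cayley (pTail p n x)‖ ≤ (21 / 25) ^ n := by
  have h0 : p ≠ 0 := by rintro rfl; norm_num at hp
  induction n generalizing x with
  | zero =>
    have h1 := (pTail_mem hp 0 x).2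
    have h2 := (pTail_mem hp 1 x).2
    have h3 := norm_sub_le (cayley (pTail p 1 x)) (cayley (pTail p 0 x))
    have := norm_nonneg (p - 2)
    constructor <;> norm_num <;> linarith
  | succ n ih =>
    by_cases h : Int.fract x = 0
    · have h1 := (p_sub_one_mem_cayleyDisc hp).2
      simp only [pTail, if_pos h, sub_self, norm_zero]
      exact ⟨h1.trans (le_add_of_nonneg_right (by positivity)), by positivity⟩
    · have e : ∀ m, cayley (pTail p (m + 1) x) =
          -cayley ((stepF p)^[⌊(Int.fract x)⁻¹⌋₊] (pTail p m (Int.fract x)⁻¹)) := by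
        intro m
        rw [pTail, if_neg h, pConvergent_succ h0, cayley_inv]
        exact ne_zero_of_mem_cayleyDisc
          (iterate_stepF_mem_cayleyDisc hp (pTail_mem hp m _) _)
      have ha := one_le_floor_inv_fract h
      obtain ⟨ih1, ih2⟩ := ih (Int.fract x)⁻¹
      rw [e, e, norm_neg, neg_sub_neg, pow_succ']
      constructor
      · refine (norm_cayley_iterate_le hp (pTail_mem hp n _) (by positivity) ih1 _).trans ?_
        have := (pow_mul_le_of_le (le_refl ((21 / 25 : ℝ) ^ n)) (by positivity)).2 ha
        linarith
      · refine (norm_cayley_iterate_sub_le hp (pTail_mem hp _ _) (pTail_mem hp _ _) _).trans ?_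
        rw [norm_sub_rev]
        exact (pow_mul_le_of_le ih2 (by positivity)).2 ha

/-- The tails converge, to a point of `cayleyNear p`. -/
theorem exists_tendsto_pTail {p : ℂ} (hp : ‖p - 2‖ ≤ 1 / 20) (x : ℝ) :
    ∃ Y ∈ cayleyNear p, Tendsto (fun n => pTail p n x) atTop (𝓝 Y) := by
  have h1 : CauchySeq fun n => cayley (pTail p n x) := by
    refine cauchySeq_of_le_geometric (21 / 25) 1 (by norm_num) fun n => ?_
    rw [dist_comm, dist_eq_norm, one_mul]
    exact (pTail_bounds hp n x).2
  obtain ⟨v, hv⟩ := cauchySeq_tendsto_of_complete h1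
  have hv2 : ‖v‖ ≤ ‖p - 2‖ := by
    have h3 : Tendsto (fun n : ℕ => ‖p - 2‖ + (21 / 25 : ℝ) ^ n) atTop (𝓝 (‖p - 2‖ + 0)) :=
      (tendsto_pow_atTop_nhds_zero_of_lt_one (by norm_num) (by norm_num)).const_add _
    rw [add_zero] at h3
    exact le_of_tendsto_of_tendsto' hv.norm h3 fun n => (pTail_bounds hp n x).1
  have hv1 : 1 - v ≠ 0 := by
    intro h
    have : v = 1 := by linear_combination -h
    rw [this] at hv2; norm_num at hv2; linarith
  have e1 : (1 + v) / (1 - v) + 1 = 2 / (1 - v) := by field_simp; ring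
  have e2 : (1 + v) / (1 - v) - 1 = 2 * v / (1 - v) := by field_simp; ring
  have hc : cayley ((1 + v) / (1 - v)) = v := by
    rw [cayley, e1, e2, div_div_div_cancel_right₀ hv1]; ring
  refine ⟨(1 + v) / (1 - v), ⟨⟨?_, ?_⟩, ?_⟩, ?_⟩
  · rw [e1]; exact div_ne_zero two_ne_zero hv1
  · rw [hc]; linarith
  · rwa [hc]
  · have h3 : Tendsto (fun n => (1 + cayley (pTail p n x)) / (1 - cayley (pTail p n x))) atTop
        (𝓝 ((1 + v) / (1 - v))) := (hv.const_add 1).div (hv.const_sub 1) hv1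
    exact h3.congr fun n => (eq_of_cayley (pTail_mem hp n x)).symm

theorem tendsto_pConvergent_aux {p : ℂ} (hp : ‖p - 2‖ ≤ 1 / 20) (x : ℝ) :
    ∃ Y ∈ cayleyNear p, Tendsto (fun n => pConvergent p n x) atTop
      (𝓝 ((stepF p)^[⌊x⌋₊] Y)) ∧ Tendsto (fun n => pTail p n x) atTop (𝓝 Y) := by
  have h0 : p ≠ 0 := by rintro rfl; norm_num at hp
  obtain ⟨Y, hY, hlim⟩ := exists_tendsto_pTail hp x
  refine ⟨Y, hY, ?_, hlim⟩
  rw [← tendsto_add_atTop_iff_nat 1]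
  simp only [pConvergent_succ h0]
  have hc : Continuous (stepF p) := by unfold stepF; fun_prop
  exact ((hc.iterate _).tendsto Y).comp hlim

theorem tendsto_pConvergent {p : ℂ} (hp : ‖p - 2‖ ≤ 1 / 20) (x : ℝ) :
    Tendsto (fun n => pConvergent p n x) atTop (𝓝 (pContFract p x)) := by
  obtain ⟨Y, -, h, -⟩ := tendsto_pConvergent_aux hp x
  exact tendsto_nhds_limUnder ⟨_, h⟩

theorem iterate_stepF_mem_cayleyNear {p Y : ℂ} (hp : ‖p - 2‖ ≤ 1 / 20) (hY : Y ∈ cayleyNear p)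
    (a : ℕ) : (stepF p)^[a] Y ∈ cayleyNear p := by
  induction a with
  | zero => exact hY
  | succ a ih => rw [Function.iterate_succ_apply']; exact stepF_mem_cayleyNear hp ih

theorem pContFract_mem {p : ℂ} (hp : ‖p - 2‖ ≤ 1 / 20) (x : ℝ) :
    pContFract p x ∈ cayleyNear p := by
  obtain ⟨Y, hY, h, -⟩ := tendsto_pConvergent_aux hp x
  rw [tendsto_nhds_unique (tendsto_pConvergent hp x) h]
  exact iterate_stepF_mem_cayleyNear hp hY _

/-- The value of a `p`-continued fraction in terms of its tail. -/
theorem pContFract_eq {p : ℂ} (hp : ‖p - 2‖ ≤ 1 / 20) (x : ℝ) :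
    pContFract p x = (stepF p)^[⌊x⌋₊]
      (if Int.fract x = 0 then p - 1 else (pContFract p (Int.fract x)⁻¹)⁻¹) := by
  obtain ⟨Y, hY, h, h'⟩ := tendsto_pConvergent_aux hp x
  rw [tendsto_nhds_unique (tendsto_pConvergent hp x) h]
  congr 1
  refine tendsto_nhds_unique h' ?_
  simp only [pTail]
  split_ifs with hx
  · exact tendsto_const_nhds
  · exact (tendsto_pConvergent hp _).inv₀ (ne_zero_of_mem_cayleyDisc (pContFract_mem hp _).1)

theorem pContFract_add_one {p : ℂ} (hp : ‖p - 2‖ ≤ 1 / 20) {x : ℝ} (hx : 0 ≤ x) :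
    pContFract p (x + 1) = stepF p (pContFract p x) := by
  rw [pContFract_eq hp (x + 1), pContFract_eq hp x, Nat.floor_add_one hx, Int.fract_add_one,
    Function.iterate_succ_apply']

theorem pContFract_zero {p : ℂ} (hp : ‖p - 2‖ ≤ 1 / 20) : pContFract p 0 = p - 1 := by
  rw [pContFract_eq hp 0]; simp

theorem pContFract_one {p : ℂ} (hp : ‖p - 2‖ ≤ 1 / 20) : pContFract p 1 = 1 := by
  have h0 : p ≠ 0 := by rintro rfl; norm_num at hp
  have := pContFract_add_one hp le_rfl
  rw [zero_add] at this
  rw [this, pContFract_zero hp, stepF]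
  field_simp; ring

theorem pContFract_inv {p : ℂ} (hp : ‖p - 2‖ ≤ 1 / 20) {x : ℝ} (hx : 0 < x) :
    pContFract p x⁻¹ = (pContFract p x)⁻¹ := by
  have key : ∀ y : ℝ, 0 < y → y < 1 → pContFract p y = (pContFract p y⁻¹)⁻¹ := by
    intro y hy hy1
    have hf : Int.fract y = y := Int.fract_eq_self.2 ⟨hy.le, hy1⟩
    conv_lhs => rw [pContFract_eq hp y]
    rw [hf, if_neg hy.ne', Nat.floor_eq_zero.2 hy1]
    rfl
  rcases lt_trichotomy x 1 with h | h | h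
  · rw [key x hx h, inv_inv]
  · subst h; rw [inv_one, pContFract_one hp, inv_one]
  · rw [key x⁻¹ (inv_pos.2 hx) (inv_lt_one_of_one_lt₀ h), inv_inv]

theorem pContFract_div_add_one {p : ℂ} (hp : ‖p - 2‖ ≤ 1 / 20) {x : ℝ} (hx : 0 ≤ x) :
    pContFract p (x / (x + 1)) = stepG p (pContFract p x) := by
  have h0 : p ≠ 0 := by rintro rfl; norm_num at hp
  rcases hx.eq_or_lt with rfl | hx
  · rw [zero_div, pContFract_zero hp, stepG, add_sub_cancel, mul_div_cancel_left₀ _ h0]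
  · have e : x / (x + 1) = (x⁻¹ + 1)⁻¹ := by field_simp; ring
    have h1 := ne_zero_of_mem_cayleyDisc (pContFract_mem hp x).1
    rw [e, pContFract_inv hp (by positivity), pContFract_add_one hp (by positivity),
      pContFract_inv hp hx, stepG_eq_inv h1]

theorem measurable_pConvergent (p : ℂ) (n : ℕ) : Measurable (pConvergent p n) := by
  induction n with
  | zero =>
    have h : Measurable (pWeight p) := measurable_from_nat
    exact h.comp Nat.measurable_floor
  | succ n ih =>
    have h : Measurable (pWeight p) := measurable_from_nat
    have h' : Measurable (fun a : ℕ => (p ^ a)⁻¹) := measurable_from_nat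
    have hs : MeasurableSet {x : ℝ | Int.fract x = 0} :=
      measurableSet_eq_fun measurable_fract measurable_const
    exact (h.comp Nat.measurable_floor).add ((h'.comp Nat.measurable_floor).mul
      (Measurable.ite hs measurable_const (ih.comp measurable_fract.inv).inv))

theorem measurable_pContFract {p : ℂ} (hp : ‖p - 2‖ ≤ 1 / 20) : Measurable (pContFract p) :=
  measurable_of_tendsto_metrizable (measurable_pConvergent p)
    (tendsto_pi_nhds.2 fun x => tendsto_pConvergent hp x)

/-! ### Self-similarity of the question mark measure -/

theorem questionMark_eq {x : ℝ} (hx : 0 ≤ x) :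
    questionMark x = 1 - (2 : ℝ) ^ (-⌊x⌋) *
      (if Int.fract x = 0 then 1 else questionMark (Int.fract x)⁻¹) := by
  have h1 := (tendsto_add_atTop_iff_nat 1).2 (tendsto_questionMark_partial hx)
  simp only [questionMark_partial_succ] at h1
  refine tendsto_nhds_unique h1 (Tendsto.const_sub 1 (Tendsto.const_mul _ ?_))
  split_ifs with h
  · exact tendsto_const_nhds
  · exact tendsto_questionMark_partial (inv_nonneg.2 (Int.fract_nonneg x))

theorem questionMark_add_one {x : ℝ} (hx : 0 ≤ x) :
    questionMark (x + 1) = 1 / 2 + 1 / 2 * questionMark x := by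
  rw [questionMark_eq (by linarith : 0 ≤ x + 1), questionMark_eq hx, Int.fract_add_one,
    Int.floor_add_one, neg_add, zpow_add₀ (by norm_num : (2 : ℝ) ≠ 0),
    show (2 : ℝ) ^ (-1 : ℤ) = 1 / 2 by norm_num]
  ring

theorem questionMark_zero : questionMark 0 = 0 := by
  rw [questionMark_eq le_rfl]; simp

theorem questionMark_inv {x : ℝ} (hx : 0 < x) : questionMark x⁻¹ = 1 - questionMark x := by
  have key : ∀ y : ℝ, 0 < y → y < 1 → questionMark y = 1 - questionMark y⁻¹ := by
    intro y hy hy1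
    have hf : Int.fract y = y := Int.fract_eq_self.2 ⟨hy.le, hy1⟩
    conv_lhs => rw [questionMark_eq hy.le]
    rw [hf, if_neg hy.ne', Int.floor_eq_zero_iff.2 ⟨hy.le, hy1⟩]
    simp
  rcases lt_trichotomy x 1 with h | h | h
  · rw [key x hx h]; ring
  · subst h
    have := questionMark_add_one le_rfl
    rw [zero_add, questionMark_zero] at this
    rw [inv_one, this]; norm_num
  · rw [key x⁻¹ (inv_pos.2 hx) (inv_lt_one_of_one_lt₀ h), inv_inv]

theorem questionMark_div_add_one {x : ℝ} (hx : 0 ≤ x) :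
    questionMark (x / (x + 1)) = 1 / 2 * questionMark x := by
  rcases hx.eq_or_lt with rfl | hx
  · rw [zero_div, questionMark_zero, mul_zero]
  · have e : x / (x + 1) = (x⁻¹ + 1)⁻¹ := by field_simp; ring
    rw [e, questionMark_inv (by positivity), questionMark_add_one (by positivity),
      questionMark_inv hx]
    ring

theorem rightLim_questionMark_of_neg {x : ℝ} (hx : x < 0) :
    Function.rightLim questionMark x = 0 := by
  refine tendsto_nhds_unique (questionMark_monotone.tendsto_rightLim x)
    (tendsto_const_nhds.congr' ?_)
  filter_upwards [Ioo_mem_nhdsGT hx] with y hy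
  rw [questionMark, if_pos hy.2]

theorem tendsto_nhdsGT_of_strictMonoOn {T : ℝ → ℝ} {x : ℝ} (hc : ContinuousAt T x)
    (hm : ∀ y, x < y → T x < T y) : Tendsto T (𝓝[>] x) (𝓝[>] (T x)) :=
  tendsto_nhdsWithin_iff.2 ⟨hc.mono_left nhdsWithin_le_nhds,
    eventually_nhdsWithin_of_forall hm⟩

/-- The Stieltjes measure is defined by right limits. Carrying the functional equations over to them
makes continuity of the question mark function unnecessary. -/
theorem rightLim_questionMark_add_one {x : ℝ} (hx : 0 ≤ x) :
    Function.rightLim questionMark (x + 1) =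
      1 / 2 + 1 / 2 * Function.rightLim questionMark x := by
  have h1 : Tendsto (fun y : ℝ => y + 1) (𝓝[>] x) (𝓝[>] (x + 1)) :=
    tendsto_nhdsGT_of_strictMonoOn (T := fun y => y + 1) (by fun_prop) (by simp)
  refine tendsto_nhds_unique ((questionMark_monotone.tendsto_rightLim (x + 1)).comp h1) ?_
  refine (((questionMark_monotone.tendsto_rightLim x).const_mul (1 / 2)).const_add
    (1 / 2)).congr' ?_
  filter_upwards [self_mem_nhdsWithin] with y hy
  exact (questionMark_add_one (hx.trans (le_of_lt hy))).symm

theorem rightLim_questionMark_div_add_one {x : ℝ} (hx : 0 ≤ x) :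
    Function.rightLim questionMark (x / (x + 1)) =
      1 / 2 * Function.rightLim questionMark x := by
  have h1 : Tendsto (fun y : ℝ => y / (y + 1)) (𝓝[>] x) (𝓝[>] (x / (x + 1))) := by
    refine tendsto_nhdsGT_of_strictMonoOn (T := fun y => y / (y + 1))
      (ContinuousAt.div (by fun_prop) (by fun_prop) (by linarith)) fun y hy => ?_
    rw [div_lt_div_iff₀ (by linarith) (by linarith)]
    linarith
  refine tendsto_nhds_unique ((questionMark_monotone.tendsto_rightLim _).comp h1) ?_
  refine ((questionMark_monotone.tendsto_rightLim x).const_mul (1 / 2)).congr' ?_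
  filter_upwards [self_mem_nhdsWithin] with y hy
  exact (questionMark_div_add_one (hx.trans (le_of_lt hy))).symm

theorem questionMark_nonneg (x : ℝ) : 0 ≤ questionMark x := by
  rcases lt_or_ge x 0 with h | h
  · rw [questionMark, if_pos h]
  · rw [← questionMark_zero]; exact questionMark_monotone h

theorem questionMark_le_one (x : ℝ) : questionMark x ≤ 1 := by
  rcases lt_or_ge x 0 with h | h
  · rw [questionMark, if_pos h]; norm_num
  · exact le_of_tendsto' (tendsto_questionMark_partial h)
      fun N => (questionMark_partial_bounds N x h).2

theorem tendsto_questionMark_atTop :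
    Tendsto questionMark.rightLim atTop (𝓝 1) := by
  have h0 : Tendsto (fun n : ℕ => questionMark n) atTop (𝓝 1) := by
    have h1 : ∀ n : ℕ, questionMark n = 1 - (1 / 2) ^ n := by
      intro n
      induction n with
      | zero => simpa using questionMark_zero
      | succ n ih =>
        rw [Nat.cast_succ, questionMark_add_one n.cast_nonneg, ih, pow_succ]; ring
    simp only [h1]
    have := (tendsto_pow_atTop_nhds_zero_of_lt_one (r := (1 / 2 : ℝ)) (by norm_num)
      (by norm_num)).const_sub 1
    simpa using this
  have hmono := questionMark_monotone.rightLim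
  have hbdd : ∀ x, questionMark.rightLim x ≤ 1 := fun x =>
    (questionMark_monotone.rightLim_le (lt_add_one x)).trans (questionMark_le_one _)
  have h2 := tendsto_atTop_ciSup hmono ⟨1, by rintro _ ⟨x, rfl⟩; exact hbdd x⟩
  have h3 := h2.comp (tendsto_natCast_atTop_atTop (R := ℝ))
  have h4 : Tendsto (fun n : ℕ => questionMark.rightLim n) atTop (𝓝 1) :=
    tendsto_of_tendsto_of_tendsto_of_le_of_le h0 tendsto_const_nhds
      (fun n => questionMark_monotone.le_rightLim le_rfl) (fun n => hbdd n)
  rwa [tendsto_nhds_unique h3 h4] at h2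

theorem tendsto_questionMark_atBot :
    Tendsto questionMark.rightLim atBot (𝓝 0) :=
  tendsto_const_nhds.congr' (by
    filter_upwards [Iio_mem_atBot (0 : ℝ)] with x hx
    exact (rightLim_questionMark_of_neg hx).symm)

theorem questionMarkMeasure_Iic (x : ℝ) :
    questionMarkMeasure (Set.Iic x) = ENNReal.ofReal (questionMark.rightLim x) := by
  rw [questionMarkMeasure, StieltjesFunction.measure_Iic _ (l := 0) tendsto_questionMark_atBot,
    sub_zero, Monotone.stieltjesFunction_eq]

instance isProbabilityMeasure_questionMarkMeasure : IsProbabilityMeasure questionMarkMeasure :=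
  ⟨by
    rw [questionMarkMeasure, StieltjesFunction.measure_univ _ (l := 0) (u := 1)
      tendsto_questionMark_atBot tendsto_questionMark_atTop]
    simp⟩

theorem questionMarkMeasure_Iio_zero : questionMarkMeasure (Set.Iio 0) = 0 := by
  have h : Set.Iio (0 : ℝ) = ⋃ n : ℕ, Set.Iic (-(1 / ((n : ℝ) + 1))) := by
    ext x
    simp only [Set.mem_Iio, Set.mem_iUnion, Set.mem_Iic]
    constructor
    · intro hx
      obtain ⟨n, hn⟩ := exists_nat_one_div_lt (neg_pos.2 hx)
      exact ⟨n, by linarith⟩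
    · rintro ⟨n, hn⟩
      have : (0 : ℝ) < 1 / ((n : ℝ) + 1) := by positivity
      linarith
  rw [h, measure_iUnion_null_iff]
  intro n
  have : (0 : ℝ) < 1 / ((n : ℝ) + 1) := by positivity
  rw [questionMarkMeasure_Iic, rightLim_questionMark_of_neg (by linarith), ENNReal.ofReal_zero]

theorem ae_nonneg_questionMarkMeasure : ∀ᵐ x ∂questionMarkMeasure, 0 ≤ x := by
  rw [ae_iff]
  simp only [not_le]
  exact questionMarkMeasure_Iio_zero

theorem questionMarkMeasure_restrict :
    questionMarkMeasure.restrict (Set.Ici 0) = questionMarkMeasure :=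
  Measure.restrict_eq_self_of_ae_mem ae_nonneg_questionMarkMeasure

theorem measurable_div_add_one : Measurable (fun x : ℝ => x / (x + 1)) :=
  measurable_id.div (measurable_id.add_const 1)

/-- The measure `dF` is self-similar under `x ↦ x + 1` and `x ↦ x / (x + 1)`. -/
theorem questionMarkMeasure_self_similar :
    questionMarkMeasure = (1 / 2 : ENNReal) • (questionMarkMeasure.map (fun x => x + 1)) +
      (1 / 2 : ENNReal) • (questionMarkMeasure.map (fun x => x / (x + 1))) := by
  refine Measure.ext_of_Iic _ _ fun x => ?_
  have hm1 : Measurable (fun x : ℝ => x + 1) := measurable_id.add_const 1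
  rw [Measure.add_apply, Measure.smul_apply, Measure.smul_apply,
    Measure.map_apply hm1 measurableSet_Iic,
    Measure.map_apply measurable_div_add_one measurableSet_Iic]
  have e1 : (fun x : ℝ => x + 1) ⁻¹' Set.Iic x = Set.Iic (x - 1) := by
    ext y; simp [le_sub_iff_add_le]
  have hhalf : ∀ a : ℝ, (1 / 2 : ENNReal) • ENNReal.ofReal a = ENNReal.ofReal (1 / 2 * a) := by
    intro a
    rw [ENNReal.ofReal_mul (by norm_num), smul_eq_mul]
    congr 1
    rw [one_div, one_div, ENNReal.ofReal_inv_of_pos two_pos, ENNReal.ofReal_ofNat]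
  rw [e1, questionMarkMeasure_Iic, questionMarkMeasure_Iic, hhalf]
  have hnn : ∀ y, 0 ≤ questionMark.rightLim y := fun y =>
    (questionMark_nonneg y).trans (questionMark_monotone.le_rightLim le_rfl)
  -- The image of the half line is `[1, ∞)` under the first map and lies in `[0, 1)` under the
  -- second. So below `0` neither contributes, on `[0, 1)` only the second does, and from `1` on the
  -- second contributes its full mass.
  rcases lt_or_ge x 0 with hx | hx
  · have h2 : questionMarkMeasure ((fun x : ℝ => x / (x + 1)) ⁻¹' Set.Iic x) = 0 := by
      refine measure_mono_null (fun y hy => ?_) questionMarkMeasure_Iio_zero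
      by_contra h
      have h0 : 0 ≤ y := not_lt.1 h
      have h1 : 0 ≤ y / (y + 1) := by positivity
      have h2 : y / (y + 1) ≤ x := hy
      linarith
    rw [h2, rightLim_questionMark_of_neg hx, rightLim_questionMark_of_neg (by linarith)]
    simp
  rcases lt_or_ge x 1 with hx1 | hx1
  · have hx' : 0 < 1 - x := by linarith
    have h2 : questionMarkMeasure ((fun x : ℝ => x / (x + 1)) ⁻¹' Set.Iic x) =
        questionMarkMeasure (Set.Iic (x / (1 - x))) := by
      refine measure_congr ?_
      filter_upwards [ae_nonneg_questionMarkMeasure] with y hy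
      refine propext ?_
      change y / (y + 1) ≤ x ↔ y ≤ x / (1 - x)
      rw [div_le_iff₀ (by linarith), le_div_iff₀ hx']
      constructor <;> intro h <;> linarith
    have e2 := rightLim_questionMark_div_add_one (x := x / (1 - x)) (by positivity)
    rw [show x / (1 - x) / (x / (1 - x) + 1) = x by field_simp; ring] at e2
    have e3 := rightLim_questionMark_of_neg (x := x - 1) (by linarith)
    rw [h2, questionMarkMeasure_Iic, hhalf, e2, e3]
    simp
  · have h2 : questionMarkMeasure ((fun x : ℝ => x / (x + 1)) ⁻¹' Set.Iic x) =
        questionMarkMeasure Set.univ := by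
      refine measure_congr ?_
      filter_upwards [ae_nonneg_questionMarkMeasure] with y hy
      refine propext ?_
      change y / (y + 1) ≤ x ↔ True
      rw [div_le_iff₀ (by linarith), iff_true]
      nlinarith
    have e2 := rightLim_questionMark_add_one (x := x - 1) (by linarith)
    rw [sub_add_cancel] at e2
    have e3 := hhalf 1
    rw [ENNReal.ofReal_one] at e3
    rw [h2, measure_univ, e2, e3,
      ← ENNReal.ofReal_add (mul_nonneg (by norm_num) (hnn _)) (by norm_num)]
    congr 1; ring

theorem integrable_of_bounded_on_nonneg {φ : ℝ → ℂ} (hφ : Measurable φ) {C : ℝ}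
    (hC : ∀ x, 0 ≤ x → ‖φ x‖ ≤ C) : Integrable φ questionMarkMeasure :=
  Integrable.of_bound hφ.aestronglyMeasurable C
    (ae_nonneg_questionMarkMeasure.mono fun x hx => hC x hx)

theorem integral_questionMark_self_similar {φ : ℝ → ℂ} (hφ : Measurable φ) {C : ℝ}
    (hC : ∀ x, 0 ≤ x → ‖φ x‖ ≤ C) :
    ∫ x, φ x ∂questionMarkMeasure =
      (1 / 2 : ℝ) • (∫ x, φ (x + 1) ∂questionMarkMeasure +
        ∫ x, φ (x / (x + 1)) ∂questionMarkMeasure) := by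
  have hm1 : Measurable (fun x : ℝ => x + 1) := measurable_id.add_const 1
  have hm2 := measurable_div_add_one
  have hi1 : Integrable φ (questionMarkMeasure.map (fun x => x + 1)) := by
    rw [integrable_map_measure hφ.aestronglyMeasurable hm1.aemeasurable]
    exact integrable_of_bounded_on_nonneg (hφ.comp hm1) fun x hx => hC _ (by positivity)
  have hi2 : Integrable φ (questionMarkMeasure.map (fun x => x / (x + 1))) := by
    rw [integrable_map_measure hφ.aestronglyMeasurable hm2.aemeasurable]
    exact integrable_of_bounded_on_nonneg (hφ.comp hm2) fun x hx => hC _ (by positivity)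
  conv_lhs => rw [questionMarkMeasure_self_similar]
  rw [integral_add_measure (hi1.smul_measure (by norm_num)) (hi2.smul_measure (by norm_num)),
    integral_smul_measure, integral_smul_measure,
    integral_map hm1.aemeasurable hφ.aestronglyMeasurable,
    integral_map hm2.aemeasurable hφ.aestronglyMeasurable, smul_add]
  norm_num

/-! ### Integrals of self-similar functions as limits of word averages -/

theorem measurable_wordMap (p : ℂ) (l : List Bool) : Measurable (wordMap p l) := by
  induction l with
  | nil => exact measurable_id
  | cons b l ih =>
    cases b
    · exact (ih.const_mul p).div (ih.const_add 1)
    · exact (ih.const_add 1).div_const p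

theorem wordMap_snoc (p : ℂ) (l : List Bool) (X : ℂ) :
    wordMap p (l ++ [true]) X = wordMap p l (stepF p X) ∧
      wordMap p (l ++ [false]) X = wordMap p l (stepG p X) := by
  induction l with
  | nil => exact ⟨rfl, rfl⟩
  | cons b l ih => cases b <;> simp [wordMap, ih.1, ih.2]

/-- A function `Y` on the half line which intertwines `x ↦ x + 1`, `x ↦ x / (x + 1)` with
`stepF p`, `stepG p`, and takes values in an invariant set `V`. -/
structure IsSelfSimilar (p : ℂ) (V : Set ℂ) (Y : ℝ → ℂ) : Prop where
  measurable : Measurable Y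
  mem : ∀ x, 0 ≤ x → Y x ∈ V
  add_one : ∀ x, 0 ≤ x → Y (x + 1) = stepF p (Y x)
  div_add_one : ∀ x, 0 ≤ x → Y (x / (x + 1)) = stepG p (Y x)
  stepF_mem : ∀ X ∈ V, stepF p X ∈ V
  stepG_mem : ∀ X ∈ V, stepG p X ∈ V

theorem IsSelfSimilar.wordMap_mem {p : ℂ} {V : Set ℂ} {Y : ℝ → ℂ} (h : IsSelfSimilar p V Y)
    (l : List Bool) {X : ℂ} (hX : X ∈ V) : wordMap p l X ∈ V := by
  induction l with
  | nil => exact hX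
  | cons b l ih =>
    cases b
    · exact h.stepG_mem _ ih
    · exact h.stepF_mem _ ih

theorem IsSelfSimilar.integrable {p : ℂ} {V : Set ℂ} {Y : ℝ → ℂ} (h : IsSelfSimilar p V Y)
    {R : ℂ → ℂ} (hR : Measurable R) {C : ℝ} (hC : ∀ X ∈ V, ‖R X‖ ≤ C) :
    Integrable (fun x => R (Y x)) questionMarkMeasure :=
  integrable_of_bounded_on_nonneg (hR.comp h.measurable) fun x hx => hC _ (h.mem x hx)

theorem IsSelfSimilar.integral_step {p : ℂ} {V : Set ℂ} {Y : ℝ → ℂ} (h : IsSelfSimilar p V Y)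
    {R : ℂ → ℂ} (hR : Measurable R) {C : ℝ} (hC : ∀ X ∈ V, ‖R X‖ ≤ C) :
    ∫ x, R (Y x) ∂questionMarkMeasure =
      (1 / 2 : ℝ) • (∫ x, R (stepF p (Y x)) ∂questionMarkMeasure +
        ∫ x, R (stepG p (Y x)) ∂questionMarkMeasure) := by
  rw [integral_questionMark_self_similar (φ := fun x => R (Y x)) (hR.comp h.measurable)
    (fun x hx => hC _ (h.mem x hx))]
  congr 2 <;> refine integral_congr_ae ?_ <;>
    refine ae_nonneg_questionMarkMeasure.mono fun x hx => ?_
  · simp only [h.add_one x hx]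
  · simp only [h.div_add_one x hx]

/-- Self-similarity is inserted repeatedly at the innermost position, which leaves the outer word
unchanged. -/
theorem IsSelfSimilar.integral_eq_wordAvg {p : ℂ} {V : Set ℂ} {Y : ℝ → ℂ}
    (h : IsSelfSimilar p V Y) {R : ℂ → ℂ} (hR : Measurable R) {C : ℝ}
    (hC : ∀ X ∈ V, ‖R X‖ ≤ C) (N : ℕ) :
    ∫ x, R (Y x) ∂questionMarkMeasure =
      wordAvg N (fun l => ∫ x, R (wordMap p l (Y x)) ∂questionMarkMeasure) := by
  induction N with
  | zero => rfl
  | succ N ih =>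
    rw [ih, wordAvg_succ_snoc, ← wordAvg_add,
      ← LinearMap.lsmul_apply (R := ℝ) (M := ℂ) (1 / 2 : ℝ), ← wordAvg_map]
    refine wordAvg_congr fun l _ => ?_
    simp only [(wordMap_snoc p l _).1, (wordMap_snoc p l _).2]
    exact h.integral_step (R := fun X => R (wordMap p l X)) (hR.comp (measurable_wordMap p l))
      fun X hX => hC _ (h.wordMap_mem l hX)

theorem wordAvg_sub {E : Type*} [AddCommGroup E] [Module ℝ E] (N : ℕ) (F G : List Bool → E) :
    wordAvg N (fun l => F l - G l) = wordAvg N F - wordAvg N G := by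
  rw [eq_sub_iff_add_eq, ← wordAvg_add]
  simp

/-- Integrals against `dF` are approximated by word averages. -/
theorem IsSelfSimilar.norm_integral_sub_wordAvg_le {p : ℂ} {V : Set ℂ} {Y : ℝ → ℂ}
    (h : IsSelfSimilar p V Y) {R : ℂ → ℂ} (hR : Measurable R) {C ε : ℝ}
    (hC : ∀ X ∈ V, ‖R X‖ ≤ C) {N : ℕ}
    (hε : ∀ l : List Bool, l.length = N → ∀ X ∈ V,
      ‖R (wordMap p l X) - R (wordMap p l 1)‖ ≤ ε) :
    ‖∫ x, R (Y x) ∂questionMarkMeasure - wordAvg N (fun l => R (wordMap p l 1))‖ ≤ ε := by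
  rw [h.integral_eq_wordAvg hR hC N, ← wordAvg_sub]
  refine norm_wordAvg_le_of_le fun l hl => ?_
  have hi := h.integrable (R := fun X => R (wordMap p l X)) (hR.comp (measurable_wordMap p l))
    fun X hX => hC _ (h.wordMap_mem l hX)
  have e : ∫ x, R (wordMap p l (Y x)) ∂questionMarkMeasure - R (wordMap p l 1) =
      ∫ x, (R (wordMap p l (Y x)) - R (wordMap p l 1)) ∂questionMarkMeasure := by
    rw [integral_sub hi (integrable_const _)]; simp
  rw [e]
  have := norm_integral_le_of_norm_le_const (μ := questionMarkMeasure)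
    (f := fun x => R (wordMap p l (Y x)) - R (wordMap p l 1)) (C := ε)
    (ae_nonneg_questionMarkMeasure.mono fun x hx => hε l hl _ (h.mem x hx))
  simpa using this

theorem isSelfSimilar_pContFract {p : ℂ} (hp : ‖p - 2‖ ≤ 1 / 20) :
    IsSelfSimilar p (cayleyNear p) (pContFract p) where
  measurable := measurable_pContFract hp
  mem x _ := pContFract_mem hp x
  add_one _ hx := pContFract_add_one hp hx
  div_add_one _ hx := pContFract_div_add_one hp hx
  stepF_mem _ hX := stepF_mem_cayleyNear hp hX
  stepG_mem _ hX := stepG_mem_cayleyNear hp hX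

/-- The nonnegative reals as a subset of `ℂ`. -/
def nonnegReals : Set ℂ := {X | ∃ r : ℝ, 0 ≤ r ∧ X = r}

theorem isSelfSimilar_ofReal : IsSelfSimilar 1 nonnegReals (fun x : ℝ => (x : ℂ)) where
  measurable := Complex.measurable_ofReal
  mem x hx := ⟨x, hx, rfl⟩
  add_one x _ := by simp [stepF, add_comm]
  div_add_one x _ := by simp [stepG, add_comm]
  stepF_mem := by
    rintro _ ⟨r, hr, rfl⟩
    exact ⟨r + 1, by positivity, by simp [stepF, add_comm]⟩
  stepG_mem := by
    rintro _ ⟨r, hr, rfl⟩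
    exact ⟨r / (r + 1), by positivity, by simp [stepG, add_comm]⟩

/-- At `p = 1` there is no geometric contraction. The weights `1 + r'` and `1 + s'` turn the
parabolic behaviour into a gain of one unit per letter, and they are cancelled by the decay of `1 /
(X + 1 - z)` in `norm_dyadicPeriod_sub_wordPeriod_le`. -/
theorem wordMap_one_contracts (l : List Bool) {r s : ℝ} (hr : 0 ≤ r) (hs : 0 ≤ s) :
    ∃ r' s' : ℝ, 0 ≤ r' ∧ 0 ≤ s' ∧ wordMap 1 l r = r' ∧ wordMap 1 l s = s' ∧
      |r' - s'| * (l.length + 1) ≤ (1 + r') * (1 + s') := by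
  induction l with
  | nil =>
    refine ⟨r, s, hr, hs, rfl, rfl, ?_⟩
    simp only [List.length_nil, Nat.cast_zero, zero_add, mul_one]
    rw [abs_le]
    constructor <;> nlinarith [mul_nonneg hr hs]
  | cons b l ih =>
    obtain ⟨u, v, hu, hv, eu, ev, h⟩ := ih
    have hle : |u - v| ≤ u + v := by rw [abs_le]; constructor <;> linarith
    cases b
    · refine ⟨u / (1 + u), v / (1 + v), by positivity, by positivity, ?_, ?_, ?_⟩
      · simp [wordMap, eu, stepG]
      · simp [wordMap, ev, stepG]
      · have h1 : u / (1 + u) - v / (1 + v) = (u - v) / ((1 + u) * (1 + v)) := by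
          field_simp; ring
        have h2 : (1 + u / (1 + u)) * (1 + v / (1 + v)) =
            ((1 + 2 * u) * (1 + 2 * v)) / ((1 + u) * (1 + v)) := by
          field_simp; ring
        rw [h1, h2, abs_div, abs_of_pos (by positivity : (0 : ℝ) < (1 + u) * (1 + v)),
          div_mul_eq_mul_div]
        refine div_le_div_of_nonneg_right ?_ (by positivity)
        push_cast [List.length_cons]
        nlinarith [mul_nonneg hu hv]
    · refine ⟨1 + u, 1 + v, by positivity, by positivity, ?_, ?_, ?_⟩
      · simp [wordMap, eu, stepF]
      · simp [wordMap, ev, stepF]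
      · push_cast [List.length_cons]
        rw [add_sub_add_left_eq_sub]
        nlinarith [mul_nonneg hu hv]

theorem norm_lower_of_mem_nonnegReals {z : ℂ} (hz : z ∈ periodRegion) {r : ℝ} (hr : 0 ≤ r) :
    (1 + r) / 4 ≤ ‖(r : ℂ) + 1 - z‖ := by
  rcases hz with hz | hz
  · have h1 := norm_sub_norm_le ((r : ℂ) + 1) z
    have h2 : ‖(r : ℂ) + 1‖ = r + 1 := by
      rw [← Complex.ofReal_one, ← Complex.ofReal_add, Complex.norm_real, Real.norm_eq_abs,
        abs_of_nonneg (by positivity)]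
    linarith
  · have h1 := norm_sub_norm_le ((r : ℂ) + 1 + 9 / 7) (z + 9 / 7)
    have h2 : ‖(r : ℂ) + 1 + 9 / 7‖ = r + 1 + 9 / 7 := by
      rw [show (r : ℂ) + 1 + 9 / 7 = ((r + 1 + 9 / 7 : ℝ) : ℂ) by push_cast; rfl,
        Complex.norm_real, Real.norm_eq_abs, abs_of_nonneg (by positivity)]
    rw [add_sub_add_right_eq_sub] at h1
    linarith

theorem measurable_one_div_add_one_sub (z : ℂ) : Measurable (fun X : ℂ => 1 / (X + 1 - z)) :=
  ((measurable_id.add_const 1).sub_const z).const_div 1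

theorem norm_one_div_le_of_mem_nonnegReals {z : ℂ} (hz : z ∈ periodRegion) {X : ℂ}
    (hX : X ∈ nonnegReals) : ‖1 / (X + 1 - z)‖ ≤ 4 := by
  obtain ⟨r, hr, rfl⟩ := hX
  have := norm_lower_of_mem_nonnegReals hz hr
  rw [norm_div, norm_one, div_le_iff₀ (by linarith)]
  linarith

theorem integrableOn_dyadicPeriod {z : ℂ} (hz : z ∈ periodRegion) :
    IntegrableOn (fun x : ℝ => 1 / ((x : ℂ) + 1 - z)) (Set.Ici 0) questionMarkMeasure := by
  rw [IntegrableOn, questionMarkMeasure_restrict]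
  exact isSelfSimilar_ofReal.integrable (measurable_one_div_add_one_sub z)
    fun X hX => norm_one_div_le_of_mem_nonnegReals hz hX

theorem norm_dyadicPeriod_sub_wordPeriod_le {z : ℂ} (hz : z ∈ periodRegion) (N : ℕ) :
    ‖dyadicPeriod z - wordPeriod N 1 z‖ ≤ 16 / (N + 1) := by
  rw [dyadicPeriod, questionMarkMeasure_restrict, wordPeriod]
  refine isSelfSimilar_ofReal.norm_integral_sub_wordAvg_le (measurable_one_div_add_one_sub z)
    (fun X hX => norm_one_div_le_of_mem_nonnegReals hz hX) ?_
  rintro l rfl _ ⟨r, hr, rfl⟩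
  obtain ⟨u, v, hu, hv, eu, ev, h⟩ := wordMap_one_contracts l hr zero_le_one
  rw [Complex.ofReal_one] at ev
  rw [eu, ev]
  have h1 := norm_lower_of_mem_nonnegReals hz hu
  have h2 := norm_lower_of_mem_nonnegReals hz hv
  have n1 : (u : ℂ) + 1 - z ≠ 0 := norm_pos_iff.1 (by linarith)
  have n2 : (v : ℂ) + 1 - z ≠ 0 := norm_pos_iff.1 (by linarith)
  rw [div_sub_div _ _ n1 n2, norm_div, norm_mul,
    show 1 * ((v : ℂ) + 1 - z) - (u + 1 - z) * 1 = ((v - u : ℝ) : ℂ) by push_cast; ring,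
    Complex.norm_real, Real.norm_eq_abs, abs_sub_comm,
    div_le_div_iff₀ (mul_pos (by linarith) (by linarith)) (by positivity)]
  have h3 := mul_le_mul h1 h2 (by positivity) (norm_nonneg _)
  nlinarith

theorem tendsto_wordPeriod_one {z : ℂ} (hz : z ∈ periodRegion) :
    Tendsto (fun N => wordPeriod N 1 z) atTop (𝓝 (dyadicPeriod z)) := by
  rw [tendsto_iff_norm_sub_tendsto_zero]
  have h := (tendsto_one_div_add_atTop_nhds_zero_nat (𝕜 := ℝ)).const_mul 16
  rw [mul_zero] at h
  refine squeeze_zero (fun _ => norm_nonneg _) (fun N => ?_) h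
  rw [norm_sub_rev, mul_one_div]
  exact norm_dyadicPeriod_sub_wordPeriod_le hz N

/-! ### Moments of the Cayley coordinate -/

theorem measurable_cayley : Measurable cayley :=
  (measurable_id.sub_const 1).div (measurable_id.add_const 1)

theorem norm_integral_cayley_sub_le {p : ℂ} (hp : ‖p - 2‖ ≤ 1 / 20) {φ : ℂ → ℂ}
    (hφ : Measurable φ) {L : ℝ} (hL0 : 0 ≤ L) (hL : ∀ v w, ‖v‖ ≤ ‖p - 2‖ → ‖w‖ ≤ ‖p - 2‖ →
      ‖φ v - φ w‖ ≤ L * ‖v - w‖) (N : ℕ) :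
    ‖∫ x, φ (cayley (pContFract p x)) ∂questionMarkMeasure -
      wordAvg N (fun l => φ (cayley (wordMap p l 1)))‖ ≤ L * (21 / 25) ^ N := by
  refine (isSelfSimilar_pContFract hp).norm_integral_sub_wordAvg_le
    (R := fun X => φ (cayley X)) (C := ‖φ 0‖ + L) (hφ.comp measurable_cayley) ?_ ?_
  · intro X hX
    have h1 := hL (cayley X) 0 hX.2 (by rw [norm_zero]; positivity)
    have h2 := norm_le_norm_add_norm_sub (φ 0) (φ (cayley X))
    rw [norm_sub_rev] at h2
    have h3 := hX.1.2
    rw [sub_zero] at h1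
    nlinarith
  · rintro l rfl X hX
    refine (hL _ _ (wordMap_mem_cayleyNear hp hX l).2
      (wordMap_mem_cayleyNear hp (one_mem_cayleyNear p) l).2).trans ?_
    refine mul_le_mul_of_nonneg_left ?_ hL0
    refine (norm_cayley_wordMap_sub_le hp hX (one_mem_cayleyNear p) l).trans ?_
    rw [cayley_one, sub_zero]
    refine mul_le_of_le_one_right (by positivity) ?_
    have := hX.1.2
    linarith

theorem tendsto_zero_geometric (L : ℝ) :
    Tendsto (fun N : ℕ => L * (21 / 25 : ℝ) ^ N) atTop (𝓝 0) := by
  simpa using (tendsto_pow_atTop_nhds_zero_of_lt_one (r := (21 / 25 : ℝ)) (by norm_num)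
    (by norm_num)).const_mul L

theorem tendsto_of_norm_sub_le_geometric {u : ℕ → ℂ} {a : ℂ} {L : ℝ}
    (h : ∀ N, ‖a - u N‖ ≤ L * (21 / 25) ^ N) : Tendsto u atTop (𝓝 a) := by
  rw [tendsto_iff_norm_sub_tendsto_zero]
  exact squeeze_zero (fun _ => norm_nonneg _) (fun N => by rw [norm_sub_rev]; exact h N)
    (tendsto_zero_geometric L)

/-- The symmetry `X ↦ X⁻¹` of the distribution of `pContFract p`. -/
theorem integral_cayley_neg {p : ℂ} (hp : ‖p - 2‖ ≤ 1 / 20) {φ : ℂ → ℂ}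
    (hφ : Measurable φ) {L : ℝ} (hL0 : 0 ≤ L) (hL : ∀ v w, ‖v‖ ≤ ‖p - 2‖ → ‖w‖ ≤ ‖p - 2‖ →
      ‖φ v - φ w‖ ≤ L * ‖v - w‖) :
    ∫ x, φ (-cayley (pContFract p x)) ∂questionMarkMeasure =
      ∫ x, φ (cayley (pContFract p x)) ∂questionMarkMeasure := by
  have h1 := tendsto_of_norm_sub_le_geometric (norm_integral_cayley_sub_le hp hφ hL0 hL)
  have h2 := tendsto_of_norm_sub_le_geometric (norm_integral_cayley_sub_le hp
    (φ := fun v => φ (-v)) (hφ.comp measurable_neg) hL0 (fun v w hv hw => by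
      have := hL (-v) (-w) (by rwa [norm_neg]) (by rwa [norm_neg])
      rwa [neg_sub_neg, norm_sub_rev w v] at this))
  refine tendsto_nhds_unique h2 (h1.congr fun N => ?_)
  rw [← wordAvg_map_not]
  refine wordAvg_congr fun l _ => ?_
  have h3 := wordMap_map_not hp (one_mem_cayleyNear p) l
  rw [inv_one] at h3
  rw [h3, cayley_inv (ne_zero_of_mem_cayleyDisc
    (wordMap_mem_cayleyNear hp (one_mem_cayleyNear p) l).1)]

/-- The moments of the Cayley coordinate of `pContFract p`. -/
noncomputable def moment (k : ℕ) (p : ℂ) : ℂ :=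
  ∫ x, cayley (pContFract p x) ^ k ∂questionMarkMeasure

theorem norm_moment_le {p : ℂ} (hp : ‖p - 2‖ ≤ 1 / 20) (k : ℕ) :
    ‖moment k p‖ ≤ ‖p - 2‖ ^ k := by
  have := norm_integral_le_of_norm_le_const (μ := questionMarkMeasure)
    (f := fun x => cayley (pContFract p x) ^ k) (C := ‖p - 2‖ ^ k)
    (Eventually.of_forall fun x => by
      rw [norm_pow]; exact pow_le_pow_left₀ (norm_nonneg _) (pContFract_mem hp x).2 k)
  simpa [moment] using this

theorem norm_pow_sub_pow_le {v w : ℂ} (hv : ‖v‖ ≤ 1) (hw : ‖w‖ ≤ 1) (k : ℕ) :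
    ‖v ^ k - w ^ k‖ ≤ k * ‖v - w‖ := by
  induction k with
  | zero => simp
  | succ k ih =>
    have e : v ^ (k + 1) - w ^ (k + 1) = v * (v ^ k - w ^ k) + (v - w) * w ^ k := by ring
    rw [e]
    refine (norm_add_le _ _).trans ?_
    rw [norm_mul, norm_mul, norm_pow]
    have h1 : ‖v‖ * ‖v ^ k - w ^ k‖ ≤ 1 * (k * ‖v - w‖) := by gcongr
    have h2 : ‖v - w‖ * ‖w‖ ^ k ≤ ‖v - w‖ * 1 := by
      gcongr
      exact pow_le_one₀ (norm_nonneg _) hw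
    push_cast
    linarith

theorem lipschitz_pow {p : ℂ} (hp : ‖p - 2‖ ≤ 1 / 20) (k : ℕ) (v w : ℂ) (hv : ‖v‖ ≤ ‖p - 2‖)
    (hw : ‖w‖ ≤ ‖p - 2‖) : ‖v ^ k - w ^ k‖ ≤ k * ‖v - w‖ :=
  norm_pow_sub_pow_le (by linarith) (by linarith) k

theorem moment_eq_zero_of_odd {p : ℂ} (hp : ‖p - 2‖ ≤ 1 / 20) {k : ℕ} (hk : Odd k) :
    moment k p = 0 := by
  have h := integral_cayley_neg hp (φ := fun v => v ^ k) (measurable_id.pow_const k)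
    k.cast_nonneg (lipschitz_pow hp k)
  simp only [hk.neg_pow, integral_neg] at h
  exact self_eq_neg.1 h.symm

theorem differentiableOn_of_geometric {φ : ℂ → ℂ} {ψ : ℕ → ℂ → ℂ} {r C : ℝ}
    (hψ : ∀ N, DifferentiableOn ℂ (ψ N) (Metric.ball 2 r))
    (h : ∀ N, ∀ p ∈ Metric.ball (2 : ℂ) r, ‖φ p - ψ N p‖ ≤ C * (21 / 25) ^ N) :
    DifferentiableOn ℂ φ (Metric.ball 2 r) := by
  have h1 : TendstoUniformlyOn ψ φ atTop (Metric.ball 2 r) := by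
    rw [Metric.tendstoUniformlyOn_iff]
    intro ε hε
    filter_upwards [(tendsto_zero_geometric C).eventually_lt_const hε] with N hN p hp
    rw [dist_eq_norm]
    exact (h N p hp).trans_lt hN
  exact h1.tendstoLocallyUniformlyOn.differentiableOn (Eventually.of_forall hψ)
    Metric.isOpen_ball

theorem analyticAt_cayley_wordMap (l : List Bool) {p : ℂ} (hp : ‖p - 2‖ ≤ 1 / 20) :
    AnalyticAt ℂ (fun p => cayley (wordMap p l 1)) p := by
  have h := analyticAt_wordMap_two l (p := p) (by linarith)
  exact (h.sub analyticAt_const).div (h.add analyticAt_const)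
    (wordMap_mem_cayleyNear hp (one_mem_cayleyNear p) l).1.1

theorem norm_sub_two_le_of_mem_ball {p : ℂ} {r : ℝ} (hr : r ≤ 1 / 20)
    (hp : p ∈ Metric.ball (2 : ℂ) r) : ‖p - 2‖ ≤ 1 / 20 :=
  (mem_ball_iff_norm.1 hp).le.trans hr

theorem analyticAt_moment (k : ℕ) : AnalyticAt ℂ (moment k) 2 := by
  have h : DifferentiableOn ℂ (moment k) (Metric.ball 2 (1 / 20)) := by
    refine differentiableOn_of_geometric (C := k)
      (ψ := fun N p => wordAvg N (fun l => cayley (wordMap p l 1) ^ k)) ?_ ?_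
    · intro N p hp
      exact (analyticAt_wordAvg fun l _ => (analyticAt_cayley_wordMap l
        (norm_sub_two_le_of_mem_ball le_rfl hp)).pow k).differentiableAt.differentiableWithinAt
    · intro N p hp
      have hp := norm_sub_two_le_of_mem_ball le_rfl hp
      exact norm_integral_cayley_sub_le hp (φ := fun v => v ^ k) (measurable_id.pow_const k)
        k.cast_nonneg (lipschitz_pow hp k) N
  exact h.analyticAt (Metric.ball_mem_nhds _ (by norm_num))

theorem eventually_near_two {r : ℝ} (hr : 0 < r) : ∀ᶠ p in 𝓝 (2 : ℂ), ‖p - 2‖ ≤ r := by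
  filter_upwards [Metric.ball_mem_nhds (2 : ℂ) hr] with p hp
  exact (mem_ball_iff_norm.1 hp).le

/-- The Taylor coefficients of the moments at `p = 2`. -/
noncomputable def momentCoeff (k n : ℕ) : ℂ := taylorCoeff n (moment k)

/-- The `k`-th moment is `O(‖p - 2‖ ^ k)`. Hence only finitely many moments contribute to each
Taylor coefficient of `G(p, z)`. -/
theorem momentCoeff_of_lt {k n : ℕ} (h : n < k) : momentCoeff k n = 0 := by
  refine taylorCoeff_eq_zero_of_isBigO (analyticAt_moment k) (C := 1) ?_
  filter_upwards [eventually_near_two (r := 1 / 20) (by norm_num)] with p hp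
  rw [one_mul]
  exact (norm_moment_le hp k).trans
    (pow_le_pow_of_le_one (norm_nonneg _) (by linarith) h)

theorem momentCoeff_of_odd {k : ℕ} (hk : Odd k) (n : ℕ) : momentCoeff k n = 0 := by
  have : moment k =ᶠ[𝓝 2] fun _ => 0 := by
    filter_upwards [eventually_near_two (r := 1 / 20) (by norm_num)] with p hp
    exact moment_eq_zero_of_odd hp hk
  rw [momentCoeff, taylorCoeff_congr this, taylorCoeff]
  simp

theorem taylor_remainder {φ : ℂ → ℂ} (hφ : AnalyticAt ℂ φ 2) (n : ℕ) :
    ∃ C : ℝ, 0 ≤ C ∧ ∀ᶠ p in 𝓝 (2 : ℂ),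
      ‖φ p - ∑ m ∈ Finset.range n, taylorCoeff m φ * (p - 2) ^ m‖ ≤ C * ‖p - 2‖ ^ n := by
  obtain ⟨C, hC, h⟩ := (hφ.hasFPowerSeriesAt.isBigO_sub_partialSum_pow n).exists_pos
  refine ⟨C, hC.le, ?_⟩
  have h2 : Tendsto (fun p : ℂ => p - 2) (𝓝 2) (𝓝 0) := by
    have : ContinuousAt (fun p : ℂ => p - 2) 2 := by fun_prop
    simpa [ContinuousAt] using this
  filter_upwards [h2.eventually h.bound] with p hp
  rw [add_sub_cancel, norm_pow, norm_norm] at hp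
  refine le_trans (le_of_eq ?_) hp
  congr 2
  simp only [FormalMultilinearSeries.partialSum, FormalMultilinearSeries.ofScalars_apply_eq,
    taylorCoeff, smul_eq_mul]

/-! ### The period function near `p = 2` -/

/-- The kernel `1 / (X + 1 - z)` in terms of the Cayley coordinate of `X`. -/
noncomputable def periodKernel (z v : ℂ) : ℂ := (1 - v) / (2 - z + z * v)

theorem periodKernel_cayley {X : ℂ} (hX : X + 1 ≠ 0) (z : ℂ) :
    1 / (X + 1 - z) = periodKernel z (cayley X) := by
  have e : 2 - z + z * cayley X = 2 * (X + 1 - z) / (X + 1) := by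
    rw [cayley]; field_simp; ring
  rw [periodKernel, e, one_sub_cayley hX, div_div_div_cancel_right₀ hX,
    mul_comm, div_mul_cancel_right₀ two_ne_zero, one_div]

/-- `‖zv‖ ≤ (‖z - 2‖ + 2) ρ`, and the two hypotheses bound this by `(1/20 + 1/3) ‖z - 2‖`. -/
theorem periodKernel_den {z v : ℂ} {ρ : ℝ} (hρ : ρ ≤ 1 / 20) (hz : 6 * ρ ≤ ‖z - 2‖)
    (hv : ‖v‖ ≤ ρ) : ‖z - 2‖ / 2 ≤ ‖2 - z + z * v‖ := by
  have h1 : ‖z‖ ≤ ‖z - 2‖ + 2 := by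
    have := norm_add_le (z - 2) 2
    rwa [sub_add_cancel, Complex.norm_ofNat] at this
  have h2 : ‖z * v‖ ≤ (‖z - 2‖ + 2) * ρ := by
    rw [norm_mul]; gcongr
  have h3 := norm_sub_le (2 - z + z * v) (z * v)
  rw [add_sub_cancel_right, norm_sub_rev] at h3
  have h4 := (norm_nonneg v).trans hv
  nlinarith [norm_nonneg (z - 2)]

theorem periodKernel_lipschitz {z v w : ℂ} {ρ : ℝ} (hρ : ρ ≤ 1 / 20) (hz0 : z ≠ 2)
    (hz : 6 * ρ ≤ ‖z - 2‖) (hv : ‖v‖ ≤ ρ) (hw : ‖w‖ ≤ ρ) :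
    ‖periodKernel z v - periodKernel z w‖ ≤ 8 / ‖z - 2‖ ^ 2 * ‖v - w‖ := by
  have hpos : 0 < ‖z - 2‖ := norm_pos_iff.2 (sub_ne_zero.2 hz0)
  have h1 := periodKernel_den hρ hz hv
  have h2 := periodKernel_den hρ hz hw
  have n1 : 2 - z + z * v ≠ 0 := norm_pos_iff.1 (by linarith)
  have n2 : 2 - z + z * w ≠ 0 := norm_pos_iff.1 (by linarith)
  have e : periodKernel z v - periodKernel z w =
      2 * (w - v) / ((2 - z + z * v) * (2 - z + z * w)) := by
    rw [periodKernel, periodKernel, div_sub_div _ _ n1 n2]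
    congr 1; ring
  rw [e, norm_div, norm_mul, norm_mul, norm_sub_rev w, Complex.norm_ofNat, div_mul_eq_mul_div,
    div_le_div_iff₀ (mul_pos (by linarith) (by linarith)) (by positivity)]
  have h3 := mul_le_mul h1 h2 (by positivity) (norm_nonneg _)
  nlinarith [norm_nonneg (v - w)]

/-- The points `p` for which the kernel is under control. -/
def NearTwo (z p : ℂ) : Prop := ‖p - 2‖ ≤ 1 / 20 ∧ 6 * ‖p - 2‖ ≤ ‖z - 2‖

theorem measurable_periodKernel (z : ℂ) : Measurable (periodKernel z) :=
  (measurable_id.const_sub 1).div ((measurable_id.const_mul z).const_add (2 - z))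

theorem pPeriod_eq_integral_kernel {z p : ℂ} (hp : ‖p - 2‖ ≤ 1 / 20) :
    pPeriod p z = ∫ x, periodKernel z (cayley (pContFract p x)) ∂questionMarkMeasure := by
  rw [pPeriod, questionMarkMeasure_restrict]
  exact integral_congr_ae (Eventually.of_forall fun x =>
    periodKernel_cayley (pContFract_mem hp x).1.1 z)

theorem norm_pPeriod_sub_wordPeriod_le {z p : ℂ} (hz : z ≠ 2) (hp : NearTwo z p) (N : ℕ) :
    ‖pPeriod p z - wordPeriod N p z‖ ≤ 8 / ‖z - 2‖ ^ 2 * (21 / 25) ^ N := by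
  rw [pPeriod_eq_integral_kernel hp.1, wordPeriod]
  have e : ∀ l, 1 / (wordMap p l 1 + 1 - z) = periodKernel z (cayley (wordMap p l 1)) := fun l =>
    periodKernel_cayley (wordMap_mem_cayleyNear hp.1 (one_mem_cayleyNear p) l).1.1 z
  simp only [e]
  exact norm_integral_cayley_sub_le hp.1 (measurable_periodKernel z) (by positivity)
    (fun v w hv hw => periodKernel_lipschitz hp.1 hz hp.2 hv hw) N

theorem norm_periodKernel_le {z v : ℂ} {ρ : ℝ} (hρ : ρ ≤ 1 / 20) (hz0 : z ≠ 2)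
    (hz : 6 * ρ ≤ ‖z - 2‖) (hv : ‖v‖ ≤ ρ) : ‖periodKernel z v‖ ≤ 4 / ‖z - 2‖ := by
  have hpos : 0 < ‖z - 2‖ := norm_pos_iff.2 (sub_ne_zero.2 hz0)
  have h1 := periodKernel_den hρ hz hv
  have h2 := norm_sub_le 1 v
  rw [norm_one] at h2
  rw [periodKernel, norm_div, div_le_div_iff₀ (by linarith) hpos]
  nlinarith

theorem integrable_periodKernel {z p : ℂ} (hz : z ≠ 2) (hp : NearTwo z p) :
    Integrable (fun x => periodKernel z (cayley (pContFract p x))) questionMarkMeasure :=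
  (isSelfSimilar_pContFract hp.1).integrable
    (R := fun X => periodKernel z (cayley X)) ((measurable_periodKernel z).comp measurable_cayley)
    fun _ hX => norm_periodKernel_le hp.1 hz hp.2 hX.2

theorem integrableOn_pPeriod {z p : ℂ} (hz : z ≠ 2) (hp : NearTwo z p) :
    IntegrableOn (fun x : ℝ => 1 / (pContFract p x + 1 - z)) (Set.Ici 0) questionMarkMeasure := by
  rw [IntegrableOn, questionMarkMeasure_restrict]
  refine (integrable_periodKernel hz hp).congr (Eventually.of_forall fun x => ?_)
  exact (periodKernel_cayley (pContFract_mem hp.1 x).1.1 z).symm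

theorem eventually_nearTwo {z : ℂ} (hz : z ≠ 2) : ∀ᶠ p in 𝓝 (2 : ℂ), NearTwo z p := by
  have hpos : 0 < ‖z - 2‖ := norm_pos_iff.2 (sub_ne_zero.2 hz)
  filter_upwards [eventually_near_two (r := 1 / 20) (by norm_num),
    eventually_near_two (r := ‖z - 2‖ / 6) (by positivity)] with p h1 h2
  exact ⟨h1, by linarith⟩

theorem wordMap_den_ne_zero {z p : ℂ} (hz : z ≠ 2) (hp : NearTwo z p) (l : List Bool) :
    wordMap p l 1 + 1 - z ≠ 0 := by
  have hpos : 0 < ‖z - 2‖ := norm_pos_iff.2 (sub_ne_zero.2 hz)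
  have hX := wordMap_mem_cayleyNear hp.1 (one_mem_cayleyNear p) l
  have h1 := periodKernel_den hp.1 hp.2 hX.2
  intro h
  have e : 2 - z + z * cayley (wordMap p l 1) = 0 := by
    have := hX.1.1
    have h' : z = wordMap p l 1 + 1 := by linear_combination -h
    rw [h', cayley]; field_simp; ring
  rw [e, norm_zero] at h1
  linarith

theorem analyticAt_wordPeriod {z p : ℂ} (hz : z ≠ 2) (hp : NearTwo z p) (N : ℕ) :
    AnalyticAt ℂ (fun p => wordPeriod N p z) p :=
  analyticAt_wordAvg fun l _ => analyticAt_const.div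
    (((analyticAt_wordMap_two l (by linarith [hp.1])).add analyticAt_const).sub analyticAt_const)
    (wordMap_den_ne_zero hz hp l)

theorem exists_differentiableOn_pPeriod {z : ℂ} (hz : z ≠ 2) :
    ∃ r > 0, (∀ p ∈ Metric.closedBall (2 : ℂ) r, NearTwo z p) ∧
      DifferentiableOn ℂ (fun p => pPeriod p z) (Metric.ball 2 r) := by
  obtain ⟨r, hr, h⟩ := Metric.eventually_nhds_iff_ball.1 (eventually_nearTwo hz)
  refine ⟨r / 2, by positivity, fun p hp =>
    h p (Metric.closedBall_subset_ball (by linarith) hp), ?_⟩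
  have h' : ∀ p ∈ Metric.ball (2 : ℂ) (r / 2), NearTwo z p := fun p hp =>
    h p (Metric.ball_subset_ball (by linarith) hp)
  exact differentiableOn_of_geometric
    (fun N p hp =>
      (analyticAt_wordPeriod hz (h' p hp) N).differentiableAt.differentiableWithinAt)
    (fun N p hp => norm_pPeriod_sub_wordPeriod_le hz (h' p hp) N)

theorem analyticAt_pPeriod {z : ℂ} (hz : z ≠ 2) : AnalyticAt ℂ (fun p => pPeriod p z) 2 := by
  obtain ⟨r, hr, -, h⟩ := exists_differentiableOn_pPeriod hz
  exact h.analyticAt (Metric.ball_mem_nhds _ hr)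

/-- Geometric expansion at `v = 0` with exact remainder; integrating it replaces the powers of `v`
by moments. -/
theorem periodKernel_expansion {z v : ℂ} (hz : z ≠ 2) (hv : 2 - z + z * v ≠ 0) (n : ℕ) :
    periodKernel z v = -1 / (z - 2) +
      ∑ k ∈ Finset.range n, -2 * z ^ k / (z - 2) ^ (k + 2) * v ^ (k + 1) +
      2 * z ^ n * v ^ (n + 1) / ((z - 2) ^ (n + 1) * (2 - z + z * v)) := by
  have h1 : z - 2 ≠ 0 := sub_ne_zero.2 hz
  induction n with
  | zero =>
    rw [periodKernel, Finset.sum_range_zero, pow_zero, zero_add, pow_one, pow_one, add_zero,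
      div_add_div _ _ h1 (mul_ne_zero h1 hv),
      div_eq_div_iff hv (mul_ne_zero h1 (mul_ne_zero h1 hv))]
    ring
  | succ n ih =>
    rw [ih, Finset.sum_range_succ]
    field_simp
    ring

theorem norm_pPeriod_sub_moments_le {z p : ℂ} (hz : z ≠ 2) (hp : NearTwo z p) (n : ℕ) :
    ‖pPeriod p z - (-1 / (z - 2) +
      ∑ k ∈ Finset.range n, -2 * z ^ k / (z - 2) ^ (k + 2) * moment (k + 1) p)‖ ≤
      4 * ‖z‖ ^ n / ‖z - 2‖ ^ (n + 2) * ‖p - 2‖ ^ (n + 1) := by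
  have hpos : 0 < ‖z - 2‖ := norm_pos_iff.2 (sub_ne_zero.2 hz)
  have hint : ∀ k, Integrable (fun x => -2 * z ^ k / (z - 2) ^ (k + 2) *
      cayley (pContFract p x) ^ (k + 1)) questionMarkMeasure := fun k => by
    refine Integrable.const_mul ?_ _
    refine (isSelfSimilar_pContFract hp.1).integrable (R := fun X => cayley X ^ (k + 1)) (C := 1)
      (measurable_cayley.pow_const _) fun X hX => ?_
    rw [norm_pow]
    exact pow_le_one₀ (norm_nonneg _) (hX.1.2.trans (by norm_num))
  have e : -1 / (z - 2) +
      ∑ k ∈ Finset.range n, -2 * z ^ k / (z - 2) ^ (k + 2) * moment (k + 1) p =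
      ∫ x, (-1 / (z - 2) + ∑ k ∈ Finset.range n, -2 * z ^ k / (z - 2) ^ (k + 2) *
        cayley (pContFract p x) ^ (k + 1)) ∂questionMarkMeasure := by
    rw [integral_add (integrable_const _) (integrable_finsetSum _ fun k _ => hint k),
      integral_finsetSum _ fun k _ => hint k]
    simp only [integral_const_mul, moment]
    simp
  have hsum : Integrable (fun x => -1 / (z - 2) + ∑ k ∈ Finset.range n,
      -2 * z ^ k / (z - 2) ^ (k + 2) * cayley (pContFract p x) ^ (k + 1)) questionMarkMeasure :=
    (integrable_const _).add (integrable_finsetSum _ fun k _ => hint k)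
  rw [pPeriod_eq_integral_kernel hp.1, e, ← integral_sub (integrable_periodKernel hz hp) hsum]
  have := norm_integral_le_of_norm_le_const (μ := questionMarkMeasure)
    (f := fun x => periodKernel z (cayley (pContFract p x)) - (-1 / (z - 2) +
      ∑ k ∈ Finset.range n, -2 * z ^ k / (z - 2) ^ (k + 2) * cayley (pContFract p x) ^ (k + 1)))
    (C := 4 * ‖z‖ ^ n / ‖z - 2‖ ^ (n + 2) * ‖p - 2‖ ^ (n + 1))
    (Eventually.of_forall fun x => by
      have hX := (pContFract_mem hp.1 x).2
      have h1 := periodKernel_den hp.1 hp.2 hX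
      have h2 : 2 - z + z * cayley (pContFract p x) ≠ 0 := norm_pos_iff.1 (by linarith)
      rw [periodKernel_expansion hz h2 n, add_sub_cancel_left, norm_div, norm_mul, norm_mul,
        norm_mul, norm_pow, norm_pow, norm_pow, Complex.norm_ofNat, div_mul_eq_mul_div,
        div_le_div_iff₀ (mul_pos (by positivity) (by linarith)) (by positivity)]
      have h3 := pow_le_pow_left₀ (norm_nonneg _) hX (n + 1)
      have h4 : ‖cayley (pContFract p x)‖ ^ (n + 1) * ‖z - 2‖ ≤
          ‖p - 2‖ ^ (n + 1) * (2 * ‖2 - z + z * cayley (pContFract p x)‖) := by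
        gcongr; linarith
      calc _ = 2 * ‖z‖ ^ n * ‖z - 2‖ ^ (n + 1) *
            (‖cayley (pContFract p x)‖ ^ (n + 1) * ‖z - 2‖) := by ring
        _ ≤ 2 * ‖z‖ ^ n * ‖z - 2‖ ^ (n + 1) * (‖p - 2‖ ^ (n + 1) *
            (2 * ‖2 - z + z * cayley (pContFract p x)‖)) := by gcongr
        _ = _ := by ring)
  simpa using this

/-! ### The polynomials -/

/-- The numerators of the Taylor coefficients of `pPeriod` at `p = 2`. -/
noncomputable def periodPoly : ℕ → ℂ[X]
  | 0 => -1
  | n + 1 => ∑ k ∈ Finset.range (n + 1),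
      C (-2 * momentCoeff (k + 1) (n + 1)) * (X ^ k * (X - C 2) ^ (n - k))

/-- The Taylor coefficients of `pPeriod` at `p = 2`. -/
noncomputable def periodCoeff (n : ℕ) (z : ℂ) : ℂ := (periodPoly n).eval z / (z - 2) ^ (n + 1)

theorem momentCoeff_zero_right (k : ℕ) : momentCoeff (k + 1) 0 = 0 :=
  momentCoeff_of_lt k.succ_pos

/-- Moments beyond the `n`-th do not contribute, so one common `K` serves all coefficients up to
order `K` in `pPeriod_remainder`. -/
theorem periodCoeff_eq_sum {z : ℂ} (hz : z ≠ 2) (n : ℕ) {K : ℕ} (hK : n ≤ K) :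
    periodCoeff n z = (if n = 0 then -1 / (z - 2) else 0) +
      ∑ k ∈ Finset.range K, -2 * z ^ k / (z - 2) ^ (k + 2) * momentCoeff (k + 1) n := by
  have h1 : z - 2 ≠ 0 := sub_ne_zero.2 hz
  cases n with
  | zero => simp [periodCoeff, periodPoly, momentCoeff_zero_right]
  | succ n =>
    rw [periodCoeff, periodPoly, eval_finsetSum, if_neg n.succ_ne_zero, zero_add, Finset.sum_div,
      ← Finset.sum_subset (Finset.range_subset_range.2 hK) (fun k _ hk => by
        rw [momentCoeff_of_lt (by simpa using hk), mul_zero])]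
    refine Finset.sum_congr rfl fun k hk => ?_
    have hk : k ≤ n := by simpa [Nat.lt_succ_iff] using hk
    obtain ⟨m, rfl⟩ := Nat.exists_eq_add_of_le hk
    simp only [eval_mul, eval_C, eval_pow, eval_X, eval_sub, Nat.add_sub_cancel_left]
    field_simp
    ring

/-- Taylor expansion of `pPeriod` with a remainder which is locally uniform in `z`. -/
theorem pPeriod_remainder (n : ℕ) {M d : ℝ} (hd : 0 < d) : ∃ K : ℝ, 0 ≤ K ∧
    ∀ᶠ p in 𝓝 (2 : ℂ), ∀ z : ℂ, ‖z‖ ≤ M → d ≤ ‖z - 2‖ →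
      ‖pPeriod p z - ∑ m ∈ Finset.range (n + 1), periodCoeff m z * (p - 2) ^ m‖ ≤
        K * ‖p - 2‖ ^ (n + 1) := by
  choose c hc0 hc using fun k => taylor_remainder (analyticAt_moment k) (n + 1)
  have hM : ∀ z : ℂ, ‖z‖ ≤ M → 0 ≤ M := fun z h => (norm_nonneg z).trans h
  refine ⟨4 * |M| ^ n / d ^ (n + 2) +
    ∑ k ∈ Finset.range n, 2 * |M| ^ k / d ^ (k + 2) * c (k + 1), ?_, ?_⟩
  · have : ∀ k, 0 ≤ 2 * |M| ^ k / d ^ (k + 2) * c (k + 1) := fun k =>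
      mul_nonneg (by positivity) (hc0 _)
    exact add_nonneg (by positivity) (Finset.sum_nonneg fun k _ => this k)
  filter_upwards [eventually_near_two (r := 1 / 20) (by norm_num),
    eventually_near_two (r := d / 6) (by positivity),
    (Finset.eventually_all (Finset.range n)).2 fun k _ => hc (k + 1)] with p h1 h2 h3 z hzM hzd
  have hz : z ≠ 2 := by rintro rfl; rw [sub_self, norm_zero] at hzd; linarith
  have hMM : ‖z‖ ≤ |M| := hzM.trans (le_abs_self M)
  have e : ∑ m ∈ Finset.range (n + 1), periodCoeff m z * (p - 2) ^ m = -1 / (z - 2) +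
      ∑ k ∈ Finset.range n, -2 * z ^ k / (z - 2) ^ (k + 2) *
        ∑ m ∈ Finset.range (n + 1), taylorCoeff m (moment (k + 1)) * (p - 2) ^ m := by
    have e1 : ∀ m ∈ Finset.range (n + 1), periodCoeff m z * (p - 2) ^ m =
        (if m = 0 then -1 / (z - 2) else 0) + ∑ k ∈ Finset.range n,
          -2 * z ^ k / (z - 2) ^ (k + 2) * (momentCoeff (k + 1) m * (p - 2) ^ m) := by
      intro m hm
      rw [periodCoeff_eq_sum hz m (by simpa [Nat.lt_succ_iff] using hm), add_mul, Finset.sum_mul]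
      congr 1
      · split_ifs with h
        · rw [h, pow_zero, mul_one]
        · rw [zero_mul]
      · exact Finset.sum_congr rfl fun k _ => by ring
    rw [Finset.sum_congr rfl e1, Finset.sum_add_distrib, Finset.sum_comm]
    simp only [← Finset.mul_sum]
    congr 1
    rw [Finset.sum_ite_eq' (Finset.range (n + 1)) 0]
    simp
  have h4 := norm_pPeriod_sub_moments_le hz ⟨h1, by linarith⟩ n
  have h5 : ‖(-1 / (z - 2) +
      ∑ k ∈ Finset.range n, -2 * z ^ k / (z - 2) ^ (k + 2) * moment (k + 1) p) -
      ∑ m ∈ Finset.range (n + 1), periodCoeff m z * (p - 2) ^ m‖ ≤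
      (∑ k ∈ Finset.range n, 2 * |M| ^ k / d ^ (k + 2) * c (k + 1)) * ‖p - 2‖ ^ (n + 1) := by
    rw [e, add_sub_add_left_eq_sub, ← Finset.sum_sub_distrib, Finset.sum_mul]
    refine norm_sum_le_of_le _ fun k hk => ?_
    rw [← mul_sub, norm_mul, norm_div, norm_mul, norm_neg, Complex.norm_ofNat, norm_pow, norm_pow,
      mul_assoc (2 * |M| ^ k / d ^ (k + 2))]
    gcongr
    exact h3 k hk
  have h6 := norm_sub_le_norm_sub_add_norm_sub (pPeriod p z) (-1 / (z - 2) +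
      ∑ k ∈ Finset.range n, -2 * z ^ k / (z - 2) ^ (k + 2) * moment (k + 1) p)
      (∑ m ∈ Finset.range (n + 1), periodCoeff m z * (p - 2) ^ m)
  have h7 : 4 * ‖z‖ ^ n / ‖z - 2‖ ^ (n + 2) * ‖p - 2‖ ^ (n + 1) ≤
      4 * |M| ^ n / d ^ (n + 2) * ‖p - 2‖ ^ (n + 1) := by gcongr
  rw [add_mul]
  linarith

theorem taylorCoeff_const (c : ℂ) (n : ℕ) :
    taylorCoeff n (fun _ => c) = if n = 0 then c else 0 := by
  rw [taylorCoeff, iteratedDeriv_const]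
  split_ifs with h
  · simp [h]
  · simp

theorem taylorCoeff_const_mul_pow (c : ℂ) (m n : ℕ) :
    taylorCoeff n (fun p => c * (p - 2) ^ m) = if n = m then c else 0 := by
  have e : (fun p : ℂ => c * (p - 2) ^ m) = fun p => (p - 2) ^ m * c := by
    funext p; ring
  rw [e, taylorCoeff_pow_mul analyticAt_const, taylorCoeff_const]
  by_cases h : m ≤ n
  · rw [if_pos h]
    congr 1
    exact propext ⟨fun h' => by omega, fun h' => by omega⟩
  · rw [if_neg h, if_neg (by omega)]

/-- The explicit polynomial in `p - 2` approximates `pPeriod` to order `n + 1`, so its `n`-th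
coefficient is the Taylor coefficient. -/
theorem taylorCoeff_pPeriod {z : ℂ} (hz : z ≠ 2) (n : ℕ) :
    taylorCoeff n (fun p => pPeriod p z) = periodCoeff n z := by
  obtain ⟨K, -, hK⟩ := pPeriod_remainder n (M := ‖z‖) (d := ‖z - 2‖)
    (norm_pos_iff.2 (sub_ne_zero.2 hz))
  have han : ∀ m ∈ Finset.range (n + 1),
      AnalyticAt ℂ (fun p : ℂ => periodCoeff m z * (p - 2) ^ m) 2 := fun m _ =>
    analyticAt_const.mul ((analyticAt_id.sub analyticAt_const).pow m)
  have hsum := Finset.analyticAt_fun_sum (Finset.range (n + 1)) han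
  have h := taylorCoeff_eq_zero_of_isBigO (n := n) (C := K) ((analyticAt_pPeriod hz).sub hsum)
    (hK.mono fun p hp => hp z le_rfl le_rfl)
  have h2 := taylorCoeff_sub (analyticAt_pPeriod hz) hsum n
  rw [taylorCoeff_sum _ han] at h2
  simp only [taylorCoeff_const_mul_pow] at h2
  rw [Finset.sum_ite_eq, if_pos (by simp)] at h2
  exact sub_eq_zero.1 (h2.symm.trans h)

theorem periodPoly_degree_lt {n : ℕ} (hn : 1 ≤ n) : (periodPoly n).degree < n := by
  obtain ⟨m, rfl⟩ := Nat.exists_eq_add_of_le' hn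
  rw [periodPoly]
  refine (degree_sum_le _ _).trans_lt ?_
  rw [Finset.sup_lt_iff (by exact WithBot.bot_lt_coe _)]
  intro k hk
  have hk : k ≤ m := by simpa [Nat.lt_succ_iff] using hk
  have h1 : (X ^ k * (X - C 2) ^ (m - k) : ℂ[X]).degree ≤ (m : ℕ) := by
    refine (degree_mul_le _ _).trans ?_
    rw [degree_X_pow, degree_pow, degree_X_sub_C]
    have : (k : WithBot ℕ) + ((m - k : ℕ) : WithBot ℕ) = m := by exact_mod_cast (by omega)
    simpa using this.le
  refine lt_of_le_of_lt (degree_mul_le _ _) ?_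
  refine lt_of_le_of_lt (add_le_add degree_C_le h1) ?_
  rw [zero_add]
  exact_mod_cast m.lt_succ_self

theorem periodPoly_one : periodPoly 1 = 0 := by
  simp [periodPoly, momentCoeff_of_odd odd_one]

theorem periodPoly_eval_zero {n : ℕ} (hn : 1 ≤ n) : (periodPoly n).eval 0 = 0 := by
  obtain ⟨m, rfl⟩ := Nat.exists_eq_add_of_le' hn
  rw [periodPoly, eval_finsetSum]
  refine Finset.sum_eq_zero fun k _ => ?_
  rcases k with _ | k
  · simp [momentCoeff_of_odd odd_one]
  · simp

/-- Holds summand by summand: `z ↦ 1 / z` keeps `z + 1` and reverses the sign of `z - 1`, up to a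
factor `z`. The signs agree because only summands with `k + 1` even survive. -/
theorem periodPoly_reciprocity {n : ℕ} (hn : 1 ≤ n) {z : ℂ} (hz : z ≠ 0) :
    (periodPoly n).eval (z + 1) = (-1) ^ n * z ^ (n - 1) * (periodPoly n).eval (1 / z + 1) := by
  obtain ⟨m, rfl⟩ := Nat.exists_eq_add_of_le' hn
  simp only [periodPoly, eval_finsetSum, Nat.add_sub_cancel]
  rw [Finset.mul_sum]
  refine Finset.sum_congr rfl fun k hk => ?_
  have hk : k ≤ m := by simpa [Nat.lt_succ_iff] using hk
  rcases Nat.even_or_odd (k + 1) with he | ho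
  · obtain ⟨j, rfl⟩ := Nat.exists_eq_add_of_le hk
    simp only [eval_mul, eval_C, eval_pow, eval_X, eval_sub, Nat.add_sub_cancel_left]
    have e1 : (1 / z + 1) = (z + 1) / z := by field_simp; ring
    have e2 : (1 / z + 1 - 2) = (-1) * (z + 1 - 2) / z := by field_simp; ring
    have e3 : (-1 : ℂ) ^ (k + j + 1) = (-1) ^ j := by
      rw [show k + j + 1 = (k + 1) + j by ring, pow_add, he.neg_one_pow, one_mul]
    have e4 : (-1 : ℂ) ^ j * (-1) ^ j = 1 := by rw [← mul_pow]; norm_num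
    rw [e2, e1, e3, div_pow, div_pow, mul_pow, pow_add]
    field_simp
    linear_combination ((z + 1) ^ k * (z + 1 - 2) ^ j * momentCoeff (k + 1) (k + j + 1)) * e4
  · rw [momentCoeff_of_odd ho]; simp

/-- All the products `X ^ k (X - 2) ^ (n - k)` are monic of degree `n`. -/
theorem periodPoly_coeff (n : ℕ) :
    (periodPoly (n + 1)).coeff n = -2 * ∑ k ∈ Finset.range (n + 1), momentCoeff (k + 1) (n + 1) := by
  rw [periodPoly, finsetSum_coeff, Finset.mul_sum]
  refine Finset.sum_congr rfl fun k hk => ?_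
  have hk : k ≤ n := by simpa [Nat.lt_succ_iff] using hk
  have h1 : (X ^ k * (X - C 2) ^ (n - k) : ℂ[X]).Monic :=
    (monic_X_pow k).mul ((monic_X_sub_C 2).pow _)
  have h2 : (X ^ k * (X - C 2) ^ (n - k) : ℂ[X]).natDegree = n := by
    rw [Monic.natDegree_mul (monic_X_pow k) ((monic_X_sub_C 2).pow _), natDegree_X_pow,
      natDegree_pow, natDegree_X_sub_C]
    omega
  have h3 := h1.coeff_natDegree
  rw [h2] at h3
  rw [coeff_C_mul, h3, mul_one]

/-! ### The mean of `pContFract` and the leading coefficients -/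

/-- The point with a given Cayley coordinate. -/
noncomputable def invCayley (v : ℂ) : ℂ := (1 + v) / (1 - v)

theorem measurable_invCayley : Measurable invCayley :=
  (measurable_id.const_add 1).div (measurable_id.const_sub 1)

theorem norm_one_sub_ge {v : ℂ} (hv : ‖v‖ ≤ 1 / 20) : 19 / 20 ≤ ‖1 - v‖ := by
  have := norm_sub_norm_le 1 v
  rw [norm_one] at this
  linarith

theorem invCayley_lipschitz {v w : ℂ} (hv : ‖v‖ ≤ 1 / 20) (hw : ‖w‖ ≤ 1 / 20) :
    ‖invCayley v - invCayley w‖ ≤ 3 * ‖v - w‖ := by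
  have h1 := norm_one_sub_ge hv
  have h2 := norm_one_sub_ge hw
  have n1 : 1 - v ≠ 0 := norm_pos_iff.1 (by linarith)
  have n2 : 1 - w ≠ 0 := norm_pos_iff.1 (by linarith)
  have e : invCayley v - invCayley w = 2 * (v - w) / ((1 - v) * (1 - w)) := by
    rw [invCayley, invCayley, div_sub_div _ _ n1 n2]; congr 1; ring
  rw [e, norm_div, norm_mul, norm_mul, Complex.norm_ofNat, div_le_iff₀ (by positivity)]
  have h3 := mul_le_mul h1 h2 (by positivity) (norm_nonneg _)
  nlinarith [norm_nonneg (v - w)]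

theorem norm_invCayley_le {v : ℂ} (hv : ‖v‖ ≤ 1 / 20) : ‖invCayley v‖ ≤ 2 := by
  have h1 := norm_one_sub_ge hv
  have h2 := norm_add_le 1 v
  rw [norm_one] at h2
  rw [invCayley, norm_div, div_le_iff₀ (by linarith)]
  linarith

theorem invCayley_cayley {X : ℂ} (h : X ∈ cayleyDisc) : invCayley (cayley X) = X :=
  (eq_of_cayley h).symm

theorem norm_le_two_of_mem_cayleyNear {p X : ℂ} (hp : ‖p - 2‖ ≤ 1 / 20) (hX : X ∈ cayleyNear p) :
    ‖X‖ ≤ 2 := by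
  rw [← invCayley_cayley hX.1]
  exact norm_invCayley_le (hX.2.trans hp)

/-- The mean of `pContFract p` with respect to `dF`. -/
noncomputable def contFractMean (p : ℂ) : ℂ := ∫ x, pContFract p x ∂questionMarkMeasure

theorem ne_zero_of_near_two {p : ℂ} (hp : ‖p - 2‖ ≤ 1 / 20) : p ≠ 0 := by
  rintro rfl; norm_num at hp

theorem integrable_pContFract {p : ℂ} (hp : ‖p - 2‖ ≤ 1 / 20) :
    Integrable (pContFract p) questionMarkMeasure :=
  (isSelfSimilar_pContFract hp).integrable (R := id) measurable_id
    fun _ hX => norm_le_two_of_mem_cayleyNear hp hX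

theorem integrable_inv_pContFract {p : ℂ} (hp : ‖p - 2‖ ≤ 1 / 20) :
    Integrable (fun x => (pContFract p x)⁻¹) questionMarkMeasure :=
  (isSelfSimilar_pContFract hp).integrable (R := fun X => X⁻¹) measurable_inv
    fun _ hX => norm_le_two_of_mem_cayleyNear hp (inv_mem_cayleyNear hX)

theorem integral_inv_pContFract {p : ℂ} (hp : ‖p - 2‖ ≤ 1 / 20) :
    ∫ x, (pContFract p x)⁻¹ ∂questionMarkMeasure = contFractMean p := by
  have h := integral_cayley_neg hp measurable_invCayley (L := 3) (by norm_num)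
    fun v w hv hw => invCayley_lipschitz (hv.trans hp) (hw.trans hp)
  rw [contFractMean]
  refine Eq.trans (integral_congr_ae (Eventually.of_forall fun x => ?_))
    (h.trans (integral_congr_ae (Eventually.of_forall fun x => ?_)))
  · have hX := (pContFract_mem hp x).1
    change _ = invCayley (-cayley (pContFract p x))
    rw [← cayley_inv (ne_zero_of_mem_cayleyDisc hX), invCayley_cayley (inv_mem_cayleyDisc hX)]
  · exact invCayley_cayley (pContFract_mem hp x).1

/-- The mean `m` of `𝔛` equals that of its inverse `X⁻¹`. Self-similarity applied to `X⁻¹` gives `m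
= (p / 2 + (1 + m) / p) / 2`, since `1 / (1 + X) = (1 - v) / 2` and the first moment of `v`
vanishes. -/
theorem contFractMean_eq {p : ℂ} (hp : ‖p - 2‖ ≤ 1 / 20) :
    contFractMean p * (4 * p - 2) = p ^ 2 + 2 := by
  have hp0 := ne_zero_of_near_two hp
  have h := (isSelfSimilar_pContFract hp).integral_step (R := fun X => X⁻¹) measurable_inv
    fun _ hX => norm_le_two_of_mem_cayleyNear hp (inv_mem_cayleyNear hX)
  have h1 : ∫ x, (stepF p (pContFract p x))⁻¹ ∂questionMarkMeasure = p / 2 := by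
    have e : ∀ x, (stepF p (pContFract p x))⁻¹ = p / 2 - p / 2 * cayley (pContFract p x) ^ 1 := by
      intro x
      have hX := (pContFract_mem hp x).1.1
      have hX' : 1 + pContFract p x ≠ 0 := by rwa [add_comm]
      rw [stepF, cayley]; field_simp; ring
    have hi : Integrable (fun x => p / 2 * cayley (pContFract p x) ^ 1) questionMarkMeasure := by
      refine Integrable.const_mul ?_ _
      refine (isSelfSimilar_pContFract hp).integrable (R := fun X => cayley X ^ 1) (C := 1)
        (measurable_cayley.pow_const _) fun X hX => ?_
      rw [pow_one]
      exact hX.1.2.trans (by norm_num)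
    simp only [e]
    rw [integral_sub (integrable_const _) hi, integral_const_mul]
    have := moment_eq_zero_of_odd hp odd_one
    rw [moment] at this
    rw [this]
    simp
  have h2 : ∫ x, (stepG p (pContFract p x))⁻¹ ∂questionMarkMeasure =
      (1 + contFractMean p) / p := by
    have e : ∀ x, (stepG p (pContFract p x))⁻¹ = (1 + (pContFract p x)⁻¹) / p := fun x =>
      inv_stepG (ne_zero_of_mem_cayleyDisc (pContFract_mem hp x).1)
    simp only [e]
    rw [integral_div, integral_add (integrable_const _) (integrable_inv_pContFract hp),
      integral_inv_pContFract hp]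
    simp
  rw [integral_inv_pContFract hp, h1, h2, Complex.real_smul] at h
  push_cast at h
  field_simp at h
  linear_combination h

theorem invCayley_expansion {v : ℂ} (hv : 1 - v ≠ 0) (n : ℕ) :
    invCayley v = 1 + 2 * ∑ k ∈ Finset.range n, v ^ (k + 1) + 2 * v ^ (n + 1) / (1 - v) := by
  induction n with
  | zero => rw [invCayley, Finset.sum_range_zero]; field_simp; ring
  | succ n ih => rw [ih, Finset.sum_range_succ]; field_simp; ring

theorem norm_mean_sub_moments_le {p : ℂ} (hp : ‖p - 2‖ ≤ 1 / 20) (n : ℕ) :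
    ‖contFractMean p - (1 + 2 * ∑ k ∈ Finset.range n, moment (k + 1) p)‖ ≤
      3 * ‖p - 2‖ ^ (n + 1) := by
  have hint : ∀ k, Integrable (fun x => cayley (pContFract p x) ^ (k + 1)) questionMarkMeasure :=
    fun k => by
    refine (isSelfSimilar_pContFract hp).integrable (R := fun X => cayley X ^ (k + 1)) (C := 1)
      (measurable_cayley.pow_const _) fun X hX => ?_
    rw [norm_pow]
    exact pow_le_one₀ (norm_nonneg _) (hX.1.2.trans (by norm_num))
  have hs : Integrable (fun x => 2 * ∑ k ∈ Finset.range n, cayley (pContFract p x) ^ (k + 1))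
      questionMarkMeasure := (integrable_finsetSum _ fun k _ => hint k).const_mul 2
  have hs' : Integrable (fun x => 1 + 2 * ∑ k ∈ Finset.range n,
      cayley (pContFract p x) ^ (k + 1)) questionMarkMeasure := (integrable_const _).add hs
  have e : 1 + 2 * ∑ k ∈ Finset.range n, moment (k + 1) p = ∫ x, (1 + 2 * ∑ k ∈ Finset.range n,
      cayley (pContFract p x) ^ (k + 1)) ∂questionMarkMeasure := by
    rw [integral_add (integrable_const _) hs, integral_const_mul,
      integral_finsetSum _ fun k _ => hint k]
    simp [moment]
  rw [e, contFractMean, ← integral_sub (integrable_pContFract hp) hs']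
  have := norm_integral_le_of_norm_le_const (μ := questionMarkMeasure)
    (f := fun x => pContFract p x - (1 + 2 * ∑ k ∈ Finset.range n,
      cayley (pContFract p x) ^ (k + 1))) (C := 3 * ‖p - 2‖ ^ (n + 1))
    (Eventually.of_forall fun x => by
      have hX := pContFract_mem hp x
      have h1 := norm_one_sub_ge (hX.2.trans hp)
      have n1 : 1 - cayley (pContFract p x) ≠ 0 := norm_pos_iff.1 (by linarith)
      nth_rw 1 [← invCayley_cayley hX.1]
      rw [invCayley_expansion n1 n, add_sub_cancel_left, norm_div, norm_mul, norm_pow,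
        Complex.norm_ofNat, div_le_iff₀ (by linarith)]
      have h3 := pow_le_pow_left₀ (norm_nonneg _) hX.2 (n + 1)
      have h4 : (0 : ℝ) ≤ ‖p - 2‖ ^ (n + 1) := by positivity
      nlinarith)
  simpa using this

theorem taylorCoeff_inv_linear (n : ℕ) :
    AnalyticAt ℂ (fun p : ℂ => 1 / (4 * (2 * p - 1))) 2 ∧
      taylorCoeff n (fun p => 1 / (4 * (2 * p - 1))) = 1 / 12 * (-2 / 3) ^ n := by
  have h := analyticAt_of_hasSum (φ := fun p => 1 / (4 * (2 * p - 1)))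
    (c := fun n => 1 / 12 * (-2 / 3) ^ n) (by
      filter_upwards [eventually_near_two (r := 1) (by norm_num)] with p hp
      have h1 : ‖-2 / 3 * (p - 2)‖ < 1 := by
        rw [norm_mul]; norm_num; linarith
      have h2 := (hasSum_geometric_of_norm_lt_one h1).mul_left (1 / 12)
      have n1 : 1 - -2 / 3 * (p - 2) ≠ 0 := by
        intro h
        rw [show -2 / 3 * (p - 2) = 1 by linear_combination -h, norm_one] at h1
        exact lt_irrefl _ h1
      have e : 1 / (4 * (2 * p - 1)) = 1 / 12 * (1 - -2 / 3 * (p - 2))⁻¹ := by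
        rw [show 4 * (2 * p - 1) = 12 * (1 - -2 / 3 * (p - 2)) by ring]
        field_simp
      rw [e]
      refine h2.congr_fun fun n => ?_
      rw [mul_pow]; ring)
  exact ⟨h.1, h.2 n⟩

/-- From `X = 1 + 2 (v + v² + ⋯)` the sum of all moments is half of the mean minus `1`, that is `(p
- 2)² / (4 (2p - 1))`, and its Taylor series at `2` is geometric. The sum is a multiple of a leading
coefficient, which is therefore nonzero. -/
theorem sum_momentCoeff (n : ℕ) :
    ∑ k ∈ Finset.range (n + 2), momentCoeff (k + 1) (n + 2) = 1 / 12 * (-2 / 3) ^ n := by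
  have han : ∀ k ∈ Finset.range (n + 2), AnalyticAt ℂ (moment (k + 1)) 2 := fun k _ =>
    analyticAt_moment _
  have hs := Finset.analyticAt_fun_sum (Finset.range (n + 2)) han
  obtain ⟨ha, hc⟩ := taylorCoeff_inv_linear n
  have ha' : AnalyticAt ℂ (fun p : ℂ => (p - 2) ^ 2 * (1 / (4 * (2 * p - 1)))) 2 :=
    ((analyticAt_id.sub analyticAt_const).pow 2).mul ha
  have h := taylorCoeff_eq_zero_of_isBigO (n := n + 2) (C := 3) (ha'.sub hs) (by
    filter_upwards [eventually_near_two (r := 1 / 20) (by norm_num)] with p hp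
    have h1 := norm_mean_sub_moments_le hp (n + 2)
    have h2 := contFractMean_eq hp
    have n1 : 2 * p - 1 ≠ 0 := by
      intro h
      rw [show p - 2 = -3 / 2 by linear_combination h / 2] at hp
      norm_num at hp
    have e : contFractMean p - (1 + 2 * ∑ k ∈ Finset.range (n + 2), moment (k + 1) p) =
        2 * ((p - 2) ^ 2 * (1 / (4 * (2 * p - 1))) -
          ∑ k ∈ Finset.range (n + 2), moment (k + 1) p) := by
      have : contFractMean p = (p ^ 2 + 2) / (2 * (2 * p - 1)) := by
        rw [eq_div_iff (mul_ne_zero two_ne_zero n1)]; linear_combination h2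
      have e0 : (p ^ 2 + 2) / (2 * (2 * p - 1)) =
          1 + 2 * ((p - 2) ^ 2 * (1 / (4 * (2 * p - 1)))) := by
        rw [mul_one_div, mul_div_assoc', one_add_div (mul_ne_zero (by norm_num : (4 : ℂ) ≠ 0) n1),
          div_eq_div_iff (mul_ne_zero two_ne_zero n1) (mul_ne_zero (by norm_num : (4 : ℂ) ≠ 0) n1)]
        ring
      rw [this, e0]; ring
    rw [e, norm_mul, Complex.norm_ofNat] at h1
    have h3 : (0 : ℝ) ≤ ‖p - 2‖ ^ (n + 2 + 1) := by positivity
    refine le_trans ?_ h1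
    have := norm_nonneg ((p - 2) ^ 2 * (1 / (4 * (2 * p - 1))) -
          ∑ k ∈ Finset.range (n + 2), moment (k + 1) p)
    change ‖(p - 2) ^ 2 * (1 / (4 * (2 * p - 1))) -
          ∑ k ∈ Finset.range (n + 2), moment (k + 1) p‖ ≤ _
    linarith)
  have h2 := taylorCoeff_sub ha' hs (n + 2)
  rw [taylorCoeff_sum _ han, taylorCoeff_pow_mul ha, if_pos (by omega), Nat.add_sub_cancel,
    hc] at h2
  exact (sub_eq_zero.1 (h2.symm.trans h)).symm

theorem periodPoly_coeff_ne_zero (n : ℕ) : (periodPoly (n + 2)).coeff (n + 1) ≠ 0 := by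
  rw [periodPoly_coeff, sum_momentCoeff]
  refine mul_ne_zero (by norm_num) (mul_ne_zero (by norm_num) (pow_ne_zero _ (by norm_num)))

/-! ### The three term functional equation -/

theorem mem_den_ne_zero {z p X : ℂ} (hz : z ≠ 2) (hp : NearTwo z p) (hX : X ∈ cayleyNear p) :
    X + 1 - z ≠ 0 := by
  have hpos : 0 < ‖z - 2‖ := norm_pos_iff.2 (sub_ne_zero.2 hz)
  have h1 := periodKernel_den hp.1 hp.2 hX.2
  intro h
  have e : 2 - z + z * cayley X = 0 := by
    have := hX.1.1
    rw [show z = X + 1 by linear_combination -h, cayley]; field_simp; ring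
  rw [e, norm_zero] at h1
  linarith

/-- Self-similarity applied to the kernel at `z + 1`. The first map gives `p G(p, pz)` directly; for
the second one, the kernel is affine in the kernel of `X⁻¹` at `p / z`, and the symmetry of the
distribution replaces `X⁻¹` by `X`. -/
theorem pPeriod_funEq {z p : ℂ} (hz0 : z ≠ 0) (h1 : z + 1 ≠ 2) (h1' : NearTwo (z + 1) p)
    (h3 : p / z ≠ 2) (h3' : NearTwo (p / z) p) :
    2 * pPeriod p (z + 1) - p * pPeriod p (p * z) + 1 / z + p / z ^ 2 * pPeriod p (p / z) = 0 := by
  have hp := h1'.1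
  have hp0 := ne_zero_of_near_two hp
  have hR : Measurable fun X : ℂ => 1 / (X + 1 - (z + 1)) := measurable_one_div_add_one_sub _
  have h := (isSelfSimilar_pContFract hp).integral_step hR (C := 4 / ‖z + 1 - 2‖) fun X hX => by
    rw [periodKernel_cayley hX.1.1]
    exact norm_periodKernel_le hp h1 h1'.2 hX.2
  have e1 : ∫ x, 1 / (stepF p (pContFract p x) + 1 - (z + 1)) ∂questionMarkMeasure =
      p * pPeriod p (p * z) := by
    rw [pPeriod, questionMarkMeasure_restrict, ← integral_const_mul]
    refine integral_congr_ae (Eventually.of_forall fun x => ?_)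
    change 1 / (stepF p (pContFract p x) + 1 - (z + 1)) = p * (1 / (pContFract p x + 1 - p * z))
    rw [show stepF p (pContFract p x) + 1 - (z + 1) = (pContFract p x + 1 - p * z) / p by
      rw [stepF]; field_simp; ring]
    rw [one_div_div, mul_one_div]
  have e2 : ∫ x, 1 / (stepG p (pContFract p x) + 1 - (z + 1)) ∂questionMarkMeasure =
      -1 / z - p / z ^ 2 * pPeriod p (p / z) := by
    have hneg := integral_cayley_neg hp (measurable_periodKernel (p / z))
      (L := 8 / ‖p / z - 2‖ ^ 2) (by positivity)
      fun v w hv hw => periodKernel_lipschitz hp h3 h3'.2 hv hw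
    have hi : Integrable (fun x => p / z ^ 2 * periodKernel (p / z) (-cayley (pContFract p x)))
        questionMarkMeasure := by
      refine Integrable.const_mul ?_ _
      refine (isSelfSimilar_pContFract hp).integrable
        (R := fun X => periodKernel (p / z) (-cayley X)) (C := 4 / ‖p / z - 2‖)
        ((measurable_periodKernel _).comp measurable_cayley.neg) fun X hX => ?_
      exact norm_periodKernel_le hp h3 h3'.2 (by rw [norm_neg]; exact hX.2)
    rw [pPeriod_eq_integral_kernel hp, ← hneg, ← integral_const_mul]
    have e3 : -1 / z = ∫ _, -1 / z ∂questionMarkMeasure := by simp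
    rw [e3, ← integral_sub (integrable_const _) hi]
    refine integral_congr_ae (Eventually.of_forall fun x => ?_)
    have hX := pContFract_mem hp x
    have hX0 := ne_zero_of_mem_cayleyDisc hX.1
    have hY := inv_mem_cayleyNear hX
    have hYd := mem_den_ne_zero h3 h3' hY
    change 1 / (stepG p (pContFract p x) + 1 - (z + 1)) =
      -1 / z - p / z ^ 2 * periodKernel (p / z) (-cayley (pContFract p x))
    rw [← cayley_inv hX0, ← periodKernel_cayley hY.1.1]
    generalize pContFract p x = X at *
    have hX1 : 1 + X ≠ 0 := by rw [add_comm]; exact hX.1.1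
    have ed : stepG p X + 1 - (z + 1) = -z * X * (X⁻¹ + 1 - p / z) / (1 + X) := by
      rw [stepG]; field_simp; ring
    rw [ed]
    generalize hD : X⁻¹ + 1 - p / z = D at *
    have hpz : p / z = X⁻¹ + 1 - D := by rw [← hD]; ring
    rw [sq, ← div_div, hpz]
    field_simp
    ring
  rw [e1, e2, Complex.real_smul] at h
  have h' : pPeriod p (z + 1) =
      ∫ x, 1 / (pContFract p x + 1 - (z + 1)) ∂questionMarkMeasure := by
    rw [pPeriod, questionMarkMeasure_restrict]
  rw [h', h]
  push_cast
  ring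

/-- The left hand side of the functional equation, for an arbitrary sequence of functions. -/
noncomputable def coeffSum (H : ℕ → ℂ → ℂ) (n : ℕ) (w u : ℂ) : ℂ :=
  ∑ j ∈ Finset.Icc 1 n, 2 / (j.factorial : ℂ) * iteratedDeriv j (H (n - j)) w * u ^ j +
    ∑ j ∈ Finset.range n,
      1 / (j.factorial : ℂ) * iteratedDeriv j (H (n - 1 - j)) w * u ^ j

theorem tendsto_sub_two_mul (u : ℂ) : Tendsto (fun p : ℂ => (p - 2) * u) (𝓝 2) (𝓝 0) := by
  have : ContinuousAt (fun p : ℂ => (p - 2) * u) 2 := by fun_prop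
  simpa [ContinuousAt] using this

theorem taylorCoeff_comp_mul {f : ℂ → ℂ} {u : ℂ} (hf : AnalyticAt ℂ f (2 * u)) :
    AnalyticAt ℂ (fun p => f (p * u)) 2 ∧ ∀ j, taylorCoeff j (fun p => f (p * u)) =
      iteratedDeriv j f (2 * u) / j.factorial * u ^ j := by
  refine analyticAt_of_hasSum ?_
  have h := hasFPowerSeriesAt_iff.1 hf.hasFPowerSeriesAt
  filter_upwards [(tendsto_sub_two_mul u).eventually h] with p hp
  rw [show 2 * u + (p - 2) * u = p * u by ring] at hp
  refine Eq.mp (congrArg (fun s => HasSum s _) (funext fun n => ?_)) hp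
  rw [FormalMultilinearSeries.coeff_ofScalars, smul_eq_mul, mul_pow]
  ring

theorem taylorCoeff_expansion {H : ℕ → ℂ → ℂ} {u : ℂ} (hH : ∀ m, AnalyticAt ℂ (H m) (2 * u))
    (K : ℕ) : AnalyticAt ℂ (fun p => ∑ m ∈ Finset.range K, H m (p * u) * (p - 2) ^ m) 2 ∧
      ∀ n, n < K → taylorCoeff n (fun p => ∑ m ∈ Finset.range K, H m (p * u) * (p - 2) ^ m) =
        ∑ j ∈ Finset.range (n + 1),
          iteratedDeriv j (H (n - j)) (2 * u) / j.factorial * u ^ j := by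
  have han : ∀ m ∈ Finset.range K, AnalyticAt ℂ (fun p => (p - 2) ^ m * H m (p * u)) 2 :=
    fun m _ => ((analyticAt_id.sub analyticAt_const).pow m).mul (taylorCoeff_comp_mul (hH m)).1
  simp only [mul_comm (H _ _)]
  refine ⟨Finset.analyticAt_fun_sum _ han, fun n hn => ?_⟩
  rw [taylorCoeff_sum _ han, ← Finset.sum_flip,
    ← Finset.sum_subset (Finset.range_subset_range.2 hn) (fun m _ hm => by
      rw [taylorCoeff_pow_mul (taylorCoeff_comp_mul (hH m)).1, if_neg (by simpa using hm)])]
  refine Finset.sum_congr rfl fun m hm => ?_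
  have hm : m ≤ n := by simpa [Nat.lt_succ_iff] using hm
  rw [taylorCoeff_pow_mul (taylorCoeff_comp_mul (hH m)).1, if_pos hm,
    (taylorCoeff_comp_mul (hH m)).2, Nat.sub_sub_self hm]

/-- Writing the factor `p` as `2 + (p - 2)` produces the two sums of the recurrence; the term `j =
0` of the first one is `2 H n (2u)`. -/
theorem taylorCoeff_mul_expansion {H : ℕ → ℂ → ℂ} {u : ℂ}
    (hH : ∀ m, AnalyticAt ℂ (H m) (2 * u)) {n : ℕ} (hn : 1 ≤ n) :
    AnalyticAt ℂ (fun p => p * ∑ m ∈ Finset.range (n + 1), H m (p * u) * (p - 2) ^ m) 2 ∧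
      taylorCoeff n (fun p => p * ∑ m ∈ Finset.range (n + 1), H m (p * u) * (p - 2) ^ m) =
        2 * H n (2 * u) + coeffSum H n (2 * u) u := by
  obtain ⟨ha, hc⟩ := taylorCoeff_expansion hH (n + 1)
  refine ⟨analyticAt_id.mul ha, ?_⟩
  have e : (fun p => p * ∑ m ∈ Finset.range (n + 1), H m (p * u) * (p - 2) ^ m) = fun p =>
      2 * (∑ m ∈ Finset.range (n + 1), H m (p * u) * (p - 2) ^ m) +
      (p - 2) ^ 1 * ∑ m ∈ Finset.range (n + 1), H m (p * u) * (p - 2) ^ m := by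
    funext p; ring
  have h1 : AnalyticAt ℂ (fun p => 2 * ∑ m ∈ Finset.range (n + 1),
      H m (p * u) * (p - 2) ^ m) 2 := analyticAt_const.mul ha
  have h2 : AnalyticAt ℂ (fun p => (p - 2) ^ 1 * ∑ m ∈ Finset.range (n + 1),
      H m (p * u) * (p - 2) ^ m) 2 := ((analyticAt_id.sub analyticAt_const).pow 1).mul ha
  rw [e, taylorCoeff_add h1 h2,
    taylorCoeff_const_mul ha, taylorCoeff_pow_mul ha, if_pos hn, hc n (by omega),
    hc (n - 1) (by omega), Nat.sub_add_cancel hn, Finset.sum_range_eq_add_Ico _ n.succ_pos,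
    coeffSum, mul_add, Finset.mul_sum, add_assoc]
  congr 1
  · simp
  · congr 1
    · refine Finset.sum_congr (by ext; simp) fun j _ => by ring
    · exact Finset.sum_congr rfl fun j _ => by ring

theorem analyticAt_periodCoeff (n : ℕ) {z : ℂ} (hz : z ≠ 2) : AnalyticAt ℂ (periodCoeff n) z := by
  refine AnalyticAt.div ((periodPoly n).differentiable.analyticAt z)
    ((analyticAt_id.sub analyticAt_const).pow _) (pow_ne_zero _ (sub_ne_zero.2 hz))

/-- The functional equation of the Taylor coefficients. -/
theorem periodCoeff_funEq {n : ℕ} (hn : 1 ≤ n) {z : ℂ} (hz0 : z ≠ 0) (hz1 : z ≠ 1) :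
    coeffSum periodCoeff n (2 * z) z - 1 / z ^ 2 * coeffSum periodCoeff n (2 / z) (1 / z) =
      2 * periodCoeff n (z + 1) - 2 * periodCoeff n (2 * z) +
        2 / z ^ 2 * periodCoeff n (2 / z) := by
  have a1 : z + 1 ≠ 2 := fun h => hz1 (by linear_combination h)
  have a2 : 2 * z ≠ 2 := fun h => hz1 (by linear_combination h / 2)
  have a3 : 2 * (1 / z) ≠ 2 := fun h => hz1 (by field_simp at h; exact h.symm)
  obtain ⟨b2, c2⟩ := taylorCoeff_mul_expansion (u := z)
    (fun m => analyticAt_periodCoeff m a2) hn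
  obtain ⟨b3, c3⟩ := taylorCoeff_mul_expansion (u := 1 / z)
    (fun m => analyticAt_periodCoeff m a3) hn
  have han : ∀ m ∈ Finset.range (n + 1),
      AnalyticAt ℂ (fun p : ℂ => periodCoeff m (z + 1) * (p - 2) ^ m) 2 := fun m _ =>
    analyticAt_const.mul ((analyticAt_id.sub analyticAt_const).pow m)
  have b1 := Finset.analyticAt_fun_sum (Finset.range (n + 1)) han
  have c1 : taylorCoeff n (fun p => ∑ m ∈ Finset.range (n + 1),
      periodCoeff m (z + 1) * (p - 2) ^ m) = periodCoeff n (z + 1) := by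
    rw [taylorCoeff_sum _ han]
    simp only [taylorCoeff_const_mul_pow]
    rw [Finset.sum_ite_eq, if_pos (by simp)]
  -- The arguments `pz` and `p / z` move with `p`, so the Taylor remainder has to be uniform: for
  -- `p` near `2` all arguments stay in norm below `M` and at distance at least `d` from the pole
  -- `2`.
  obtain ⟨d, hd0, hd1, hd2, hd3⟩ : ∃ d : ℝ, 0 < d ∧ d ≤ ‖z + 1 - 2‖ ∧ 2 * d ≤ ‖2 * z - 2‖ ∧
      2 * d ≤ ‖2 * (1 / z) - 2‖ := by
    have p1 : 0 < ‖z + 1 - 2‖ := norm_pos_iff.2 (sub_ne_zero.2 a1)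
    have p2 : 0 < ‖2 * z - 2‖ := norm_pos_iff.2 (sub_ne_zero.2 a2)
    have p3 : 0 < ‖2 * (1 / z) - 2‖ := norm_pos_iff.2 (sub_ne_zero.2 a3)
    refine ⟨min ‖z + 1 - 2‖ (min (‖2 * z - 2‖ / 2) (‖2 * (1 / z) - 2‖ / 2)),
      lt_min p1 (lt_min (by positivity) (by positivity)), min_le_left _ _, ?_, ?_⟩
    · have := (min_le_right ‖z + 1 - 2‖ _).trans
        (min_le_left (‖2 * z - 2‖ / 2) (‖2 * (1 / z) - 2‖ / 2))
      linarith
    · have := (min_le_right ‖z + 1 - 2‖ _).trans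
        (min_le_right (‖2 * z - 2‖ / 2) (‖2 * (1 / z) - 2‖ / 2))
      linarith
  set M : ℝ := max ‖z + 1‖ (max (3 * ‖z‖) (3 * ‖1 / z‖)) with hM
  have hM1 : ‖z + 1‖ ≤ M := le_max_left _ _
  have hM2 : 3 * ‖z‖ ≤ M := (le_max_left _ _).trans (le_max_right _ _)
  have hM3 : 3 * ‖1 / z‖ ≤ M := (le_max_right _ _).trans (le_max_right _ _)
  obtain ⟨K, hK0, hK⟩ := pPeriod_remainder n (M := M) hd0
  set T : ℂ → ℂ → ℂ := fun p w => ∑ m ∈ Finset.range (n + 1), periodCoeff m w * (p - 2) ^ m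
    with hT
  have q1 : AnalyticAt ℂ (fun p => 2 * T p (z + 1)) 2 := analyticAt_const.mul b1
  have q2 : AnalyticAt ℂ (fun p => 2 * T p (z + 1) - p * T p (p * z)) 2 := q1.sub b2
  have q3 : AnalyticAt ℂ (fun p => 2 * T p (z + 1) - p * T p (p * z) + 1 / z) 2 :=
    q2.add analyticAt_const
  have q4 : AnalyticAt ℂ (fun p => 1 / z ^ 2 * (p * T p (p * (1 / z)))) 2 :=
    analyticAt_const.mul b3
  have hD : AnalyticAt ℂ (fun p => 2 * T p (z + 1) - p * T p (p * z) + 1 / z +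
      1 / z ^ 2 * (p * T p (p * (1 / z)))) 2 := q3.add q4
  have hz2 : 0 < ‖z‖ := norm_pos_iff.2 hz0
  have hzi : 0 < ‖1 / z‖ := norm_pos_iff.2 (one_div_ne_zero hz0)
  have h0 := taylorCoeff_eq_zero_of_isBigO (n := n)
    (C := 2 * K + 3 * K + ‖1 / z ^ 2‖ * (3 * K)) hD (by
    filter_upwards [hK, eventually_near_two (r := 1 / 20) (by norm_num),
      eventually_near_two (r := d / 6) (by positivity),
      eventually_near_two (r := d / ‖z‖) (by positivity),
      eventually_near_two (r := d / ‖1 / z‖) (by positivity)] with p hp h1 h2 h3 h4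
    have hpn := norm_le_of_near_two h1
    have near : ∀ u : ℂ, 0 < ‖u‖ → 2 * d ≤ ‖2 * u - 2‖ → ‖p - 2‖ ≤ d / ‖u‖ →
        d ≤ ‖p * u - 2‖ := by
      intro u hu hu2 hu3
      rw [le_div_iff₀ hu, ← norm_mul] at hu3
      have := norm_sub_le (p * u - 2) ((p - 2) * u)
      rw [show p * u - 2 - (p - 2) * u = 2 * u - 2 by ring] at this
      linarith
    have n2 := near z hz2 hd2 h3
    have n3 := near (1 / z) hzi hd3 h4
    have r1 := hp (z + 1) hM1 hd1
    have r2 := hp (p * z) (by rw [norm_mul]; nlinarith) n2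
    have r3 := hp (p * (1 / z)) (by rw [norm_mul]; nlinarith) n3
    have hfe := pPeriod_funEq (p := p) hz0 a1 ⟨h1, by linarith⟩
      (by rw [div_eq_mul_one_div]; intro h; rw [h, sub_self, norm_zero] at n3; linarith)
      ⟨h1, by rw [div_eq_mul_one_div]; linarith⟩
    rw [div_eq_mul_one_div p z] at hfe
    -- By the exact functional equation, the same combination of Taylor polynomials is a combination
    -- of remainders, hence of order `n + 1` in `p - 2`.
    have e : 2 * T p (z + 1) - p * T p (p * z) + 1 / z + 1 / z ^ 2 * (p * T p (p * (1 / z))) =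
        -(2 * (pPeriod p (z + 1) - T p (z + 1))) + p * (pPeriod p (p * z) - T p (p * z)) +
          -(1 / z ^ 2 * (p * (pPeriod p (p * (1 / z)) - T p (p * (1 / z))))) := by
      linear_combination hfe
    rw [e]
    refine (norm_add₃_le).trans ?_
    rw [norm_neg, norm_neg, norm_mul, norm_mul, norm_mul, norm_mul, Complex.norm_ofNat]
    have hpn' : ‖p‖ ≤ 3 := by linarith
    calc _ ≤ 2 * (K * ‖p - 2‖ ^ (n + 1)) + 3 * (K * ‖p - 2‖ ^ (n + 1)) +
          ‖1 / z ^ 2‖ * (3 * (K * ‖p - 2‖ ^ (n + 1))) := by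
          gcongr
      _ = _ := by ring)
  rw [taylorCoeff_add q3 q4, taylorCoeff_add q2 analyticAt_const, taylorCoeff_sub q1 b2,
    taylorCoeff_const_mul b1, taylorCoeff_const_mul b3, c1, c2, c3, taylorCoeff_const,
    if_neg (by omega)] at h0
  rw [mul_one_div] at h0
  linear_combination -h0

/-! ### Uniqueness and rationality of the polynomials -/

/-- The value is `1` for even `e` and `1 - 2 / 2 ^ e` for odd `e`; the latter vanishes only for `e =
1`. -/
theorem one_sub_inv_pow_add_ne_zero {e : ℕ} (he : 2 ≤ e) :
    (1 : ℂ) - 1 / 2 ^ e + 1 / (-2) ^ e ≠ 0 := by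
  rcases Nat.even_or_odd e with h | h
  · rw [h.neg_pow]; norm_num
  · rw [h.neg_pow, one_div_neg_eq_neg_one_div]
    intro h'
    have h2 : (2 : ℂ) ^ e ≠ 0 := pow_ne_zero _ two_ne_zero
    field_simp at h'
    have h3 : (2 : ℂ) ^ e = ((2 : ℕ) : ℂ) := by push_cast; linear_combination h'
    have h4 : 2 ^ e = 2 := by exact_mod_cast h3
    have h5 := Nat.pow_le_pow_right two_pos he
    omega

/-- All three arguments tend to `2` as `q → 1`. Comparing leading terms of the poles there gives the
nonzero factor of `one_sub_inv_pow_add_ne_zero`; the degree bound makes the pole order at least `2`.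
Rational `q` suffice, which is what the descent to `ℚ` requires. -/
theorem homogeneous_funEq_unique {n : ℕ} {D : ℂ[X]} (hdeg : D.degree < n)
    (h : ∀ q : ℚ, q ≠ 0 → q ≠ 1 →
      D.eval ((q : ℂ) + 1) / ((q : ℂ) + 1 - 2) ^ (n + 1) -
        D.eval (2 * (q : ℂ)) / (2 * (q : ℂ) - 2) ^ (n + 1) +
        1 / (q : ℂ) ^ 2 * (D.eval (2 / (q : ℂ)) / (2 / (q : ℂ) - 2) ^ (n + 1)) = 0) : D = 0 := by
  by_contra hD
  obtain ⟨S, hS, hS2⟩ := exists_eq_pow_rootMultiplicity_mul_and_not_dvd D hD 2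
  set j := D.rootMultiplicity 2 with hj
  have hS2 : S.eval 2 ≠ 0 := fun h0 => hS2 (dvd_iff_isRoot.2 h0)
  have hS0 : S ≠ 0 := by rintro rfl; simp at hS2
  have hjn : j + 1 ≤ n := by
    rw [hS, degree_mul, degree_pow, degree_X_sub_C, degree_eq_natDegree hS0] at hdeg
    have : ((j + S.natDegree : ℕ) : WithBot ℕ) < n := by simpa using hdeg
    have : j + S.natDegree < n := by exact_mod_cast this
    omega
  obtain ⟨e, he⟩ : ∃ e, n + 1 = j + (e + 2) := ⟨n - 1 - j, by omega⟩
  have hH : ∀ w : ℂ, w ≠ 2 → D.eval w / (w - 2) ^ (n + 1) = S.eval w / (w - 2) ^ (e + 2) := by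
    intro w hw
    have hw : w - 2 ≠ 0 := sub_ne_zero.2 hw
    rw [hS, he, eval_mul, eval_pow, eval_sub, eval_X, eval_C, pow_add,
      mul_div_mul_left _ _ (pow_ne_zero _ hw)]
  -- The homogeneous equation at `q = 1 + x`, multiplied by `x ^ (e + 2)`; it extends continuously
  -- to `x = 0`.
  set Φ : ℂ → ℂ := fun x => S.eval (2 + x) - S.eval (2 + 2 * x) / 2 ^ (e + 2) +
    (1 + x) ^ e * S.eval (2 / (1 + x)) / (-2) ^ (e + 2) with hΦ
  have hzero : ∀ m : ℕ, Φ (1 / ((m : ℂ) + 1)) = 0 := by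
    intro m
    have hm : (m : ℂ) + 1 ≠ 0 := Nat.cast_add_one_ne_zero m
    obtain ⟨x, hx⟩ : ∃ x : ℂ, x = 1 / ((m : ℂ) + 1) := ⟨_, rfl⟩
    have hx0 : x ≠ 0 := hx ▸ one_div_ne_zero hm
    have hq := h (1 + 1 / ((m : ℚ) + 1)) (by positivity) (by
      rw [Ne, add_eq_left]; positivity)
    have hxq : ((1 + 1 / ((m : ℚ) + 1) : ℚ) : ℂ) = 1 + x := by rw [hx]; push_cast; rfl
    have hx1 : 1 + x ≠ 0 := by
      rw [← hxq]; exact_mod_cast (by positivity : (1 + 1 / ((m : ℚ) + 1)) ≠ 0)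
    have w1 : 1 + x + 1 - 2 = x := by ring
    have w2 : 2 * (1 + x) - 2 = 2 * x := by ring
    have w3 : 2 / (1 + x) - 2 = -2 * x / (1 + x) := by field_simp; ring
    have n1 : 1 + x + 1 ≠ 2 := sub_ne_zero.1 (by rw [w1]; exact hx0)
    have n2 : 2 * (1 + x) ≠ 2 := sub_ne_zero.1 (by rw [w2]; exact mul_ne_zero two_ne_zero hx0)
    have n3 : 2 / (1 + x) ≠ 2 := sub_ne_zero.1 (by
      rw [w3]; exact div_ne_zero (mul_ne_zero (by norm_num) hx0) hx1)
    rw [hxq, hH _ n1, hH _ n2, hH _ n3, w1, w2, w3, div_pow (-2 * x), mul_pow, mul_pow,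
      show 1 + x + 1 = 2 + x by ring, show 2 * (1 + x) = 2 + 2 * x by ring] at hq
    have hxe : x ^ (e + 2) ≠ 0 := pow_ne_zero _ hx0
    have h2e : (2 : ℂ) ^ (e + 2) ≠ 0 := pow_ne_zero _ two_ne_zero
    have h2e' : (-2 : ℂ) ^ (e + 2) ≠ 0 := pow_ne_zero _ (by norm_num)
    have : Φ x = x ^ (e + 2) * (eval (2 + x) S / x ^ (e + 2) -
        eval (2 + 2 * x) S / (2 ^ (e + 2) * x ^ (e + 2)) + 1 / (1 + x) ^ 2 *
        (eval (2 / (1 + x)) S / ((-2) ^ (e + 2) * x ^ (e + 2) / (1 + x) ^ (e + 2)))) := by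
      rw [hΦ]
      generalize (-2 : ℂ) ^ (e + 2) = a at *
      generalize (2 : ℂ) ^ (e + 2) = b at *
      generalize x ^ (e + 2) = c at *
      rw [pow_add]
      field_simp
    rw [← hx, this, hq, mul_zero]
  have hcont : ContinuousAt Φ 0 := by
    have hS' : Continuous fun w => S.eval w := S.continuous
    have h1 : ContinuousAt (fun x : ℂ => S.eval (2 / (1 + x))) 0 :=
      hS'.continuousAt.comp (continuousAt_const.div (by fun_prop) (by norm_num))
    rw [hΦ]
    refine ContinuousAt.add (ContinuousAt.sub ?_ ?_) ?_
    · exact (hS'.comp (continuous_const.add continuous_id)).continuousAt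
    · exact ((hS'.comp (continuous_const.add
        (continuous_const.mul continuous_id))).div_const _).continuousAt
    · exact (ContinuousAt.mul (by fun_prop) h1).div_const _
  have hlim : Tendsto (fun m : ℕ => (1 : ℂ) / ((m : ℂ) + 1)) atTop (𝓝 0) :=
    tendsto_one_div_add_atTop_nhds_zero_nat
  have h0 : Φ 0 = 0 := tendsto_nhds_unique (hcont.tendsto.comp hlim)
    (tendsto_const_nhds.congr fun m => (hzero m).symm)
  have h1 : Φ 0 = S.eval 2 * (1 - 1 / 2 ^ (e + 2) + 1 / (-2) ^ (e + 2)) := by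
    simp only [hΦ]
    rw [mul_zero, add_zero, add_zero, div_one, one_pow]
    ring
  rw [h0] at h1
  exact mul_ne_zero hS2 (one_sub_inv_pow_add_ne_zero (by omega)) h1.symm

theorem coeffSum_congr {H H' : ℕ → ℂ → ℂ} {n : ℕ} (h : ∀ m, m < n → H m = H' m) (w u : ℂ) :
    coeffSum H n w u = coeffSum H' n w u := by
  unfold coeffSum
  congr 1
  · refine Finset.sum_congr rfl fun j hj => ?_
    rw [h (n - j) (by have := Finset.mem_Icc.1 hj; omega)]
  · refine Finset.sum_congr rfl fun j hj => ?_
    rw [h (n - 1 - j) (by have := Finset.mem_range.1 hj; omega)]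

theorem iteratedDeriv_rational (P : ℚ[X]) (m j : ℕ) : ∃ Q : ℚ[X], ∀ w : ℂ, w ≠ 2 →
    iteratedDeriv j (fun z : ℂ => aeval z P / (z - 2) ^ (m + 1)) w =
      aeval w Q / (w - 2) ^ (m + j + 1) := by
  induction j with
  | zero => exact ⟨P, fun w _ => by simp⟩
  | succ j ih =>
    obtain ⟨Q, hQ⟩ := ih
    refine ⟨derivative Q * (X - 2) - C ((m + j + 1 : ℕ) : ℚ) * Q, fun w hw => ?_⟩
    have hw' : w - 2 ≠ 0 := sub_ne_zero.2 hw
    have h1 : iteratedDeriv j (fun z : ℂ => aeval z P / (z - 2) ^ (m + 1)) =ᶠ[𝓝 w]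
        fun z => aeval z Q / (z - 2) ^ (m + j + 1) := by
      filter_upwards [isOpen_ne.mem_nhds hw] with z hz using hQ z hz
    rw [iteratedDeriv_succ, h1.deriv_eq]
    have h2 : HasDerivAt (fun z : ℂ => (z - 2) ^ (m + j + 1))
        (((m + j + 1 : ℕ) : ℂ) * (w - 2) ^ (m + j) * 1) w :=
      ((hasDerivAt_id w).sub_const 2).pow (m + j + 1)
    have h3 : HasDerivAt (fun z : ℂ => aeval z Q / (z - 2) ^ (m + j + 1)) _ w :=
      (Q.hasDerivAt_aeval w).div h2 (pow_ne_zero _ hw')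
    rw [h3.deriv]
    simp only [map_sub, map_mul, aeval_X, map_ofNat, map_natCast]
    rw [show m + (j + 1) + 1 = m + j + 2 by ring, pow_succ _ (m + j)]
    field_simp
    ring

theorem ratH_iteratedDeriv_mem (B : ℕ → ℚ[X]) (m j : ℕ) {w : ℚ} (hw : w ≠ 2) :
    iteratedDeriv j (ratH B m) (w : ℂ) ∈ (algebraMap ℚ ℂ).fieldRange := by
  obtain ⟨Q, hQ⟩ := iteratedDeriv_rational (B m) m j
  have h := hQ w (by exact_mod_cast hw)
  change iteratedDeriv j (fun z : ℂ => aeval z (B m) / (z - 2) ^ (m + 1)) (w : ℂ) ∈ _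
  rw [h]
  refine ⟨Q.eval w / (w - 2) ^ (m + j + 1), ?_⟩
  have : aeval (w : ℂ) Q = ((Q.eval w : ℚ) : ℂ) := by
    have := aeval_algebraMap_apply ℂ w Q
    simpa using this
  rw [this]
  simp

theorem coeffSum_ratH_mem (B : ℕ → ℚ[X]) (n : ℕ) {w : ℚ} (hw : w ≠ 2) (u : ℚ) :
    coeffSum (ratH B) n (w : ℂ) (u : ℂ) ∈ (algebraMap ℚ ℂ).fieldRange := by
  have hu : (u : ℂ) ∈ (algebraMap ℚ ℂ).fieldRange := ⟨u, by simp⟩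
  refine add_mem (sum_mem fun j _ => ?_) (sum_mem fun j _ => ?_)
  · exact mul_mem (mul_mem (div_mem (ofNat_mem _ 2) (natCast_mem _ _))
      (ratH_iteratedDeriv_mem B _ _ hw)) (pow_mem hu _)
  · exact mul_mem (mul_mem (div_mem (one_mem _) (natCast_mem _ _))
      (ratH_iteratedDeriv_mem B _ _ hw)) (pow_mem hu _)

/-- A `ℚ`-linear left inverse of the inclusion. It commutes with evaluation at rational points, so
it maps solutions of a linear equation with rational data to rational solutions. -/
theorem exists_rational_projection : ∃ π : ℂ →ₗ[ℚ] ℚ, ∀ q : ℚ, π (q : ℂ) = q := by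
  obtain ⟨g, hg⟩ := LinearMap.exists_leftInverse_of_injective (Algebra.linearMap ℚ ℂ)
    (LinearMap.ker_eq_bot.2 (algebraMap ℚ ℂ).injective)
  exact ⟨g, fun q => by simpa using LinearMap.congr_fun hg q⟩

theorem projection_eval {π : ℂ →ₗ[ℚ] ℚ} {n : ℕ} {D : ℂ[X]} (hD : D.degree < n) (q : ℚ) :
    π (D.eval (q : ℂ)) = (∑ i ∈ Finset.range n, C (π (D.coeff i)) * X ^ i : ℚ[X]).eval q := by
  have hD' : ∀ i, n ≤ i → D.coeff i = 0 := fun i hi =>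
    coeff_eq_zero_of_degree_lt (hD.trans_le (by exact_mod_cast hi))
  have e : D.eval (q : ℂ) = ∑ i ∈ Finset.range n, (q ^ i : ℚ) • D.coeff i := by
    rw [eval_eq_sum_range' (n := max n (D.natDegree + 1)) (by omega),
      ← Finset.sum_subset (Finset.range_subset_range.2 (le_max_left n _)) (fun i _ hi => by
        rw [hD' i (by simpa using hi), zero_mul])]
    refine Finset.sum_congr rfl fun i _ => ?_
    rw [Rat.smul_def]; push_cast; ring
  rw [e, map_sum, eval_finsetSum]
  refine Finset.sum_congr rfl fun i _ => ?_
  rw [map_smul, eval_mul, eval_C, eval_pow, eval_X, smul_eq_mul, mul_comm]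

theorem aeval_ratCast (Q : ℚ[X]) (q : ℚ) : aeval (q : ℂ) Q = ((Q.eval q : ℚ) : ℂ) := by
  have := aeval_algebraMap_apply ℂ q Q
  simpa using this

/-- At a rational `q` the left-hand side of the functional equation is rational by induction.
Projecting the coefficients of `periodPoly n` to `ℚ` gives a second solution with the same degree
bound, and the difference solves the homogeneous equation. -/
theorem periodPoly_rational (n : ℕ) : ∃ Q : ℚ[X], Q.map (algebraMap ℚ ℂ) = periodPoly n := by
  induction n using Nat.strong_induction_on with
  | _ n ih =>
    rcases Nat.eq_zero_or_pos n with rfl | hn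
    · exact ⟨-1, by simp [periodPoly]⟩
    -- The value `0` chosen for `m ≥ n` is immaterial: the left-hand side involves only indices
    -- below `n`.
    have : ∀ m, ∃ Q : ℚ[X], m < n → Q.map (algebraMap ℚ ℂ) = periodPoly m := fun m => by
      by_cases hm : m < n
      · obtain ⟨Q, hQ⟩ := ih m hm
        exact ⟨Q, fun _ => hQ⟩
      · exact ⟨0, fun h => absurd h hm⟩
    choose B hB using this
    have hH : ∀ m, m < n → periodCoeff m = ratH B m := by
      intro m hm
      funext z
      rw [periodCoeff, ratH, ← hB m hm, eval_map_algebraMap]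
    obtain ⟨π, hπ⟩ := exists_rational_projection
    have hdeg := periodPoly_degree_lt hn
    set Q : ℚ[X] := ∑ i ∈ Finset.range n, C (π ((periodPoly n).coeff i)) * X ^ i with hQ
    have hQdeg : Q.degree < n := by
      refine (degree_sum_le _ _).trans_lt ?_
      rw [Finset.sup_lt_iff (by exact WithBot.bot_lt_coe _)]
      intro k hk
      refine (degree_C_mul_X_pow_le _ _).trans_lt ?_
      exact_mod_cast Finset.mem_range.1 hk
    refine ⟨Q, ?_⟩
    refine (sub_eq_zero.1 (homogeneous_funEq_unique (n := n)
      (D := periodPoly n - Q.map (algebraMap ℚ ℂ)) ?_ ?_)).symm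
    · refine (degree_sub_le _ _).trans_lt (max_lt hdeg ?_)
      rwa [degree_map]
    intro q hq0 hq1
    have hq0' : (q : ℂ) ≠ 0 := by exact_mod_cast hq0
    have hq1' : (q : ℂ) ≠ 1 := by exact_mod_cast hq1
    have hfe := periodCoeff_funEq hn hq0' hq1'
    have hrat : coeffSum periodCoeff n (2 * q : ℂ) q -
        1 / (q : ℂ) ^ 2 * coeffSum periodCoeff n (2 / q : ℂ) (1 / q) ∈
          (algebraMap ℚ ℂ).fieldRange := by
      rw [coeffSum_congr hH, coeffSum_congr hH]
      have m1 := coeffSum_ratH_mem B n (w := 2 * q) (fun h => hq1 (by linarith)) q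
      have m2 := coeffSum_ratH_mem B n (w := 2 / q)
        (fun h => hq1 (by field_simp at h; exact h.symm)) (1 / q)
      push_cast at m1 m2
      have hqm : (q : ℂ) ∈ (algebraMap ℚ ℂ).fieldRange := ⟨q, by simp⟩
      exact sub_mem m1 (mul_mem (div_mem (one_mem _) (pow_mem hqm _)) m2)
    obtain ⟨r, hr⟩ := hrat
    rw [hfe] at hr
    have key : ∀ (a b : ℚ), (π ((a : ℂ) * (periodCoeff n (b : ℂ))) : ℂ) =
        a * (Q.eval b / (b - 2) ^ (n + 1) : ℚ) := by
      intro a b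
      have e : (a : ℂ) * periodCoeff n (b : ℂ) =
          (a * ((b - 2) ^ (n + 1))⁻¹ : ℚ) • (periodPoly n).eval (b : ℂ) := by
        rw [Rat.smul_def, periodCoeff]; push_cast; ring
      rw [e, map_smul, projection_eval hdeg, ← hQ, smul_eq_mul]
      push_cast; ring
    have hπr : (π ((r : ℚ) : ℂ) : ℂ) = (r : ℂ) := by rw [hπ]
    have e : ((r : ℚ) : ℂ) = ((2 : ℚ) : ℂ) * periodCoeff n ((q + 1 : ℚ) : ℂ) -
        ((2 : ℚ) : ℂ) * periodCoeff n ((2 * q : ℚ) : ℂ) +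
        ((2 / q ^ 2 : ℚ) : ℂ) * periodCoeff n ((2 / q : ℚ) : ℂ) := by
      push_cast; exact hr
    have h2 := hπr
    rw [e, map_add, map_sub, Rat.cast_add, Rat.cast_sub, key, key, key] at h2
    push_cast at h2
    simp only [eval_sub, eval_map_algebraMap]
    have a1 : aeval ((q : ℂ) + 1) Q = ((Q.eval (q + 1) : ℚ) : ℂ) := by
      rw [← aeval_ratCast]; push_cast; rfl
    have a2 : aeval (2 * (q : ℂ)) Q = ((Q.eval (2 * q) : ℚ) : ℂ) := by
      rw [← aeval_ratCast]; push_cast; rfl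
    have a3 : aeval (2 / (q : ℂ)) Q = ((Q.eval (2 / q) : ℚ) : ℂ) := by
      rw [← aeval_ratCast]; push_cast; rfl
    rw [a1, a2, a3]
    simp only [periodCoeff] at h2
    linear_combination -h2 / 2

theorem isRatHRecurrence_of_map_eq {B : ℕ → ℚ[X]}
    (hB : ∀ n, (B n).map (algebraMap ℚ ℂ) = periodPoly n) :
    IsRatHRecurrence B ∧ ∀ n z, ratH B n z = periodCoeff n z := by
  have hH : ∀ n z, ratH B n z = periodCoeff n z := fun n z => by
    rw [periodCoeff, ratH, ← hB n, eval_map_algebraMap]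
  refine ⟨⟨?_, ?_, ?_⟩, hH⟩
  · refine Polynomial.map_injective _ (algebraMap ℚ ℂ).injective ?_
    rw [hB]; simp [periodPoly]
  · intro n hn
    have := periodPoly_degree_lt hn
    rwa [← hB, degree_map] at this
  · intro n hn z hz0 hz1
    have hH' : ratH B = periodCoeff := by funext n z; exact hH n z
    rw [hH']
    change coeffSum (ratH B) n (2 * z) z - 1 / z ^ 2 * coeffSum (ratH B) n (2 / z) (1 / z) = _
    rw [hH']
    exact periodCoeff_funEq hn hz0 hz1

/-- By induction the left-hand sides agree, so the difference of the two numerators solves the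
homogeneous equation. -/
theorem IsRatHRecurrence.unique {B B' : ℕ → ℚ[X]} (hB : IsRatHRecurrence B)
    (hB' : IsRatHRecurrence B') : B' = B := by
  funext n
  induction n using Nat.strong_induction_on with
  | _ n ih =>
    rcases Nat.eq_zero_or_pos n with rfl | hn
    · rw [hB.zero, hB'.zero]
    refine Polynomial.map_injective _ (algebraMap ℚ ℂ).injective ?_
    refine sub_eq_zero.1 (homogeneous_funEq_unique (n := n) ?_ ?_)
    · refine (degree_sub_le _ _).trans_lt (max_lt ?_ ?_)
      · rw [degree_map]; exact hB'.degree_lt n hn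
      · rw [degree_map]; exact hB.degree_lt n hn
    intro q hq0 hq1
    have hq0' : (q : ℂ) ≠ 0 := by exact_mod_cast hq0
    have hq1' : (q : ℂ) ≠ 1 := by exact_mod_cast hq1
    have h1 := hB.funEq n hn q hq0' hq1'
    have h2 := hB'.funEq n hn q hq0' hq1'
    have hH : ∀ m, m < n → ratH B' m = ratH B m := fun m hm => by
      funext z; rw [ratH, ratH, ih m hm]
    have e : ∀ w u, ratHSum B' n w u = ratHSum B n w u := fun w u => coeffSum_congr hH w u
    rw [e, e, h1] at h2
    simp only [eval_sub, eval_map_algebraMap]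
    simp only [ratH] at h2
    linear_combination -h2 / 2

/-! ### Summation of the Taylor series at `p = 1` -/

theorem ne_two_of_mem_periodRegion {z : ℂ} (hz : z ∈ periodRegion) : z ≠ 2 := by
  rintro rfl
  rcases hz with hz | hz
  · norm_num at hz
  · rw [show (2 : ℂ) + 9 / 7 = ((23 / 7 : ℝ) : ℂ) by push_cast; norm_num, Complex.norm_real] at hz
    norm_num at hz

/-- Cauchy estimate for the geometric convergence on a small disc around `2`. The factor `r ^ n` in
the denominator limits its use to `N` large compared with `n`. -/
theorem norm_taylorCoeff_sub_le {z : ℂ} (hz : z ≠ 2) : ∃ r C : ℝ, 0 < r ∧ r ≤ 1 ∧ 0 ≤ C ∧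
    ∀ N n : ℕ, ‖taylorCoeff n (fun p => wordPeriod N p z) - periodCoeff n z‖ ≤
      C * (21 / 25) ^ N / r ^ n := by
  obtain ⟨r, hr, h1, h2⟩ := exists_differentiableOn_pPeriod hz
  have hr1 : 0 < min (r / 2) 1 := lt_min (by positivity) one_pos
  refine ⟨min (r / 2) 1, 8 / ‖z - 2‖ ^ 2, hr1, min_le_right _ _, by positivity, fun N n => ?_⟩
  have hsub : Metric.closedBall (2 : ℂ) (min (r / 2) 1) ⊆ Metric.ball 2 r :=
    Metric.closedBall_subset_ball ((min_le_left _ _).trans_lt (by linarith))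
  have hnear : ∀ p ∈ Metric.closedBall (2 : ℂ) (min (r / 2) 1), NearTwo z p := fun p hp =>
    h1 p (Metric.ball_subset_closedBall (hsub hp))
  have hd : DifferentiableOn ℂ (fun p => wordPeriod N p z - pPeriod p z)
      (Metric.closedBall 2 (min (r / 2) 1)) := fun p hp =>
    ((analyticAt_wordPeriod hz (hnear p hp) N).differentiableAt.differentiableWithinAt).sub
      ((h2.mono hsub) p hp)
  have h2an : NearTwo z 2 := hnear 2 (Metric.mem_closedBall_self hr1.le)
  rw [← taylorCoeff_pPeriod hz, ← taylorCoeff_sub (analyticAt_wordPeriod hz h2an N)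
    (analyticAt_pPeriod hz)]
  refine norm_taylorCoeff_le hr1 (hd.diffContOnCl_ball subset_rfl) (fun p hp => ?_) n
  rw [norm_sub_rev]
  exact norm_pPeriod_sub_wordPeriod_le hz (hnear p (Metric.sphere_subset_closedBall hp)) N

theorem exists_pow_four_le : ∃ C : ℝ, 0 ≤ C ∧ ∀ L : ℕ, (L : ℝ) ^ 4 ≤ C * 2 ^ L := by
  obtain ⟨C, hC⟩ := (tendsto_pow_const_div_const_pow_of_one_lt 4
    (one_lt_two (α := ℝ))).bddAbove_range
  have h : ∀ L : ℕ, (L : ℝ) ^ 4 / 2 ^ L ≤ C := fun L => hC ⟨L, rfl⟩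
  refine ⟨C, le_trans (by positivity) (h 0), fun L => ?_⟩
  rw [← div_le_iff₀ (by positivity)]
  exact h L

/-- Bernoulli's inequality for exponent `n / 4`, raised to the fourth power. With `x` of order `(log
n)⁻²`, four powers beat `n²` despite the logarithms. -/
theorem pow_lower_bound {x : ℝ} (hx0 : 0 ≤ x) (hx1 : x ≤ 1) (n : ℕ) :
    (((n : ℝ) + 1) * x / 4) ^ 4 ≤ (1 + x) ^ n := by
  have h1 := one_add_mul_le_pow (a := x) (by linarith) (n / 4)
  have h2 : (n : ℝ) + 1 ≤ 4 * ((n / 4 : ℕ) + 1) := by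
    have : n + 1 ≤ 4 * (n / 4 + 1) := by omega
    exact_mod_cast this
  calc (((n : ℝ) + 1) * x / 4) ^ 4 ≤ ((1 + x) ^ (n / 4)) ^ 4 := by
        refine pow_le_pow_left₀ (by positivity) ?_ 4
        nlinarith
    _ = (1 + x) ^ (n / 4 * 4) := by rw [pow_mul]
    _ ≤ (1 + x) ^ n := pow_le_pow_right₀ (by linarith) (Nat.div_mul_le_self n 4)

/-- Words of length `O(n)` contribute `O(n⁻²)` to the `n`-th Taylor coefficient. -/
theorem norm_taylorCoeff_short_le {z : ℂ} (hz : z ∈ periodRegion) (K : ℕ) :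
    ∃ C : ℝ, 0 ≤ C ∧ ∀ N n : ℕ, N ≤ K * (n + 1) →
      ‖taylorCoeff n (fun p => wordPeriod N p z)‖ ≤ C / ((n : ℝ) + 1) ^ 2 := by
  obtain ⟨c, hc0, hc⟩ := exists_pow_four_le
  refine ⟨400 * 180000 ^ 4 * c ^ 2 + 100 * K, by positivity, fun N n hN => ?_⟩
  set L := Nat.log 2 (n + 1) + 1 with hL
  have hL1 : n + 1 < 2 ^ L := Nat.lt_pow_succ_log_self one_lt_two _
  have hL2 : 2 ^ L ≤ 2 * (n + 1) := by
    rw [hL, pow_succ, mul_comm]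
    exact Nat.mul_le_mul_left 2 (Nat.pow_log_le_self 2 n.succ_ne_zero)
  have hL1' : (n : ℝ) + 1 ≤ 2 ^ L := by exact_mod_cast hL1.le
  have hL2' : (2 : ℝ) ^ L ≤ 2 * (n + 1) := by exact_mod_cast hL2
  have hLpos : (0 : ℝ) < L := by rw [hL]; positivity
  have hL1le : (1 : ℝ) ≤ L := by exact_mod_cast Nat.le_add_left 1 _
  have hM : (0 : ℝ) < (n : ℝ) + 1 := by positivity
  -- As `2 ^ L ≥ n + 1`, the run length `3L` makes the proportion of long-run words `O(N n⁻³)`,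
  -- hence `O(n⁻²)` for these `N`.
  refine (norm_taylorCoeff_wordPeriod_le hz (A := 3 * L) (by omega) N n).trans ?_
  have e : 1 / (5000 * ((3 * L : ℕ) : ℝ) ^ 2) = 1 / (45000 * (L : ℝ) ^ 2) := by
    push_cast; ring_nf
  rw [e, add_div]
  refine add_le_add ?_ ?_
  · have hx1 : 1 / (45000 * (L : ℝ) ^ 2) ≤ 1 := by
      rw [div_le_one (by positivity)]; nlinarith
    have h1 := pow_lower_bound (x := 1 / (45000 * (L : ℝ) ^ 2)) (by positivity) hx1 n
    have h2 : 0 < (((n : ℝ) + 1) * (1 / (45000 * (L : ℝ) ^ 2)) / 4) ^ 4 := by positivity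
    refine (div_le_div_of_nonneg_left (by norm_num) h2 h1).trans ?_
    have e2 : 100 / (((n : ℝ) + 1) * (1 / (45000 * (L : ℝ) ^ 2)) / 4) ^ 4 =
        100 * 180000 ^ 4 * ((L : ℝ) ^ 4) ^ 2 / ((n : ℝ) + 1) ^ 4 := by
      field_simp; norm_num
    rw [e2, div_le_div_iff₀ (by positivity) (by positivity)]
    have h3 : (L : ℝ) ^ 4 ≤ c * (2 * (n + 1)) := (hc L).trans (by gcongr)
    have h4 : ((L : ℝ) ^ 4) ^ 2 ≤ (c * (2 * (n + 1))) ^ 2 := pow_le_pow_left₀ (by positivity) h3 2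
    calc 100 * 180000 ^ 4 * ((L : ℝ) ^ 4) ^ 2 * ((n : ℝ) + 1) ^ 2 ≤
          100 * 180000 ^ 4 * (c * (2 * (n + 1))) ^ 2 * ((n : ℝ) + 1) ^ 2 := by gcongr
      _ = 400 * 180000 ^ 4 * c ^ 2 * ((n : ℝ) + 1) ^ 4 := by ring
  · have h1 : (N : ℝ) ≤ K * ((n : ℝ) + 1) := by exact_mod_cast hN
    have h2 : ((1 : ℝ) / 2) ^ (3 * L) ≤ 1 / ((n : ℝ) + 1) ^ 3 := by
      rw [one_div_pow, mul_comm 3 L, pow_mul]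
      exact one_div_le_one_div_of_le (by positivity) (pow_le_pow_left₀ hM.le hL1' 3)
    calc 100 * ((N : ℝ) * (1 / 2) ^ (3 * L)) ≤
          100 * (K * ((n : ℝ) + 1) * (1 / ((n : ℝ) + 1) ^ 3)) := by gcongr
      _ = 100 * K / ((n : ℝ) + 1) ^ 2 := by field_simp

/-- For `N ≤ K (n + 1)` the run-length estimate applies. For longer words, `K` is chosen with
`(21/25) ^ K < r / 2`, so that the coefficient differs from its limit by at most `C / 2 ^ n`. -/
theorem exists_dominating_sequence {z : ℂ} (hz : z ∈ periodRegion) : ∃ b : ℕ → ℝ, Summable b ∧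
    (∀ N n : ℕ, ‖taylorCoeff n (fun p => wordPeriod N p z)‖ ≤ b n) ∧
    ∀ n, Tendsto (fun N => taylorCoeff n (fun p => wordPeriod N p z)) atTop
      (𝓝 (periodCoeff n z)) := by
  obtain ⟨r, C, hr, hr1, hC, h⟩ := norm_taylorCoeff_sub_le (ne_two_of_mem_periodRegion hz)
  obtain ⟨K, hK⟩ := exists_pow_lt_of_lt_one (by positivity : 0 < r / 2)
    (by norm_num : (21 / 25 : ℝ) < 1)
  obtain ⟨C', hC', h'⟩ := norm_taylorCoeff_short_le hz K
  have hfar : ∀ N n : ℕ, K * (n + 1) ≤ N →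
      ‖taylorCoeff n (fun p => wordPeriod N p z) - periodCoeff n z‖ ≤ C * (1 / 2) ^ n := by
    intro N n hN
    refine (h N n).trans ?_
    rw [div_le_iff₀ (by positivity), mul_assoc]
    refine mul_le_mul_of_nonneg_left ?_ hC
    calc (21 / 25 : ℝ) ^ N ≤ (21 / 25) ^ (K * (n + 1)) :=
          pow_le_pow_of_le_one (by norm_num) (by norm_num) hN
      _ = ((21 / 25) ^ K) ^ (n + 1) := pow_mul _ _ _
      _ ≤ (r / 2) ^ (n + 1) := pow_le_pow_left₀ (by positivity) hK.le _
      _ ≤ (r / 2) ^ n := pow_le_pow_of_le_one (by positivity) (by linarith) n.le_succ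
      _ = (1 / 2) ^ n * r ^ n := by rw [← mul_pow]; congr 1; ring
  have hlim : ∀ n, Tendsto (fun N => taylorCoeff n (fun p => wordPeriod N p z)) atTop
      (𝓝 (periodCoeff n z)) := fun n =>
    tendsto_of_norm_sub_le_geometric (L := C / r ^ n) fun N => by
      rw [norm_sub_rev, div_mul_eq_mul_div]; exact h N n
  -- The factor `2` arises because long words are compared with words of length `K (n + 1)` through
  -- the limit.
  refine ⟨fun n => C' / ((n : ℝ) + 1) ^ 2 + 2 * C * (1 / 2) ^ n, ?_, fun N n => ?_, hlim⟩
  · refine Summable.add ?_ ((summable_geometric_of_lt_one (by norm_num) (by norm_num)).mul_left _)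
    have := ((summable_nat_add_iff 1).2 (Real.summable_one_div_nat_pow.2 one_lt_two)).mul_left C'
    simpa [div_eq_mul_inv] using this
  · have hCn : 0 ≤ C * (1 / 2) ^ n := by positivity
    have hM := h' (K * (n + 1)) n le_rfl
    have hM' := hfar (K * (n + 1)) n le_rfl
    rcases le_total N (K * (n + 1)) with hN | hN
    · refine (h' N n hN).trans ?_
      linarith
    · have h1 := hfar N n hN
      have h2 := norm_sub_norm_le (taylorCoeff n (fun p => wordPeriod N p z)) (periodCoeff n z)
      have h3 := norm_sub_norm_le (periodCoeff n z)
        (taylorCoeff n (fun p => wordPeriod (K * (n + 1)) p z))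
      rw [norm_sub_rev] at h3
      linarith

/-- Dominated convergence for series: for each `N` the alternating sum is `wordPeriod N 1 z`, which
tends to `dyadicPeriod z`, while the terms tend to `(-1) ^ n * periodCoeff n z`. -/
theorem hasSum_periodCoeff {z : ℂ} (hz : z ∈ periodRegion) :
    (Summable fun n : ℕ => ‖(-1) ^ n * periodCoeff n z‖) ∧
      HasSum (fun n : ℕ => (-1) ^ n * periodCoeff n z) (dyadicPeriod z) := by
  obtain ⟨b, hb, hN, hlim⟩ := exists_dominating_sequence hz
  have hnorm : ∀ (n : ℕ) (w : ℂ), ‖(-1) ^ n * w‖ = ‖w‖ := fun n w => by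
    rw [norm_mul, norm_pow, norm_neg, norm_one, one_pow, one_mul]
  have hs : Summable fun n : ℕ => ‖(-1) ^ n * periodCoeff n z‖ := by
    refine Summable.of_nonneg_of_le (fun _ => norm_nonneg _) (fun n => ?_) hb
    rw [hnorm]
    exact le_of_tendsto' (hlim n).norm fun N => hN N n
  have h1 := tendsto_tsum_of_dominated_convergence (𝓕 := atTop)
    (f := fun N n => (-1) ^ n * taylorCoeff n (fun p => wordPeriod N p z))
    (g := fun n => (-1) ^ n * periodCoeff n z) hb
    (fun n => (hlim n).const_mul _)
    (Eventually.of_forall fun N n => by rw [hnorm]; exact hN N n)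
  simp only [(hasSum_wordPeriod_one hz _).tsum_eq] at h1
  refine ⟨hs, ?_⟩
  rw [tendsto_nhds_unique (tendsto_wordPeriod_one hz) h1]
  exact hs.of_norm.hasSum

theorem theorem1p1 :
    ∃ B : ℕ → ℚ[X],
      -- the sequence is given by the recurrence, and the recurrence determines it
      IsRatHRecurrence B ∧ (∀ B' : ℕ → ℚ[X], IsRatHRecurrence B' → B' = B) ∧
      -- degrees
      B 0 = -1 ∧ B 1 = 0 ∧ (∀ n : ℕ, 2 ≤ n → (B n).natDegree = n - 1) ∧
      -- reciprocity
      (∀ n : ℕ, 1 ≤ n → (B n).eval 0 = 0 ∧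
        ∀ z : ℂ, z ≠ 0 →
          aeval (z + 1) (B n) = (-1) ^ n * z ^ (n - 1) * aeval (1 / z + 1) (B n)) ∧
      -- the `Hₙ(z)` are the Taylor coefficients of `p ↦ G(p, z)` at `p = 2`
      (∀ᶠ p : ℂ in 𝓝 2, ∀ x : ℝ, 0 ≤ x →
        Tendsto (fun n => pConvergent p n x) atTop (𝓝 (pContFract p x))) ∧
      (∀ z : ℂ, z ≠ 2 →
        (∀ᶠ p : ℂ in 𝓝 2, IntegrableOn (fun x : ℝ => 1 / (pContFract p x + 1 - z))
          (Set.Ici 0) questionMarkMeasure) ∧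
        AnalyticAt ℂ (fun p => pPeriod p z) 2 ∧
        ∀ n : ℕ, iteratedDeriv n (fun p => pPeriod p z) 2 / (n.factorial : ℂ) = ratH B n z) ∧
      -- the absolutely convergent expansion of the dyadic period function
      (∀ z : ℂ, ‖z‖ ≤ 3 / 4 ∨ ‖z + 9 / 7‖ ≤ 12 / 7 →
        IntegrableOn (fun x : ℝ => 1 / ((x : ℂ) + 1 - z)) (Set.Ici 0) questionMarkMeasure ∧
        (Summable fun n : ℕ => ‖(-1) ^ n * ratH B n z‖) ∧
        HasSum (fun n : ℕ => (-1) ^ n * ratH B n z) (dyadicPeriod z)) := by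
  choose B hB using periodPoly_rational
  obtain ⟨hrec, hH⟩ := isRatHRecurrence_of_map_eq hB
  have hinj := Polynomial.map_injective _ (algebraMap ℚ ℂ).injective
  refine ⟨B, hrec, fun B' hB' => hrec.unique hB', hrec.zero, ?_, fun n hn => ?_,
    fun n hn => ⟨?_, fun z hz => ?_⟩, ?_, fun z hz => ⟨?_, analyticAt_pPeriod hz, fun n => ?_⟩,
    fun z hz => ?_⟩
  · exact hinj (by rw [hB, periodPoly_one, Polynomial.map_zero])
  · obtain ⟨m, rfl⟩ := Nat.exists_eq_add_of_le' hn
    have h1 := periodPoly_coeff_ne_zero m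
    have h2 := hrec.degree_lt (m + 2) (by omega)
    rw [← hB, coeff_map] at h1
    have h3 : (B (m + 2)).coeff (m + 1) ≠ 0 := fun h => h1 (by rw [h, map_zero])
    have h4 := le_natDegree_of_ne_zero h3
    have h5 : B (m + 2) ≠ 0 := by rintro h; rw [h, coeff_zero] at h3; exact h3 rfl
    rw [degree_eq_natDegree h5] at h2
    have h6 : (B (m + 2)).natDegree < m + 2 := by exact_mod_cast h2
    omega
  · have h := periodPoly_eval_zero hn
    rw [← hB, eval_map_algebraMap] at h
    have h' := aeval_ratCast (B n) 0
    rw [Rat.cast_zero, h] at h'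
    exact_mod_cast h'.symm
  · have h := periodPoly_reciprocity hn hz
    rwa [← hB, eval_map_algebraMap, eval_map_algebraMap] at h
  · filter_upwards [eventually_near_two (r := 1 / 20) (by norm_num)] with p hp x _
    exact tendsto_pConvergent hp x
  · filter_upwards [eventually_nearTwo hz] with p hp using integrableOn_pPeriod hz hp
  · rw [hH]
    exact taylorCoeff_pPeriod hz n
  · have h := hasSum_periodCoeff (z := z) hz
    simp only [hH]
    exact ⟨integrableOn_dyadicPeriod hz, h⟩
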